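/- **Setting.** Let $\Gamma\cong\mathbb Z^{r}$ be a lattice with basis $\gamma^a$ and an integral skew-symmetric form $\langle\cdot,\cdot\rangle$, $Z:\Gamma\to\mathbb C$ a homomorphism, and $\Omega(\gamma,y)\in\mathbb Q[y^{\pm1}]$ ($\gamma\in\Gamma$) refined BPS indices with $\Omega(-\gamma,y)=\Omega(\gamma,y)$ and the support property: for some $C>0$, $\Omega(\gamma)\neq0$ implies $|Z_\gamma|>C\|\gamma\|$. Let $\sigma_\gamma=\pm1$ satisfy $\sigma_\gamma\sigma_{\gamma'}=(-1)^{\langle\gamma,\gamma'\rangle}\sigma_{\gamma+\gamma'}$. Let $$\bar\Omega(\gamma,y)=\sum_{d|\gamma}\frac1d\,\frac{y-y^{-1}}{y^d-y^{-d}}\,\Omega(\gamma/d,y^d),\qquad \bar\Omega(\gamma)=\sum_{d|\gamma}\frac1{d^2}\,\Omega(\gamma/d,1),$$ $\ell_\gamma=\{t: Z_\gamma/t\in i\mathbb R^-\}$, and $X^{\rm sf}_\gamma(t)=e^{2\pi i(\theta_\gamma-Z_\gamma/t)}$, a function of the complex coordinates $\theta^a=\theta_{\gamma^a}$, where $\theta_\gamma$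 is additive in $\gamma$. Put $y=e^{2\pi i\alpha}$, $\omega_{ab}=\langle\gamma^a,\gamma^b\rangle$, $$f\star g=f\exp\Big[\frac{\alpha}{2\pi i}\sum_{a,b}\omega_{ab}\overleftarrow{\partial}_{\theta^a}\overrightarrow{\partial}_{\theta^b}\Big]g,\qquad \{f,g\}_\star=\frac{f\star g-g\star f}{y-y^{-1}},\qquad \{f,g\}=\frac1{(2\pi i)^2}\sum_{a,b}\omega_{ab}\,\partial_{\theta^a}f\,\partial_{\theta^b}g .$$ Write $X^{\rm sf}_i=X^{\rm sf}_{\gamma_i}(t_i)$, $\mathcal K_{ij}=t_it_j/(t_j-t_i)$, and $$\oint_i=\sum_{\gamma_i\in\Gamma\setminus 0}\frac{\sigma_{\gamma_i}\bar\Omega(\gamma_i,y)}{2\pi i}\int_{\ell_{\gamma_i}}\frac{dt_i}{t_i^2},$$ and $\oint_i^{\rm cl}$ for the same operation with $\bar\Omega(\gamma_i)$ in place of $\bar\Omega(\gamma_i,y)$. All objects are formal power series in the rational BPS indices (one bookkeeping variable for each nonzero charge), and equalities and limits hold coefficient by coefficient and pointwise in $\theta$. In nested integrals, contours lying on the same ray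 are slightly displaced and one averages over all their relative orderings: each contour is rotated by an independent uniformly distributed angle in $(-\varepsilon,\varepsilon)$, one averages, and lets $\varepsilon\to0^+$. The point $t=t_0\in\mathbb C^\times$ lies on no ray $\ell_\gamma$ with $\Omega(\gamma)\ne0$. Let $X^{\rm ref}_\gamma$ be the solution, by iteration, of $X^{\rm ref}_0=X^{\rm sf}_0\star\big(1+\oint_1\frac{\mathcal K_{01}}{y-y^{-1}}X^{\rm ref}_1\big)$, and put $$J^{\rm ref}(t_0)=\oint_1\frac{\mathcal K_{01}}{y-y^{-1}}X^{\rm ref}_1,\qquad X_\gamma=(1+J^{\rm ref})_\star^{-1}\star X^{\rm ref}_\gamma,\qquad H^{\rm ref}=(y-y^{-1})\log_\star(1+J^{\rm ref}),$$ where $(1+A)_\star^{-1}=\sum_{n\ge0}(-1)^nA^{\star n}$ and $\log_\star(1+A)=\sum_{n\ge1}\frac{(-1)^{n-1}}nA^{\star n}$. Let $\mathcal X_\gamma$ be the classical Darboux coordinates, i.e. the solution, by iteration, of $\mathcal X_0=X^{\rm sf}_0\exp\big[\oint_1^{\rm cl}\langle\gamma_0,\gamma_1\rangle\mathcal K_{01}\mathcal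 X_1\big]$. **Statement.** (i) Let $y$ be generic (not a root of unity). The nested integrals defining $J^{\rm ref}$ and $X^{\rm ref}_\gamma$ exist. The charge-independent function $H^{\rm ref}$ satisfies, for every $\gamma\in\Gamma$, $$X_\gamma=e^{-\{H^{\rm ref},\,\cdot\,\}_\star}X^{\rm sf}_\gamma,$$ and $$H^{\rm ref}=\sum_{n\ge1}\Big[\prod_{k=1}^n\oint_k\mathcal K_{k-1,k}\Big]\sum_{\sigma\in S_n}\frac{(-1)^{s_\sigma+1}}{\binom n{s_\sigma}\,n\,s_\sigma}\Big\{\cdots\big\{X^{\rm sf}_{\sigma(1)},X^{\rm sf}_{\sigma(2)}\big\}_\star,\cdots,X^{\rm sf}_{\sigma(n)}\Big\}_\star ,$$ where $s_\sigma$ is the number of ascending runs of $\sigma$, that is, $1$ plus the number of $1\le i\le n-1$ with $\sigma(i)>\sigma(i+1)$; in particular the nested integrals on the right exist. (ii) The limit $H=\lim_{y\to1}H^{\rm ref}$ (that is, $\alpha\to0$, $\alpha\neq0$) exists and is given by the series in (i) with $\{\cdot,\cdot\}_\star$ and $\bar\Omega(\gamma,y)$ replaced by $\{\cdot,\cdot\}$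 and $\bar\Omega(\gamma)$. The nested integrals defining $\mathcal X_\gamma$ exist, and for every $\gamma\in\Gamma$ $$\lim_{y\to1}X_\gamma=\mathcal X_\gamma=e^{-\{H,\,\cdot\,\}}X^{\rm sf}_\gamma .$$ -/

import Mathlib

open Filter Topology MeasureTheory

noncomputable section

namespace QRH

/-- The charge lattice `Γ ≅ ℤ^r`, with the basis `γ^a` given by the coordinate vectors. -/
abbrev Charge (r : ℕ) := Fin r → ℤ

/-- The nonzero charges `Γ_⋆`. -/
abbrev NZCharge (r : ℕ) := {γ : Charge r // γ ≠ 0}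

/-- Functions of the complex coordinates `θ^a = θ_{γ^a}`, `a = 1, …, r`. -/
abbrev Obs (r : ℕ) := (Fin r → ℂ) → ℂ

/-- Formal power series in the (rational) BPS indices: there is one indeterminate for every
nonzero charge `γ`, which accompanies each factor `Ω̄(γ)`; the coefficients are functions of `θ`. -/
abbrev Formal (r : ℕ) := MvPowerSeries (NZCharge r) (Obs r)

/-- A refined BPS structure on `Γ = ℤ^r` together with a quadratic refinement. -/
structure RefinedBPS (r : ℕ) where
  /-- the skew-symmetric Dirac product -/
  pairing : LinearMap.BilinForm ℤ (Charge r)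
  pairing_skew : ∀ γ γ' : Charge r, pairing γ γ' = -pairing γ' γ
  /-- the central charge -/
  Z : Charge r →+ ℂ
  /-- the refined BPS indices, Laurent polynomials in `y` -/
  Ω : Charge r → LaurentPolynomial ℚ
  Ω_neg : ∀ γ : Charge r, Ω (-γ) = Ω γ
  /-- the support property -/
  support : ∃ C : ℝ, 0 < C ∧ ∀ γ : Charge r, Ω γ ≠ 0 → C * ‖γ‖ < ‖Z γ‖
  /-- the quadratic refinement -/
  sgn : Charge r → ℤˣ
  sgn_mul : ∀ γ γ' : Charge r, sgn γ * sgn γ' = (-1) ^ (pairing γ γ') * sgn (γ + γ')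

variable {r : ℕ}

/-! ### Formal series -/

/-- Extension of a bilinear operation on functions of `θ` to formal series (Cauchy product). -/
def lift₂ (op : Obs r → Obs r → Obs r) (A B : Formal r) : Formal r :=
  fun m => ∑ p ∈ Finset.HasAntidiagonal.antidiagonal m, op (A p.1) (B p.2)

/-- The sum of a sequence of formal series such that the `n`-th one starts in total degree
at least `n`. In total degree `d` only the terms `n ≤ d` contribute. -/
def formalSum (A : ℕ → Formal r) : Formal r :=
  fun m => ∑ n ∈ Finset.range (m.degree + 1), A n m

/-- Powers with respect to a product. -/
def opPow (mul : Formal r → Formal r → Formal r) (A : Formal r) : ℕ → Formal r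
  | 0 => 1
  | n + 1 => mul A (opPow mul A n)

/-- `log (1 + A) = ∑_{n ≥ 1} (-1)^{n-1} A^n / n` for `A` without constant term. -/
def logOneAdd (mul : Formal r → Formal r → Formal r) (A : Formal r) : Formal r :=
  formalSum fun n => if n = 0 then 0 else ((-1 : ℂ) ^ (n + 1) / (n : ℂ)) • opPow mul A n

/-- `(1 + A)⁻¹ = ∑_{n ≥ 0} (-1)^n A^n` for `A` without constant term. -/
def invOneAdd (mul : Formal r → Formal r → Formal r) (A : Formal r) : Formal r :=
  formalSum fun n => ((-1 : ℂ) ^ n) • opPow mul A n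

/-- The commutative exponential `∑_{n ≥ 0} A^n / n!` for `A` without constant term. -/
def expFormal (A : Formal r) : Formal r :=
  formalSum fun n => ((n.factorial : ℂ)⁻¹) • A ^ n

/-- `exp (-{H, ·}) A = ∑_{n ≥ 0} (-1)^n/n! {H, {H, … {H, A}}}` for `H` without constant term. -/
def expNegBracket (br : Formal r → Formal r → Formal r) (H A : Formal r) : Formal r :=
  formalSum fun n => ((-1 : ℂ) ^ n / (n.factorial : ℂ)) • (br H)^[n] A

/-- The left-nested bracket `{ … {{f₁, f₂}, f₃}, …, f_n}` of a list. -/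
def leftNested (br : Obs r → Obs r → Obs r) : List (Obs r) → Obs r
  | [] => 0
  | f :: l => l.foldl br f

/-- The number `s_σ` of ascending runs of a permutation: one plus the number of descents
`σ(i) > σ(i+1)`. -/
def ascRuns {n : ℕ} (σ : Equiv.Perm (Fin n)) : ℕ :=
  1 + (Finset.univ.filter fun i : Fin n => ∃ h : i.val + 1 < n, σ ⟨i.val + 1, h⟩ < σ i).card

/-- The function
`∑_{σ ∈ S_n} (-1)^{s_σ+1} / (binom(n, s_σ) n s_σ) {…{f_{σ(1)}, f_{σ(2)}}, …, f_{σ(n)}}`. -/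
def runSum (br : Obs r → Obs r → Obs r) (n : ℕ) (f : Fin n → Obs r) : Obs r :=
  ∑ σ : Equiv.Perm (Fin n),
    ((-1 : ℂ) ^ (ascRuns σ + 1) / ((n.choose (ascRuns σ) : ℂ) * (n : ℂ) * (ascRuns σ : ℂ))) •
      leftNested br (List.ofFn fun i => f (σ i))

/-- The kernel `𝒦_{01} = t₀ t₁ / (t₁ - t₀)`. -/
def kern (t₀ t₁ : ℂ) : ℂ := t₀ * t₁ / (t₁ - t₀)

/-- The refinement parameter `y = exp (2πiα)`. -/
def yy (α : ℂ) : ℂˣ := Units.mk0 (Complex.exp (2 * Real.pi * Complex.I * α)) (Complex.exp_ne_zero _)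

/-- `y - y⁻¹`. -/
def yGap (α : ℂ) : ℂ := (yy α : ℂ) - ((yy α)⁻¹ : ℂˣ)

/-- `y` is generic: not a root of unity. -/
def Generic (α : ℂ) : Prop := ∀ k : ℕ, 0 < k → yy α ^ k ≠ 1

namespace RefinedBPS

variable (D : RefinedBPS r)

/-! ### Star product and brackets -/

/-- `ω_{ab} = ⟨γ^a, γ^b⟩`. -/
def om (a b : Fin r) : ℂ := ((D.pairing (Pi.single a 1) (Pi.single b 1) : ℤ) : ℂ)

/-- The Moyal product
`f ⋆ g = f exp (α/(2πi) ∑_{a,b} ω_{ab} ∂⃖_{θ^a} ∂⃗_{θ^b}) g`. -/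
def moyal (α : ℂ) (f g : Obs r) : Obs r := fun θ =>
  ∑' k : ℕ, (α / (2 * Real.pi * Complex.I)) ^ k / (k.factorial : ℂ) *
    ∑ a : Fin k → Fin r, ∑ b : Fin k → Fin r, (∏ i, D.om (a i) (b i)) *
      (iteratedFDeriv ℂ k f θ (fun i => Pi.single (a i) 1) *
        iteratedFDeriv ℂ k g θ (fun i => Pi.single (b i) 1))

/-- The star bracket `{f, g}_⋆ = (f ⋆ g - g ⋆ f) / (y - y⁻¹)`. -/
def starBr (α : ℂ) (f g : Obs r) : Obs r :=
  (yGap α)⁻¹ • (D.moyal α f g - D.moyal α g f)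

/-- The Poisson bracket `{f, g} = (2πi)⁻² ∑_{a,b} ω_{ab} ∂_{θ^a} f ∂_{θ^b} g`, normalised so that
`{X^sf_γ, X^sf_γ'} = ⟨γ, γ'⟩ X^sf_γ X^sf_γ'`. -/
def poissonBr (f g : Obs r) : Obs r := fun θ =>
  ((2 * Real.pi * Complex.I) ^ 2)⁻¹ * ∑ a : Fin r, ∑ b : Fin r,
    D.om a b * (fderiv ℂ f θ (Pi.single a 1) * fderiv ℂ g θ (Pi.single b 1))

/-- The star product of formal series. -/
def starMul (α : ℂ) : Formal r → Formal r → Formal r := lift₂ (D.moyal α)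

/-! ### BPS indices, rays and the sum-integral -/

/-- The value of `Ω(γ, y)` at a nonzero complex number `y`. -/
def OmegaAt (γ : Charge r) (u : ℂˣ) : ℂ := LaurentPolynomial.eval₂ (algebraMap ℚ ℂ) u (D.Ω γ)

/-- The rational refined BPS indices
`Ω̄(γ, y) = ∑_{d ∣ γ} (1/d) (y - y⁻¹)/(y^d - y^{-d}) Ω(γ/d, y^d)`. -/
def OmegaBar (α : ℂ) (γ : Charge r) : ℂ :=
  ∑ d ∈ (Finset.univ.gcd γ).natAbs.divisors,
    (1 / (d : ℂ)) * (yGap α / (((yy α) ^ d : ℂˣ) - (((yy α) ^ d)⁻¹ : ℂˣ))) *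
      D.OmegaAt (fun a => γ a / (d : ℤ)) ((yy α) ^ d)

/-- The rational BPS indices `Ω̄(γ) = ∑_{d ∣ γ} Ω(γ/d) / d²`, with `Ω(γ) = Ω(γ, y = 1)`. -/
def OmegaBarCl (γ : Charge r) : ℂ :=
  ∑ d ∈ (Finset.univ.gcd γ).natAbs.divisors,
    (1 / (d : ℂ) ^ 2) * D.OmegaAt (fun a => γ a / (d : ℤ)) 1

/-- The BPS ray `ℓ_γ = {t : Z_γ / t ∈ i ℝ⁻}`. -/
def ray (γ : Charge r) : Set ℂ :=
  {t | t ≠ 0 ∧ ∃ x : ℝ, x < 0 ∧ D.Z γ / t = Complex.I * (x : ℂ)}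

/-- `t` is a point of `ℂ^×` which lies on no active BPS ray. -/
def OffRays (t : ℂ) : Prop := t ≠ 0 ∧ ∀ γ : Charge r, D.Ω γ ≠ 0 → t ∉ D.ray γ

/-- The point with parameter `ρ > 0` on the ray `ℓ_γ` rotated by the angle `φ`. -/
def rayPt (γ : Charge r) (φ ρ : ℝ) : ℂ :=
  Complex.I * D.Z γ * Complex.exp (Complex.I * (φ : ℂ)) * (ρ : ℂ)

/-- `∫_{ℓ_γ} dt/t² f(t)` with a displaced contour: the average over `φ ∈ (-ε, ε)` of the integrals
along the ray `ℓ_γ` rotated by `φ`, oriented from `0` to `∞`. -/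
def rayInt (ε : ℝ) (γ : Charge r) (f : ℂ → ℂ) : ℂ :=
  (1 / (2 * ε : ℂ)) * ∫ p in Set.Ioo (-ε) ε ×ˢ Set.Ioi (0 : ℝ),
    f (D.rayPt γ p.1 p.2) / (D.rayPt γ p.1 p.2) ^ 2 *
      (Complex.I * D.Z γ * Complex.exp (Complex.I * (p.1 : ℂ)))

/-- The weighted sum-integral
`∑_{γ ∈ Γ_⋆} σ_γ Ω̄(γ) / (2πi) ∫_{ℓ_γ} dt/t² F_γ(t)`, where `W` stands for `Ω̄`; each `Ω̄(γ)` comes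
with the indeterminate of `γ`. In a nested sum-integral every contour is displaced independently,
so that for `ε → 0` one gets the average over all relative orderings of the contours
that lie on a common ray. -/
def sumInt (W : Charge r → ℂ) (ε : ℝ) (F : NZCharge r → ℂ → Formal r) : Formal r :=
  fun m θ => ∑ γ ∈ m.support,
    (((D.sgn γ.1 : ℤ) : ℂ) * W γ.1 / (2 * Real.pi * Complex.I)) *
      D.rayInt ε γ.1 (fun t => F γ t (m - Finsupp.single γ 1) θ)

/-- The semi-flat functions `X^sf_γ(t) = exp (2πi (θ_γ - Z_γ / t))`. -/
def Xsf (γ : Charge r) (t : ℂ) : Obs r := fun θ =>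
  Complex.exp (2 * Real.pi * Complex.I * ((∑ a, (γ a : ℂ) * θ a) - D.Z γ / t))

/-- `X^sf_γ(t)` as a formal series of degree zero. -/
def XsfF (γ : Charge r) (t : ℂ) : Formal r := MvPowerSeries.C (D.Xsf γ t)

/-! ### The functions `X^ref`, `J^ref`, `X`, `H^ref` -/

/-- The right-hand side `X^sf_0 ⋆ (1 + ∑∫_1 𝒦_{01}/(y - y⁻¹) X_1)` of the integral equation. -/
def refStep (α : ℂ) (ε : ℝ) (X : Charge r → ℂ → Formal r) (γ : Charge r) (t : ℂ) : Formal r :=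
  D.starMul α (D.XsfF γ t)
    (1 + D.sumInt (D.OmegaBar α) ε fun γ₁ t₁ => (kern t t₁ / yGap α) • X γ₁.1 t₁)

/-- The solution of the integral equation `X = refStep X` by iteration (see `XrefReg_eq`). -/
def XrefReg (α : ℂ) (ε : ℝ) (γ : Charge r) (t : ℂ) : Formal r :=
  fun m => (D.refStep α ε)^[m.degree + 1] 0 γ t m

/-- `J^ref(t₀) = ∑∫_1 𝒦_{01}/(y - y⁻¹) X^ref_1` with displaced contours. -/
def JrefReg (α : ℂ) (ε : ℝ) (t : ℂ) : Formal r :=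
  D.sumInt (D.OmegaBar α) ε fun γ₁ t₁ => (kern t t₁ / yGap α) • D.XrefReg α ε γ₁.1 t₁

/-- `X^ref_γ(t)`. -/
def Xref (α : ℂ) (γ : Charge r) (t : ℂ) : Formal r :=
  fun m θ => limUnder (𝓝[>] (0 : ℝ)) fun ε => D.XrefReg α ε γ t m θ

/-- `J^ref(t)`. -/
def Jref (α : ℂ) (t : ℂ) : Formal r :=
  fun m θ => limUnder (𝓝[>] (0 : ℝ)) fun ε => D.JrefReg α ε t m θ

/-- `X_γ(t) = (1 + J^ref(t))_⋆⁻¹ ⋆ X^ref_γ(t)`. -/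
def X (α : ℂ) (γ : Charge r) (t : ℂ) : Formal r :=
  D.starMul α (invOneAdd (D.starMul α) (D.Jref α t)) (D.Xref α γ t)

/-- `H^ref(t) = (y - y⁻¹) log_⋆ (1 + J^ref(t))`. -/
def Href (α : ℂ) (t : ℂ) : Formal r :=
  yGap α • logOneAdd (D.starMul α) (D.Jref α t)

/-! ### Series of nested brackets -/

/-- `[∏_{k=1}^n ∑∫_k 𝒦_{k-1,k}] F((γ₁, t₁), …, (γ_n, t_n))`. -/
def chainInt (W : Charge r → ℂ) (ε : ℝ) :
    (n : ℕ) → ℂ → ((Fin n → NZCharge r × ℂ) → Obs r) → Formal r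
  | 0, _, F => MvPowerSeries.C (F Fin.elim0)
  | n + 1, t, F => D.sumInt W ε fun γ₁ t₁ =>
      kern t t₁ • chainInt W ε n t₁ fun v => F (Fin.cons (γ₁, t₁) v)

/-- `∑_{n ≥ 1} [∏_{k=1}^n ∑∫_k 𝒦_{k-1,k}] ∑_{σ ∈ S_n} (-1)^{s_σ+1} / (binom(n, s_σ) n s_σ)
{…{X^sf_{σ(1)}, X^sf_{σ(2)}}, …, X^sf_{σ(n)}}` for a given bracket, with displaced contours. -/
def bracketSeries (br : Obs r → Obs r → Obs r) (W : Charge r → ℂ) (ε : ℝ) (t : ℂ) : Formal r :=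
  formalSum fun n => if n = 0 then 0 else
    D.chainInt W ε n t fun v => runSum br n fun i => D.Xsf (v i).1.1 (v i).2

/-! ### The classical side -/

/-- The right-hand side `X^sf_0 exp (∑∫_1 γ_{01} 𝒦_{01} X_1)` of the classical TBA equation. -/
def tbaStep (ε : ℝ) (X : Charge r → ℂ → Formal r) (γ : Charge r) (t : ℂ) : Formal r :=
  D.XsfF γ t * expFormal (D.sumInt D.OmegaBarCl ε fun γ₁ t₁ =>
    (((D.pairing γ γ₁.1 : ℤ) : ℂ) * kern t t₁) • X γ₁.1 t₁)

/-- The solution of the TBA equation `X = tbaStep X` by iteration (see `XclReg_eq`). -/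
def XclReg (ε : ℝ) (γ : Charge r) (t : ℂ) : Formal r :=
  fun m => (D.tbaStep ε)^[m.degree + 1] 0 γ t m

/-- The classical Darboux coordinates `𝒳_γ(t)`. -/
def Xcl (γ : Charge r) (t : ℂ) : Formal r :=
  fun m θ => limUnder (𝓝[>] (0 : ℝ)) fun ε => D.XclReg ε γ t m θ

/-- `ℋ(t) = lim_{y → 1} H^ref(t)`. -/
def Hcl (t : ℂ) : Formal r :=
  fun m θ => limUnder (𝓝[≠] (0 : ℂ)) fun α => D.Href α t m θ

/-! ### The iterations do solve the equations -/

/-- Two families of formal series agree in total degree less than `N`. -/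
def AgreeBelow (N : ℕ) (X Y : Charge r → ℂ → Formal r) : Prop :=
  ∀ γ t (m : NZCharge r →₀ ℕ), m.degree < N → X γ t m = Y γ t m

theorem sumInt_congr (W : Charge r → ℂ) (ε : ℝ) {N : ℕ} {X Y : Charge r → ℂ → Formal r}
    (h : AgreeBelow N X Y) (c : NZCharge r → ℂ → ℂ) (m : NZCharge r →₀ ℕ)
    (hm : m.degree < N + 1) :
    D.sumInt W ε (fun γ₁ t₁ => c γ₁ t₁ • X γ₁.1 t₁) m =
      D.sumInt W ε (fun γ₁ t₁ => c γ₁ t₁ • Y γ₁.1 t₁) m := by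
  funext θ
  refine Finset.sum_congr rfl fun γ hγ => ?_
  have hd : (m - Finsupp.single γ 1).degree < N := by
    have h1 : m - Finsupp.single γ 1 + Finsupp.single γ 1 = m := by
      apply tsub_add_cancel_of_le
      rw [Finsupp.single_le_iff]
      exact Nat.one_le_iff_ne_zero.mpr (Finsupp.mem_support_iff.mp hγ)
    have h2 := congrArg Finsupp.degree h1
    rw [map_add, Finsupp.degree_single] at h2
    omega
  have key : ∀ t, (c γ t • X γ.1 t) (m - Finsupp.single γ 1) θ =
      (c γ t • Y γ.1 t) (m - Finsupp.single γ 1) θ := fun t => by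
    change c γ t • X γ.1 t (m - Finsupp.single γ 1) θ = c γ t • Y γ.1 t (m - Finsupp.single γ 1) θ
    rw [h γ.1 t _ hd]
  simp only [key]

theorem degree_le_of_antidiagonal {m : NZCharge r →₀ ℕ}
    {p : (NZCharge r →₀ ℕ) × (NZCharge r →₀ ℕ)} (hp : p ∈ Finset.HasAntidiagonal.antidiagonal m) :
    p.1.degree ≤ m.degree ∧ p.2.degree ≤ m.degree := by
  rw [Finset.HasAntidiagonal.mem_antidiagonal] at hp
  rw [← hp, map_add]
  omega

theorem refStep_agree (α : ℂ) (ε : ℝ) {N : ℕ} {X Y : Charge r → ℂ → Formal r}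
    (h : AgreeBelow N X Y) : AgreeBelow (N + 1) (D.refStep α ε X) (D.refStep α ε Y) := by
  intro γ t m hm
  refine Finset.sum_congr rfl fun p hp => ?_
  have hp2 := (degree_le_of_antidiagonal hp).2
  have := D.sumInt_congr (D.OmegaBar α) ε h (fun _ t₁ => kern t t₁ / yGap α) p.2 (by omega)
  congr 1
  exact congrArg (fun z => (1 : Formal r) p.2 + z) this

theorem pow_congr {A B : Formal r} {N : ℕ} (h : ∀ m, m.degree < N → A m = B m) (n : ℕ) :
    ∀ m, m.degree < N → (A ^ n) m = (B ^ n) m := by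
  classical
  induction n with
  | zero => intro m _; simp
  | succ n ih =>
    intro m hm
    have e : ∀ C : Formal r, (C ^ (n + 1)) m = ∑ p ∈ Finset.HasAntidiagonal.antidiagonal m, (C ^ n) p.1 * C p.2 :=
      fun C => by rw [pow_succ]; exact MvPowerSeries.coeff_mul m (C ^ n) C
    rw [e, e]
    refine Finset.sum_congr rfl fun p hp => ?_
    have := degree_le_of_antidiagonal hp
    rw [ih p.1 (by omega), h p.2 (by omega)]

theorem tbaStep_agree (ε : ℝ) {N : ℕ} {X Y : Charge r → ℂ → Formal r}
    (h : AgreeBelow N X Y) : AgreeBelow (N + 1) (D.tbaStep ε X) (D.tbaStep ε Y) := by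
  classical
  intro γ t m hm
  have e : ∀ A B : Formal r, (A * B) m = ∑ p ∈ Finset.HasAntidiagonal.antidiagonal m, A p.1 * B p.2 :=
    fun A B => MvPowerSeries.coeff_mul m A B
  unfold tbaStep
  rw [e, e]
  refine Finset.sum_congr rfl fun p hp => ?_
  have hp2 := (degree_le_of_antidiagonal hp).2
  congr 1
  unfold expFormal formalSum
  refine Finset.sum_congr rfl fun n _ => ?_
  exact congrArg (fun z => ((n.factorial : ℂ)⁻¹) • z) (pow_congr
    (fun q hq => D.sumInt_congr D.OmegaBarCl ε h
      (fun γ₁ t₁ => ((D.pairing γ γ₁.1 : ℤ) : ℂ) * kern t t₁) q hq) n p.2 (by omega))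

theorem iterate_agree {S : (Charge r → ℂ → Formal r) → Charge r → ℂ → Formal r}
    (hS : ∀ N X Y, AgreeBelow N X Y → AgreeBelow (N + 1) (S X) (S Y)) (N k : ℕ) :
    AgreeBelow N (S^[N] 0) (S^[N + k] 0) := by
  induction N with
  | zero => intro γ t m hm; omega
  | succ N ih =>
    rw [show N + 1 + k = (N + k) + 1 by omega, Function.iterate_succ_apply',
      Function.iterate_succ_apply']
    exact hS N _ _ ih

theorem iterate_fixed {S : (Charge r → ℂ → Formal r) → Charge r → ℂ → Formal r}
    (hS : ∀ N X Y, AgreeBelow N X Y → AgreeBelow (N + 1) (S X) (S Y)) :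
    (fun γ t m => S^[m.degree + 1] 0 γ t m : Charge r → ℂ → Formal r) =
      S (fun γ t m => S^[m.degree + 1] 0 γ t m) := by
  funext γ t m
  have h : AgreeBelow m.degree (S^[m.degree] 0) (fun γ t m => S^[m.degree + 1] 0 γ t m) := by
    intro γ' t' q hq
    obtain ⟨k, hk⟩ := Nat.exists_eq_add_of_le (Nat.succ_le_of_lt hq)
    have := iterate_agree hS (q.degree + 1) k γ' t' q (Nat.lt_succ_self _)
    rw [hk]
    exact this.symm
  have := hS _ _ _ h γ t m (Nat.lt_succ_self _)
  rw [← this, Function.iterate_succ_apply']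

/-- `X^ref` solves its integral equation `X^ref_0 = X^sf_0 ⋆ (1 + ∑∫_1 K^ref_{01} X^ref_1)`. -/
theorem XrefReg_eq (α : ℂ) (ε : ℝ) : D.XrefReg α ε = D.refStep α ε (D.XrefReg α ε) :=
  iterate_fixed fun _ _ _ h => D.refStep_agree α ε h

/-- The classical functions solve the TBA equation `𝒳_0 = X^sf_0 exp (∑∫_1 K_{01} 𝒳_1)`. -/
theorem XclReg_eq (ε : ℝ) : D.XclReg ε = D.tbaStep ε (D.XclReg ε) :=
  iterate_fixed fun _ _ _ h => D.tbaStep_agree ε h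

end RefinedBPS

end QRH

end

set_option linter.unusedSectionVars false

noncomputable section

/-! Solving the integral equations by iteration turns every object into a sum over words w = γ₁…γ_n
of charges. The coefficient of a word is an algebraic constant times an iterated integral χ(w) of
the kernels and of the exponential factors of X^sf along the rays.

Analysis supplies two facts about χ. First, with K(t,s) = t/(s−t), the partial fraction identity
K(t,s)K(t,s') = K(t,s)K(s,s') + K(t,s')K(s',s) turns a product of iterated integrals into a sum over
shuffles, so χ is a character of the shuffle algebra (`isShuffleChar_wordInt`). Averaging over
independent angles makes each integral two-dimensional, where the poles are absolutely integrable
and Fubini applies. Second, by Cauchy's theorem a rotated ray matters only through its order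
relative to the others, so for small ε the averaged integral does not depend on ε
(`eventually_wordInt`). The limits therefore exist and inherit the shuffle relations.

The rest is algebra in the quantum torus, represented by operators. There 1 + J is the word series Σ
χ(w) x_w. As χ is a character, conjugation by it sends P to Σ χ(w) […[P,x₁],…,x_n]
(`psEval_inv_mul_C_mul`); on the other hand e^{-h} P e^{h} = e^{-ad h} P for h = log(1 + J)
(`sum_ad_eq`). The logarithm of a character is an infinitesimal character (`shuffleSum_wordLog`), so
the Dynkin–Specht–Wever argument (`degree_smul_wordSer_wordLog`) writes h in nested commutators with
a factor 1/n.

The permutation coefficients come from the generating function of the convolution powers of χ, which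
equals Σ_σ z^s (1+z)^{n−s} χ(f∘σ⁻¹) (`powSum_ofFn`). The logarithm applies z^k ↦ (−1)^{k+1}/k, which
is integration of dz/z over [−1,0], and a Beta integral gives (−1)^{s+1}/(binom(n,s) s)
(`wordLog_ofFn`).

For y → 1 the word expansions of X and H^ref contain y only through Ω̄ and through (y^n − y^{−n})/(y
− y⁻¹) → n, so they converge term by term. The limiting expansion of X solves the classical equation
because the classical structure constants are additive: the word coefficients are multiplicative in
γ, hence an exponential (`lamW_eq_sum_shPow`). -/

namespace QRH

/-! ### Shuffles, cuts and unshuffles of words. -/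

section Words

variable {L M N : Type*} [AddCommMonoid M] [AddCommMonoid N]

/-- The sum of `F w` over all shuffles `w` of the words `u` and `v`. -/
def shuffleSum : List L → List L → (List L → M) → M
  | [], v, F => F v
  | a :: u, [], F => F (a :: u)
  | a :: u, b :: v, F =>
    shuffleSum u (b :: v) (fun w => F (a :: w)) + shuffleSum (a :: u) v (fun w => F (b :: w))
termination_by u v => u.length + v.length

/-- The sum of `H u v` over all factorisations `w = u ++ v`. -/
def splitSum : (List L → List L → M) → List L → M
  | H, [] => H [] []
  | H, a :: w => H [] (a :: w) + splitSum (fun u v => H (a :: u) v) w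

/-- The sum of `B u v` over all pairs of complementary subwords of `w`. -/
def unshuffleSum : (List L → List L → M) → List L → M
  | B, [] => B [] []
  | B, a :: w => unshuffleSum (fun u v => B (a :: u) v) w + unshuffleSum (fun u v => B u (a :: v)) w

@[simp] theorem shuffleSum_nil_left (v : List L) (F : List L → M) : shuffleSum [] v F = F v := by
  rw [shuffleSum]

@[simp] theorem shuffleSum_nil_right (u : List L) (F : List L → M) : shuffleSum u [] F = F u := by
  cases u <;> rw [shuffleSum]

theorem shuffleSum_cons_cons (a b : L) (u v : List L) (F : List L → M) :
    shuffleSum (a :: u) (b :: v) F =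
      shuffleSum u (b :: v) (fun w => F (a :: w)) + shuffleSum (a :: u) v (fun w => F (b :: w)) := by
  rw [shuffleSum]

theorem map_shuffleSum (φ : M →+ N) (u v : List L) (F : List L → M) :
    φ (shuffleSum u v F) = shuffleSum u v fun w => φ (F w) := by
  fun_induction shuffleSum u v F with
  | case1 => simp
  | case2 => simp
  | case3 a u b v F ih1 ih2 => rw [map_add, ih1, ih2, shuffleSum_cons_cons]

theorem shuffleSum_add (u v : List L) (F G : List L → M) :
    shuffleSum u v (fun w => F w + G w) = shuffleSum u v F + shuffleSum u v G := by
  fun_induction shuffleSum u v F generalizing G with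
  | case1 => simp
  | case2 => simp
  | case3 a u b v F ih1 ih2 =>
    rw [shuffleSum_cons_cons, ih1, ih2, shuffleSum_cons_cons]
    abel

theorem shuffleSum_zero (u v : List L) : shuffleSum u v (fun _ => (0 : M)) = 0 := by
  have := map_shuffleSum (0 : M →+ M) u v (fun _ => 0)
  simpa using this.symm

theorem splitSum_add (H G : List L → List L → M) (w : List L) :
    splitSum (fun u v => H u v + G u v) w = splitSum H w + splitSum G w := by
  induction w generalizing H G with
  | nil => rfl
  | cons a w ih => simp only [splitSum, ih]; abel

theorem map_splitSum (φ : M →+ N) (H : List L → List L → M) (w : List L) :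
    φ (splitSum H w) = splitSum (fun u v => φ (H u v)) w := by
  induction w generalizing H with
  | nil => rfl
  | cons a w ih => simp only [splitSum, map_add, ih]

theorem splitSum_sum {ι : Type*} (s : Finset ι) (H : ι → List L → List L → M) (w : List L) :
    splitSum (fun u v => ∑ i ∈ s, H i u v) w = ∑ i ∈ s, splitSum (H i) w := by
  induction w generalizing H with
  | nil => rfl
  | cons a w ih => simp only [splitSum, ih, Finset.sum_add_distrib]

theorem splitSum_congr {H G : List L → List L → M} {w : List L}
    (h : ∀ u v, u ++ v = w → H u v = G u v) : splitSum H w = splitSum G w := by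
  induction w generalizing H G with
  | nil => exact h [] [] rfl
  | cons a w ih =>
    simp only [splitSum]
    rw [h [] (a :: w) rfl, ih fun u v huv => h (a :: u) v (by simp [huv])]

theorem unshuffleSum_add (H G : List L → List L → M) (w : List L) :
    unshuffleSum (fun u v => H u v + G u v) w = unshuffleSum H w + unshuffleSum G w := by
  induction w generalizing H G with
  | nil => rfl
  | cons a w ih => simp only [unshuffleSum, ih]; abel

theorem map_unshuffleSum (φ : M →+ N) (H : List L → List L → M) (w : List L) :
    φ (unshuffleSum H w) = unshuffleSum (fun u v => φ (H u v)) w := by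
  induction w generalizing H with
  | nil => rfl
  | cons a w ih => simp only [unshuffleSum, map_add, ih]

/-- Shuffling is compatible with deconcatenation. -/
theorem shuffleSum_splitSum (u v : List L) (G : List L → List L → M) :
    shuffleSum u v (splitSum G) =
      splitSum (fun u₁ u₂ => splitSum (fun v₁ v₂ =>
        shuffleSum u₁ v₁ fun w₁ => shuffleSum u₂ v₂ (G w₁)) v) u := by
  induction hn : u.length + v.length using Nat.strong_induction_on generalizing u v G with
  | _ n ih =>
  match u, v with
  | [], v => simp [splitSum]
  | a :: u, [] => simp [splitSum]
  | a :: u, b :: v =>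
    -- The first letter of a shuffle comes from either word and is absorbed into the first argument
    -- of `G`, whence the generalisation over `G`.
    have h1 := ih (u.length + (b :: v).length) (by simp at hn ⊢; omega) u (b :: v)
      (fun w => G (a :: w)) rfl
    have h2 := ih ((a :: u).length + v.length) (by simp at hn ⊢; omega) (a :: u) v
      (fun w => G (b :: w)) rfl
    rw [shuffleSum_cons_cons]
    simp only [splitSum, shuffleSum_add, h1, h2]
    simp only [shuffleSum_nil_left, shuffleSum_nil_right, shuffleSum_cons_cons, splitSum_add]
    abel

end Words

/-! ### Characters of the shuffle algebra and their convolution powers. -/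

section Characters

variable {L R : Type*} [CommRing R]

/-- Characters of the shuffle algebra. -/
structure IsShuffleChar (χ : List L → R) : Prop where
  nil : χ [] = 1
  mul : ∀ u v, χ u * χ v = shuffleSum u v χ

/-- Convolution powers of the reduced part of a function on words. -/
def convPow (χ : List L → R) : ℕ → List L → R
  | 0, [] => 1
  | 0, _ :: _ => 0
  | _ + 1, [] => 0
  | k + 1, a :: w => splitSum (fun u v => χ (a :: u) * convPow χ k v) w

/-- Convolution powers of a function on words. -/
def convIter (χ : List L → R) : ℕ → List L → R
  | 0, [] => 1
  | 0, _ :: _ => 0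
  | s + 1, w => splitSum (fun u v => χ u * convIter χ s v) w

theorem convPow_eq_zero (χ : List L → R) {k : ℕ} {w : List L} (h : w.length < k) :
    convPow χ k w = 0 := by
  induction k generalizing w with
  | zero => omega
  | succ k ih =>
    cases w with
    | nil => rfl
    | cons a w =>
      rw [convPow, splitSum_congr (G := fun _ _ => 0)]
      · have := map_splitSum (0 : R →+ R) (fun _ _ => 0) w
        simpa using this.symm
      · intro u v huv
        rw [ih, mul_zero]
        rw [← huv] at h
        simp at h
        omega

theorem convIter_nil (χ : List L → R) (h : χ [] = 1) (s : ℕ) : convIter χ s [] = 1 := by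
  induction s with
  | zero => rfl
  | succ s ih => simp [convIter, splitSum, h, ih]

theorem splitSum_mul_left (c : R) (H : List L → List L → R) (w : List L) :
    splitSum (fun u v => c * H u v) w = c * splitSum H w :=
  (map_splitSum (AddMonoidHom.mulLeft c) H w).symm

theorem shuffleSum_mul_left (c : R) (u v : List L) (F : List L → R) :
    shuffleSum u v (fun w => c * F w) = c * shuffleSum u v F :=
  (map_shuffleSum (AddMonoidHom.mulLeft c) u v F).symm

theorem shuffleSum_mul_right (c : R) (u v : List L) (F : List L → R) :
    shuffleSum u v (fun w => F w * c) = shuffleSum u v F * c :=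
  (map_shuffleSum (AddMonoidHom.mulRight c) u v F).symm

/-- Binomial theorem for χ = counit + reduced part. A word has at most `w.length` nonempty factors,
so the cut-off `N` is immaterial. -/
theorem convIter_eq_sum (χ : List L → R) (h : χ [] = 1) (s : ℕ) (w : List L) {N : ℕ}
    (hN : w.length < N) :
    convIter χ s w = ∑ k ∈ Finset.range N, (s.choose k : R) * convPow χ k w := by
  induction s generalizing w N with
  | zero =>
    obtain ⟨N, rfl⟩ : ∃ N', N = N' + 1 := ⟨N - 1, by omega⟩
    rw [Finset.sum_range_succ']
    cases w <;> simp [convIter, convPow]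
  | succ s ih =>
    obtain ⟨N, rfl⟩ : ∃ N', N = N' + 1 := ⟨N - 1, by omega⟩
    rw [Finset.sum_range_succ']
    cases w with
    | nil =>
      simp [convIter, convPow, splitSum, h, convIter_nil χ h]
    | cons a w =>
      rw [convIter, splitSum, h, one_mul, ih (a :: w) hN, Finset.sum_range_succ']
      have h1 : splitSum (fun u v => χ (a :: u) * convIter χ s v) w =
          ∑ k ∈ Finset.range N, (s.choose k : R) * convPow χ (k + 1) (a :: w) := by
        rw [splitSum_congr (G := fun u v => ∑ k ∈ Finset.range N, (s.choose k : R) *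
          (χ (a :: u) * convPow χ k v)), splitSum_sum]
        · exact Finset.sum_congr rfl fun k _ => splitSum_mul_left _ _ _
        · intro u v huv
          rw [ih v (N := N), Finset.mul_sum]
          · exact Finset.sum_congr rfl fun k _ => by ring
          · have := congrArg List.length huv
            simp at this hN
            omega
      rw [h1]
      simp only [Nat.choose_succ_succ, Nat.cast_add, add_mul, Finset.sum_add_distrib]
      simp [convPow]
      ring

/-- A convolution of characters is a character because shuffling respects deconcatenation and the
values commute. -/
theorem isShuffleChar_convIter {χ : List L → R} (h : IsShuffleChar χ) (s : ℕ) :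
    IsShuffleChar (convIter χ s) := by
  refine ⟨convIter_nil χ h.nil s, ?_⟩
  induction s with
  | zero =>
    intro u v
    cases u with
    | nil => simp [convIter]
    | cons a u =>
      cases v with
      | nil => simp [convIter]
      | cons b v => simp [convIter, shuffleSum_cons_cons, shuffleSum_zero]
  | succ s ih =>
    intro u v
    have : (convIter χ (s + 1)) = splitSum fun u v => χ u * convIter χ s v := by
      funext w; rw [convIter]
    rw [this, shuffleSum_splitSum]
    simp only [shuffleSum_mul_left, ← ih, shuffleSum_mul_right, ← h.mul]
    rw [show splitSum (fun u v => χ u * convIter χ s v) u * splitSum (fun u v => χ u * convIter χ s v) v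
      = (AddMonoidHom.mulRight (splitSum (fun u v => χ u * convIter χ s v) v))
        (splitSum (fun u v => χ u * convIter χ s v) u) from rfl, map_splitSum]
    congr 1
    funext u₁ u₂
    simp only [AddMonoidHom.mulRight_apply]
    rw [← splitSum_mul_left]
    congr 1
    funext v₁ v₂
    ring

end Characters

/-! ### The logarithm of a character is an infinitesimal character. -/

section Log

variable {L K : Type*} [Field K]

/-- The coefficients of `log (1 + x)`. -/
def logCoeff (K : Type*) [Field K] (k : ℕ) : K := if k = 0 then 0 else (-1) ^ (k + 1) / k

/-- The convolution logarithm of a function on words. -/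
def wordLog (χ : List L → K) (w : List L) : K :=
  ∑ k ∈ Finset.range (w.length + 1), logCoeff K k * convPow χ k w

open Polynomial in
/-- The polynomial in `s` which interpolates the convolution powers `χ^s`. -/
def powPoly (χ : List L → K) (w : List L) : Polynomial K :=
  ∑ k ∈ Finset.range (w.length + 1),
    C ((k.factorial : K)⁻¹ * convPow χ k w) * descPochhammer K k

theorem eval_powPoly [CharZero K] (χ : List L → K) (h : χ [] = 1) (w : List L) (s : ℕ) :
    (powPoly χ w).eval (s : K) = convIter χ s w := by
  rw [convIter_eq_sum χ h s w (Nat.lt_succ_self _), powPoly, Polynomial.eval_finsetSum]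
  refine Finset.sum_congr rfl fun k _ => ?_
  rw [Polynomial.eval_mul, Polynomial.eval_C, descPochhammer_eval_eq_descFactorial,
    Nat.descFactorial_eq_factorial_mul_choose]
  have : (k.factorial : K) ≠ 0 := by exact_mod_cast k.factorial_ne_zero
  push_cast
  field_simp

theorem descPochhammer_eval_neg_one (n : ℕ) :
    (descPochhammer K n).eval (-1) = (-1) ^ n * (n.factorial : K) := by
  induction n with
  | zero => simp
  | succ n ih =>
    rw [descPochhammer_succ_right, Polynomial.eval_mul, ih]
    simp [Nat.factorial_succ]
    ring

/-- The falling factorial of order n + 1 is X times the shifted one of order n, so its linear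
coefficient is the value of the latter at −1. -/
theorem descPochhammer_coeff_one (n : ℕ) :
    (descPochhammer K (n + 1)).coeff 1 = (-1) ^ n * (n.factorial : K) := by
  rw [descPochhammer_succ_left, Polynomial.coeff_X_mul, Polynomial.coeff_zero_eq_eval_zero,
    Polynomial.eval_comp]
  simp [descPochhammer_eval_neg_one]

/-- The logarithm is the derivative of χ^s at s = 0: the linear coefficient of binom(s,k) is
(−1)^{k+1}/k. -/
theorem powPoly_coeff_one [CharZero K] (χ : List L → K) (w : List L) :
    (powPoly χ w).coeff 1 = wordLog χ w := by
  rw [powPoly, Polynomial.finsetSum_coeff, wordLog]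
  refine Finset.sum_congr rfl fun k _ => ?_
  rw [Polynomial.coeff_C_mul]
  cases k with
  | zero => simp [logCoeff, Polynomial.coeff_one]
  | succ k =>
    rw [descPochhammer_coeff_one, logCoeff, if_neg (Nat.succ_ne_zero k), Nat.factorial_succ]
    have : (k.factorial : K) ≠ 0 := by exact_mod_cast k.factorial_ne_zero
    have : ((k : K) + 1) ≠ 0 := by exact_mod_cast k.succ_ne_zero
    push_cast
    field_simp
    ring

theorem powPoly_coeff_zero [CharZero K] (χ : List L → K) (h : χ [] = 1) (a : L) (w : List L) :
    (powPoly χ (a :: w)).coeff 0 = 0 := by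
  have := eval_powPoly χ h (a :: w) 0
  rw [Polynomial.coeff_zero_eq_eval_zero]
  simpa [convIter] using this

/-- The logarithm of a character is an infinitesimal character. -/
theorem shuffleSum_wordLog [CharZero K] {χ : List L → K} (h : IsShuffleChar χ) (a b : L) (u v : List L) :
    shuffleSum (a :: u) (b :: v) (wordLog χ) = 0 := by
  -- At every natural s this says that χ^s is a character; infinitely many values determine a
  -- polynomial.
  have key : powPoly χ (a :: u) * powPoly χ (b :: v) =
      shuffleSum (a :: u) (b :: v) (powPoly χ) := by
    apply Polynomial.eq_of_infinite_eval_eq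
    refine (Set.infinite_range_of_injective (Nat.cast_injective (R := K))).mono ?_
    rintro _ ⟨s, rfl⟩
    have := map_shuffleSum (Polynomial.evalRingHom (s : K)).toAddMonoidHom (a :: u) (b :: v)
      (powPoly χ)
    simp only [RingHom.toAddMonoidHom_eq_coe, AddMonoidHom.coe_coe, Polynomial.coe_evalRingHom,
      eval_powPoly χ h.nil] at this
    simp only [Set.mem_ofPred_eq, Polynomial.eval_mul, eval_powPoly χ h.nil, this]
    exact (isShuffleChar_convIter h s).mul _ _
  have h1 := map_shuffleSum (Polynomial.lcoeff K 1).toAddMonoidHom (a :: u) (b :: v) (powPoly χ)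
  simp only [LinearMap.toAddMonoidHom_coe, Polynomial.lcoeff_apply, powPoly_coeff_one] at h1
  -- Both factors belong to nonempty words and have no constant term, so their product has no linear
  -- term.
  rw [← h1, ← key, Polynomial.mul_coeff_one, powPoly_coeff_zero χ h.nil, powPoly_coeff_zero χ h.nil]
  simp

theorem wordLog_nil (χ : List L → K) : wordLog χ [] = 0 := by
  simp [wordLog, logCoeff]

end Log

/-! ### Convolution powers as weighted sums over successive insertions of letters. -/

section Insertion

variable {L M R : Type*} [AddCommMonoid M] [CommRing R]

theorem sum_range_take_drop (F : List L → List L → M) (w : List L) :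
    ∑ k ∈ Finset.range (w.length + 1), F (w.take k) (w.drop k) = splitSum F w := by
  induction w generalizing F with
  | nil => simp [splitSum]
  | cons a w ih =>
    rw [Finset.sum_range_succ', splitSum, ← ih]
    simp [add_comm]

/-- The shuffles are sorted by the prefix `q₁` of `q` that precedes `b`. -/
theorem shuffleSum_cons_left (b : L) (r q : List L) (f : List L → M) :
    shuffleSum (b :: r) q f =
      splitSum (fun q₁ q₂ => shuffleSum r q₂ fun s => f (q₁ ++ b :: s)) q := by
  induction q generalizing f with
  | nil => simp [splitSum]
  | cons a q ih =>
    rw [shuffleSum_cons_cons, ih, splitSum]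
    rfl

/-- Insert the remaining letters one by one into the word `w`, anywhere, with weight `1 + z` for an
insertion behind the position `j` of the previous letter, and `z` otherwise. -/
def insertSum (χ : List L → R) (z : R) : List L → ℕ → List L → R
  | w, _, [] => χ w
  | w, j, b :: l => ∑ k ∈ Finset.range (w.length + 1),
      (if j < k then 1 + z else z) * insertSum χ z (w.take k ++ b :: w.drop k) k l

/-- The generating polynomial of the convolution powers. -/
def powSum (χ : List L → R) (z : R) (w : List L) : R :=
  ∑ k ∈ Finset.range (w.length + 1), z ^ k * convPow χ k w

theorem powSum_nil (χ : List L → R) (z : R) : powSum χ z [] = 1 := by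
  simp [powSum, convPow]

theorem powSum_eq_sum (χ : List L → R) (z : R) (w : List L) {N : ℕ} (hN : w.length < N) :
    powSum χ z w = ∑ k ∈ Finset.range N, z ^ k * convPow χ k w := by
  refine Finset.sum_subset (Finset.range_mono hN) fun k _ hk => ?_
  rw [convPow_eq_zero, mul_zero]
  simp at hk
  omega

theorem powSum_cons (χ : List L → R) (z : R) (a : L) (w : List L) :
    powSum χ z (a :: w) = z * splitSum (fun u v => χ (a :: u) * powSum χ z v) w := by
  have h : ∀ u v, u ++ v = w → χ (a :: u) * powSum χ z v =
      ∑ k ∈ Finset.range (w.length + 1), z ^ k * (χ (a :: u) * convPow χ k v) := by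
    intro u v huv
    rw [powSum_eq_sum χ z v (N := w.length + 1), Finset.mul_sum]
    · exact Finset.sum_congr rfl fun k _ => by ring
    · rw [← huv]; simp
  rw [splitSum_congr h, splitSum_sum, powSum, List.length_cons, Finset.sum_range_succ',
    Finset.mul_sum]
  simp only [convPow, splitSum_mul_left, mul_zero, add_zero]
  exact Finset.sum_congr rfl fun k _ => by ring

/-- Split the weight 1 + z into z for every place and 1 for the places behind the previous letter.
Inserting `b` anywhere and then `r` behind it shuffles `b :: r` into the whole word; the character
property factors this sum, and with the factor z it opens a new convolution factor. Insertions
behind the previous letter prolong the current block, which is shuffled with `q`. -/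
theorem insertSum_eq {χ : List L → R} (h : IsShuffleChar χ) (z : R) (p q l : List L) (a : L) :
    insertSum χ z (p ++ a :: q) p.length l =
      splitSum (fun r l' => shuffleSum r q (fun s => χ (p ++ a :: s)) * powSum χ z l') l := by
  induction l generalizing p q a with
  | nil => simp [insertSum, splitSum, powSum_nil]
  | cons b l ih =>
    have e1 : insertSum χ z (p ++ a :: q) p.length (b :: l) =
        (∑ k ∈ Finset.range ((p ++ a :: q).length + 1), z *
          insertSum χ z ((p ++ a :: q).take k ++ b :: (p ++ a :: q).drop k)
            ((p ++ a :: q).take k).length l) +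
        ∑ k ∈ Finset.range (q.length + 1), insertSum χ z ((p ++ a :: q.take k) ++ b :: q.drop k)
          (p ++ a :: q.take k).length l := by
      rw [insertSum]
      have e : ∀ k ∈ Finset.range ((p ++ a :: q).length + 1), (if p.length < k then 1 + z else z) *
          insertSum χ z ((p ++ a :: q).take k ++ b :: (p ++ a :: q).drop k) k l =
          z * insertSum χ z ((p ++ a :: q).take k ++ b :: (p ++ a :: q).drop k)
            ((p ++ a :: q).take k).length l + if p.length < k then
          insertSum χ z ((p ++ a :: q).take k ++ b :: (p ++ a :: q).drop k) k l else 0 := by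
        intro k hk
        have : ((p ++ a :: q).take k).length = k := by
          rw [List.length_take]
          simp only [Finset.mem_range] at hk
          omega
        rw [this]
        split_ifs <;> ring
      rw [Finset.sum_congr rfl e, Finset.sum_add_distrib]
      congr 1
      rw [show (p ++ a :: q).length + 1 = (p.length + 1) + (q.length + 1) by simp; omega,
        Finset.sum_range_add, Finset.sum_eq_zero, zero_add]
      · refine Finset.sum_congr rfl fun k hk => ?_
        simp only [Finset.mem_range] at hk
        rw [if_pos (by omega)]
        have h1 : (p ++ a :: q).take (p.length + 1 + k) = p ++ a :: q.take k := by
          rw [add_assoc, List.take_length_add_append, add_comm 1 k, List.take_succ_cons]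
        have h2 : (p ++ a :: q).drop (p.length + 1 + k) = q.drop k := by
          rw [add_assoc, List.drop_length_add_append, add_comm 1 k, List.drop_succ_cons]
        rw [h1, h2]
        congr 1
        simp
        omega
      · intro k hk
        simp only [Finset.mem_range] at hk
        rw [if_neg (by omega)]
    rw [e1, ← Finset.mul_sum,
      sum_range_take_drop (fun u v => insertSum χ z (u ++ b :: v) u.length l),
      sum_range_take_drop (fun u v => insertSum χ z ((p ++ a :: u) ++ b :: v)
        (p ++ a :: u).length l) q]
    simp only [ih]
    rw [splitSum]
    simp only [shuffleSum_nil_left]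
    have comm : ∀ (w : List L) (G : List L → List L → List L → List L → R),
        splitSum (fun u v => splitSum (fun r l' => G u v r l') l) w =
          splitSum (fun r l' => splitSum (fun u v => G u v r l') w) l := by
      intro w G
      rw [← sum_range_take_drop]
      rw [splitSum_congr (w := l) (G := fun r l' => ∑ k ∈ Finset.range (w.length + 1),
        G (w.take k) (w.drop k) r l') (fun u v _ => (sum_range_take_drop _ _).symm), splitSum_sum]
    have mr : ∀ (w : List L) (G : List L → List L → R) (c : R),
        splitSum (fun u v => G u v * c) w = splitSum G w * c := fun w G c =>
      (map_splitSum (AddMonoidHom.mulRight c) G w).symm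
    rw [comm, comm]
    simp only [mr, powSum_cons]
    congr 1
    · conv_lhs => rw [← splitSum_mul_left]
      conv_rhs => rw [← mul_assoc, ← splitSum_mul_left]
      congr 1
      funext r l'
      rw [← shuffleSum_cons_left, ← h.mul]
      ring
    · congr 1
      funext r l'
      rw [shuffleSum_cons_left]
      simp

theorem powSum_eq_insertSum {χ : List L → R} (h : IsShuffleChar χ) (z : R) (a : L) (l : List L) :
    powSum χ z (a :: l) = z * insertSum χ z [a] 0 l := by
  have := insertSum_eq h z [] [] l a
  simp only [List.nil_append, List.length_nil, shuffleSum_nil_right] at this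
  rw [this, powSum_cons]

end Insertion

/-! ### Permutations built by insertion, and their descents. -/

section Perms

/-- The permutation with value `p` at the last place which is ordered like `σ` before it. -/
def permSnoc {n : ℕ} (x : Fin (n + 1) × Equiv.Perm (Fin n)) : Equiv.Perm (Fin (n + 1)) :=
  (finSuccEquivLast.trans (Equiv.optionCongr x.2)).trans (finSuccEquiv' x.1).symm

theorem permSnoc_last {n : ℕ} (p : Fin (n + 1)) (σ : Equiv.Perm (Fin n)) :
    permSnoc (p, σ) (Fin.last n) = p := by
  simp [permSnoc]

theorem permSnoc_castSucc {n : ℕ} (p : Fin (n + 1)) (σ : Equiv.Perm (Fin n)) (i : Fin n) :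
    permSnoc (p, σ) i.castSucc = p.succAbove (σ i) := by
  simp [permSnoc]

theorem permSnoc_bijective (n : ℕ) : Function.Bijective (permSnoc (n := n)) := by
  rw [Fintype.bijective_iff_injective_and_card]
  refine ⟨?_, by simp [Fintype.card_perm, Nat.factorial_succ]⟩
  rintro ⟨p, σ⟩ ⟨p', σ'⟩ h
  have h1 : p = p' := by
    rw [← permSnoc_last p σ, h, permSnoc_last]
  subst h1
  congr 1
  ext i
  have h2 : p.succAbove (σ i) = p.succAbove (σ' i) := by
    rw [← permSnoc_castSucc, h, permSnoc_castSucc]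
  rw [Fin.succAbove_right_injective h2]

/-- `σ` maps the time at which a letter is inserted to its place, so the resulting word reads `f ∘
σ.symm`. -/
theorem comp_permSnoc_symm {n : ℕ} {L : Type*} (p : Fin (n + 1)) (σ : Equiv.Perm (Fin n))
    (f : Fin n → L) (b : L) :
    (Fin.snoc f b : Fin (n + 1) → L) ∘ (permSnoc (p, σ)).symm =
      Fin.insertNth (α := fun _ => L) p b (f ∘ σ.symm) := by
  rw [Fin.eq_insertNth_iff]
  constructor
  · have : (permSnoc (p, σ)).symm p = Fin.last n := by
      rw [Equiv.symm_apply_eq, permSnoc_last]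
    simp [this]
  · ext i
    have : (permSnoc (p, σ)).symm (p.succAbove i) = (σ.symm i).castSucc := by
      rw [Equiv.symm_apply_eq, permSnoc_castSucc, Equiv.apply_symm_apply]
    simp [Fin.removeNth, this]

theorem ofFn_insertNth {n : ℕ} {L : Type*} (p : Fin (n + 1)) (b : L) (g : Fin n → L) :
    List.ofFn (Fin.insertNth (α := fun _ => L) p b g) =
      (List.ofFn g).take p ++ b :: (List.ofFn g).drop p := by
  induction n with
  | zero =>
    obtain rfl : p = 0 := Fin.ext (by omega)
    simp [Fin.insertNth_zero']
  | succ n ih =>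
    refine Fin.cases ?_ (fun q => ?_) p
    · simp [Fin.insertNth_zero']
    · obtain ⟨a, g, rfl⟩ : ∃ a g', g = Fin.cons a g' := ⟨g 0, Fin.tail g, by simp⟩
      rw [Fin.insertNth_succ_cons, List.ofFn_cons, ih, List.ofFn_cons]
      simp

theorem ascRuns_succ {n : ℕ} (σ : Equiv.Perm (Fin (n + 1))) :
    ascRuns σ = 1 + ∑ i : Fin n, if σ i.succ < σ i.castSucc then 1 else 0 := by
  rw [ascRuns, Finset.card_filter, Fin.sum_univ_castSucc]
  congr 1
  rw [if_neg, add_zero]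
  · refine Finset.sum_congr rfl fun i _ => ?_
    congr 1
    simp only [Fin.val_castSucc, eq_iff_iff]
    constructor
    · rintro ⟨_, h⟩; exact h
    · intro h; exact ⟨by omega, h⟩
  · rintro ⟨h, _⟩
    simp at h

theorem ascRuns_le {n : ℕ} (σ : Equiv.Perm (Fin (n + 1))) : ascRuns σ ≤ n + 1 := by
  rw [ascRuns_succ, add_comm]
  have : ∑ i : Fin n, (if σ i.succ < σ i.castSucc then 1 else 0) ≤ ∑ _i : Fin n, 1 :=
    Finset.sum_le_sum fun i _ => by split_ifs <;> omega
  simp at this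
  simpa using this

/-- Making room at place `p` keeps the earlier places in order, so only the last step can add a
descent; it does so unless `p` lies behind the previous place. -/
theorem ascRuns_permSnoc {n : ℕ} (p : Fin (n + 2)) (σ : Equiv.Perm (Fin (n + 1))) :
    ascRuns (permSnoc (p, σ)) =
      ascRuns σ + if (σ (Fin.last n) : ℕ) < p then 0 else 1 := by
  rw [ascRuns_succ, ascRuns_succ, Fin.sum_univ_castSucc]
  refine (add_assoc _ _ _).symm.trans ?_
  congr 1
  · congr 1
    refine Finset.sum_congr rfl fun i _ => ?_
    have e : permSnoc (p, σ) i.castSucc.succ = p.succAbove (σ i.succ) :=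
      permSnoc_castSucc p σ i.succ
    rw [permSnoc_castSucc, e]
    simp
  · have e : permSnoc (p, σ) (Fin.last n).succ = p := permSnoc_last p σ
    rw [permSnoc_castSucc, e]
    have : p < p.succAbove (σ (Fin.last n)) ↔ ¬ ((σ (Fin.last n) : ℕ) < p) := by
      rw [Fin.lt_succAbove_iff_le_castSucc, Fin.le_def]
      simp
    simp only [this]
    split_ifs <;> simp_all

variable {L R : Type*} [CommRing R]

/-- Every permutation arises from exactly one sequence of insertions. Each of the n steps
contributes z at a descent and 1 + z at an ascent; the first letter contributes nothing, hence the
exponent `ascRuns σ - 1`. -/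
theorem sum_perm_insertSum (χ : List L → R) (z : R) (n : ℕ) (f : Fin (n + 1) → L) (l : List L) :
    ∑ σ : Equiv.Perm (Fin (n + 1)), z ^ (ascRuns σ - 1) * (1 + z) ^ (n + 1 - ascRuns σ) *
      insertSum χ z (List.ofFn (f ∘ σ.symm)) (σ (Fin.last n)) l =
      insertSum χ z [f 0] 0 (List.ofFn (Fin.tail f) ++ l) := by
  induction n generalizing l with
  | zero =>
    have hu : ∀ σ : Equiv.Perm (Fin (0 + 1)), σ = 1 := fun σ => by
      ext i
      omega
    rw [Fintype.sum_eq_single 1 fun σ h => absurd (hu σ) h]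
    have : ascRuns (1 : Equiv.Perm (Fin (0 + 1))) = 1 := by rw [ascRuns_succ]; simp
    rw [this]
    simp [List.ofFn_succ]
    rfl
  | succ n ih =>
    obtain ⟨f, b, rfl⟩ : ∃ f' b, f = Fin.snoc f' b := ⟨Fin.init f, f (Fin.last _), by simp⟩
    rw [← (permSnoc_bijective (n + 1)).sum_comp, Fintype.sum_prod_type, Finset.sum_comm]
    have e : List.ofFn (Fin.tail (Fin.snoc f b : Fin (n + 2) → L)) ++ l =
        List.ofFn (Fin.tail f) ++ b :: l := by
      rw [show Fin.tail (Fin.snoc f b : Fin (n + 2) → L) = Fin.snoc (Fin.tail f) b from by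
        funext i
        refine Fin.lastCases ?_ (fun i => ?_) i
        · rw [Fin.snoc_last]
          exact Fin.snoc_last (α := fun _ => L) b f
        · rw [Fin.snoc_castSucc]
          exact Fin.snoc_castSucc (α := fun _ => L) b f i.succ,
        List.ofFn_succ']
      simp [Fin.snoc_castSucc, Fin.snoc_last]
    have e0 : (Fin.snoc f b : Fin (n + 2) → L) 0 = f 0 := by
      rw [show (0 : Fin (n + 2)) = (0 : Fin (n + 1)).castSucc from rfl]
      simp only [Fin.snoc_castSucc]
    rw [e, e0, ← ih]
    refine Finset.sum_congr rfl fun σ _ => ?_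
    rw [insertSum, List.length_ofFn, Finset.sum_range, Finset.mul_sum]
    refine Finset.sum_congr rfl fun p _ => ?_
    have h1 := ascRuns_le σ
    have h0 : 1 ≤ ascRuns σ := by rw [ascRuns_succ]; omega
    rw [permSnoc_last, comp_permSnoc_symm, ofFn_insertNth, ascRuns_permSnoc]
    split_ifs with h
    · rw [add_zero, show n + 1 + 1 - ascRuns σ = (n + 1 - ascRuns σ) + 1 by omega]
      ring
    · rw [show ascRuns σ + 1 - 1 = (ascRuns σ - 1) + 1 by omega,
        show n + 1 + 1 - (ascRuns σ + 1) = n + 1 - ascRuns σ by omega]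
      ring

theorem powSum_ofFn {χ : List L → R} (h : IsShuffleChar χ) (z : R) (n : ℕ) (f : Fin (n + 1) → L) :
    powSum χ z (List.ofFn f) = ∑ σ : Equiv.Perm (Fin (n + 1)),
      z ^ ascRuns σ * (1 + z) ^ (n + 1 - ascRuns σ) * χ (List.ofFn (f ∘ σ.symm)) := by
  have := sum_perm_insertSum χ z n f []
  rw [List.append_nil] at this
  rw [List.ofFn_succ, powSum_eq_insertSum h, show (fun i : Fin n => f i.succ) = Fin.tail f from rfl,
    ← this, Finset.mul_sum]
  refine Finset.sum_congr rfl fun σ _ => ?_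
  have h0 : 1 ≤ ascRuns σ := by rw [ascRuns_succ]; omega
  obtain ⟨s, hs⟩ := Nat.exists_eq_add_of_le h0
  rw [hs, insertSum, show 1 + s - 1 = s by omega]
  ring

end Perms

/-! ### The Beta integral and the permutation formula for the logarithm. -/

section LogFormula

variable {L K : Type*} [Field K]

/-- The linear functional `z^k ↦ (-1)^(k+1) / k` on polynomials. -/
def logFunctional (K : Type*) [Field K] : Polynomial K →ₗ[K] K :=
  Polynomial.lsum fun k => logCoeff K k • LinearMap.id

theorem logFunctional_C_mul_X_pow (c : K) (k : ℕ) :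
    logFunctional K (Polynomial.C c * Polynomial.X ^ k) = logCoeff K k * c := by
  rw [Polynomial.C_mul_X_pow_eq_monomial]
  simp [logFunctional, Polynomial.lsum, Polynomial.sum_monomial_index]

/-- On polynomials divisible by z the functional is integration of p(z) dz/z over [−1,0], so this is
a Beta integral. The induction uses (1+z)^{e+1} = (1+z)^e + z(1+z)^e. -/
theorem logFunctional_beta [CharZero K] (d e : ℕ) :
    logFunctional K (Polynomial.X ^ (d + 1) * (1 + Polynomial.X) ^ e) =
      (-1) ^ d * (d.factorial * e.factorial : K) / ((d + e + 1).factorial : K) := by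
  induction e generalizing d with
  | zero =>
    have := logFunctional_C_mul_X_pow (K := K) 1 (d + 1)
    simp only [map_one, one_mul, mul_one] at this
    simp only [pow_zero, mul_one, this, logCoeff, Nat.succ_ne_zero, if_false, add_zero,
      Nat.factorial_succ, Nat.factorial_zero]
    have h1 : (d.factorial : K) ≠ 0 := by exact_mod_cast d.factorial_ne_zero
    have h2 : ((d : K) + 1) ≠ 0 := by exact_mod_cast d.succ_ne_zero
    push_cast
    field_simp
    ring
  | succ e ih =>
    have : (Polynomial.X : Polynomial K) ^ (d + 1) * (1 + Polynomial.X) ^ (e + 1) =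
      Polynomial.X ^ (d + 1) * (1 + Polynomial.X) ^ e +
        Polynomial.X ^ (d + 1 + 1) * (1 + Polynomial.X) ^ e := by ring
    rw [this, map_add, ih, ih]
    rw [show d + 1 + e + 1 = (d + e + 1) + 1 by ring, show d + (e + 1) + 1 = (d + e + 1) + 1 by ring,
      Nat.factorial_succ (d + e + 1), Nat.factorial_succ d, Nat.factorial_succ e]
    have h1 : ((d + e + 1).factorial : K) ≠ 0 := by exact_mod_cast Nat.factorial_ne_zero _
    have h2 : ((d : K) + e + 1 + 1) ≠ 0 := by exact_mod_cast (d + e + 1).succ_ne_zero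
    push_cast
    field_simp
    ring

theorem logFunctional_choose [CharZero K] {N s e : ℕ} (h : N = s + 1 + e) :
    logFunctional K (Polynomial.X ^ (s + 1) * (1 + Polynomial.X) ^ e) =
      (-1) ^ (s + 1 + 1) / ((N.choose (s + 1) : K) * ((s + 1 : ℕ) : K)) := by
  subst h
  rw [logFunctional_beta]
  have hc := Nat.choose_mul_factorial_mul_factorial (show s + 1 ≤ s + 1 + e by omega)
  rw [show s + 1 + e - (s + 1) = e by omega] at hc
  have hc' : ((s + 1 + e).choose (s + 1) : K) * ((s + 1).factorial : K) * (e.factorial : K) =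
    ((s + 1 + e).factorial : K) := by exact_mod_cast hc
  rw [show s + e + 1 = s + 1 + e by ring, ← hc', Nat.factorial_succ]
  have h2 : ((s + 1 + e).choose (s + 1) : K) ≠ 0 := by
    exact_mod_cast (Nat.choose_pos (by omega)).ne'
  have h3 : ((s : K) + 1) ≠ 0 := by exact_mod_cast s.succ_ne_zero
  have h4 : (s.factorial : K) ≠ 0 := by exact_mod_cast Nat.factorial_ne_zero _
  have h5 : (e.factorial : K) ≠ 0 := by exact_mod_cast Nat.factorial_ne_zero _
  push_cast
  field_simp
  ring

/-- The logarithm of a character of the shuffle algebra in terms of permutations. -/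
theorem wordLog_ofFn [CharZero K] {χ : List L → K} (h : IsShuffleChar χ) (n : ℕ)
    (f : Fin (n + 1) → L) :
    wordLog χ (List.ofFn f) = ∑ σ : Equiv.Perm (Fin (n + 1)),
      (-1) ^ (ascRuns σ + 1) / (((n + 1).choose (ascRuns σ) : K) * (ascRuns σ : K)) *
        χ (List.ofFn (f ∘ σ.symm)) := by
  -- With polynomial coefficients z can be the indeterminate, to which the functional is applied
  -- afterwards.
  have hC : IsShuffleChar fun w => Polynomial.C (χ w) := by
    refine ⟨by rw [h.nil, map_one], fun u v => ?_⟩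
    have := map_shuffleSum (Polynomial.C (R := K)).toAddMonoidHom u v χ
    simp only [RingHom.toAddMonoidHom_eq_coe, AddMonoidHom.coe_coe] at this
    rw [← map_mul, h.mul, this]
  have hP : ∀ k w, convPow (fun w => Polynomial.C (χ w)) k w =
      Polynomial.C (convPow χ k w) := by
    intro k
    induction k with
    | zero => intro w; cases w <;> simp [convPow]
    | succ k ih =>
      intro w
      cases w with
      | nil => simp [convPow]
      | cons a w =>
        have := map_splitSum (Polynomial.C (R := K)).toAddMonoidHom
          (fun u v => χ (a :: u) * convPow χ k v) w
        simp only [RingHom.toAddMonoidHom_eq_coe, AddMonoidHom.coe_coe] at this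
        rw [convPow, convPow, this]
        simp only [ih, map_mul]
  have key := congrArg (logFunctional K) (powSum_ofFn hC Polynomial.X n f)
  rw [powSum, map_sum, map_sum] at key
  simp only [hP] at key
  rw [wordLog]
  have e1 : ∀ k, logFunctional K (Polynomial.X ^ k * Polynomial.C (convPow χ k (List.ofFn f))) =
      logCoeff K k * convPow χ k (List.ofFn f) := fun k => by
    rw [mul_comm, logFunctional_C_mul_X_pow]
  simp only [e1] at key
  rw [key]
  refine Finset.sum_congr rfl fun σ _ => ?_
  rw [mul_comm, ← Polynomial.smul_eq_C_mul, map_smul, smul_eq_mul, mul_comm]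
  congr 1
  have h1 := ascRuns_le σ
  have h0 : 1 ≤ ascRuns σ := by rw [ascRuns_succ]; omega
  obtain ⟨s, hs⟩ := Nat.exists_eq_add_of_le' h0
  obtain ⟨e, he⟩ := Nat.exists_eq_add_of_le h1
  rw [show n + 1 - ascRuns σ = e by omega, hs]
  exact logFunctional_choose (by omega)

end LogFormula

/-! ### Words with prescribed content, and the adjointness of shuffling and unshuffling. -/

section Content

variable {L M : Type*} [AddCommMonoid M]

/-- The multiset of letters of a word, as an exponent. -/
def content (w : List L) : L →₀ ℕ := (w.map fun a => Finsupp.single a 1).sum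

theorem content_nil : content ([] : List L) = 0 := rfl

theorem content_cons (a : L) (w : List L) : content (a :: w) = Finsupp.single a 1 + content w := by
  simp [content]

theorem content_reverse (w : List L) : content w.reverse = content w := by
  simp [content, List.map_reverse, List.sum_reverse]

theorem degree_content (w : List L) : (content w).degree = w.length := by
  induction w with
  | nil => simp [content_nil]
  | cons a w ih => rw [content_cons, map_add, ih, Finsupp.degree_single]; simp [add_comm]

theorem single_le_of_mem_support {m : L →₀ ℕ} {a : L} (ha : a ∈ m.support) :
    Finsupp.single a 1 ≤ m := by
  rw [Finsupp.single_le_iff]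
  exact Nat.one_le_iff_ne_zero.2 (Finsupp.mem_support_iff.1 ha)

theorem content_ofFn_comp {n : ℕ} (f : Fin n → L) (σ : Equiv.Perm (Fin n)) :
    content (List.ofFn (f ∘ σ)) = content (List.ofFn f) := by
  simp only [content, List.map_ofFn, List.sum_ofFn]
  exact Equiv.sum_comp σ fun i => Finsupp.single (f i) 1

theorem mem_support_content {a : L} {w : List L} (h : a ∈ w) : a ∈ (content w).support := by
  induction w with
  | nil => simp at h
  | cons b w ih =>
    rw [content_cons, Finsupp.mem_support_iff, Finsupp.add_apply]
    rcases List.mem_cons.1 h with rfl | h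
    · simp
    · have := Finsupp.mem_support_iff.1 (ih h)
      omega

theorem degree_sub_single {m : L →₀ ℕ} {a : L} (ha : a ∈ m.support) :
    (m - Finsupp.single a 1).degree + 1 = m.degree := by
  conv_rhs => rw [← tsub_add_cancel_of_le (single_le_of_mem_support ha)]
  rw [map_add, Finsupp.degree_single]

variable [DecidableEq L]

/-- The words with a given content. -/
def wordsOf (m : L →₀ ℕ) : Finset (List L) :=
  ((Fintype.piFinset fun _ : Fin m.degree => m.support).image List.ofFn).filter (content · = m)

theorem mem_wordsOf {m : L →₀ ℕ} {w : List L} : w ∈ wordsOf m ↔ content w = m := by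
  refine ⟨fun h => (Finset.mem_filter.1 h).2, fun h => Finset.mem_filter.2 ⟨?_, h⟩⟩
  subst h
  rw [Finset.mem_image]
  refine ⟨fun i => w.get (i.cast (degree_content w)), ?_, ?_⟩
  · rw [Fintype.mem_piFinset]
    intro i
    exact mem_support_content (List.get_mem _ _)
  · apply List.ext_get
    · simp [degree_content]
    · simp

theorem length_of_mem_wordsOf {m : L →₀ ℕ} {w : List L} (h : w ∈ wordsOf m) :
    w.length = m.degree := by
  rw [← degree_content, mem_wordsOf.1 h]

/-- A word is empty or has a first letter; the inductions on the degree below rest on this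
recursion. -/
theorem sum_wordsOf (m : L →₀ ℕ) (F : List L → M) :
    ∑ w ∈ wordsOf m, F w = (if m = 0 then F [] else 0) +
      ∑ a ∈ m.support, ∑ w ∈ wordsOf (m - Finsupp.single a 1), F (a :: w) := by
  by_cases hm : m = 0
  · subst hm
    have : wordsOf (0 : L →₀ ℕ) = {[]} := by
      ext w
      rw [mem_wordsOf, Finset.mem_singleton]
      refine ⟨fun h => ?_, fun h => by rw [h, content_nil]⟩
      have := degree_content w
      rw [h, map_zero] at this
      exact List.length_eq_zero_iff.1 this.symm
    simp [this]
  · have : wordsOf m = m.support.biUnion fun a =>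
        (wordsOf (m - Finsupp.single a 1)).image (List.cons a) := by
      ext w
      simp only [Finset.mem_biUnion, Finset.mem_image, mem_wordsOf]
      constructor
      · intro h
        cases w with
        | nil => exact absurd h.symm hm
        | cons a w =>
          refine ⟨a, h ▸ mem_support_content (by simp), w, ?_, rfl⟩
          rw [← h, content_cons, add_tsub_cancel_left]
      · rintro ⟨a, ha, w, hw, rfl⟩
        rw [content_cons, hw, add_tsub_cancel_of_le (single_le_of_mem_support ha)]
    rw [if_neg hm, zero_add, this, Finset.sum_biUnion]
    · refine Finset.sum_congr rfl fun a _ => ?_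
      rw [Finset.sum_image]
      intro u _ v _ h
      exact (List.cons.inj h).2
    · intro a _ b _ hab
      rw [Function.onFun, Finset.disjoint_left]
      rintro w h1 h2
      obtain ⟨u, _, rfl⟩ := Finset.mem_image.1 h1
      obtain ⟨v, _, h⟩ := Finset.mem_image.1 h2
      exact hab (List.cons.inj h).1.symm

theorem sum_wordsOf_zero (F : List L → M) : ∑ w ∈ wordsOf (0 : L →₀ ℕ), F w = F [] := by
  rw [sum_wordsOf]; simp

theorem sum_wordsOf_of_ne {m : L →₀ ℕ} (hm : m ≠ 0) (F : List L → M) :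
    ∑ w ∈ wordsOf m, F w =
      ∑ a ∈ m.support, ∑ w ∈ wordsOf (m - Finsupp.single a 1), F (a :: w) := by
  rw [sum_wordsOf, if_neg hm, zero_add]

theorem sum_wordsOf_reverse (m : L →₀ ℕ) (F : List L → M) :
    ∑ w ∈ wordsOf m, F w.reverse = ∑ w ∈ wordsOf m, F w :=
  Finset.sum_nbij' List.reverse List.reverse
    (fun w hw => by rw [mem_wordsOf, content_reverse]; exact mem_wordsOf.1 hw)
    (fun w hw => by rw [mem_wordsOf, content_reverse]; exact mem_wordsOf.1 hw)
    (fun w _ => List.reverse_reverse w) (fun w _ => List.reverse_reverse w) (fun _ _ => rfl)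

/-- The sum over all pairs of words with a given total content. -/
def pairSum (m : L →₀ ℕ) (H : List L → List L → M) : M :=
  ∑ x ∈ Finset.HasAntidiagonal.antidiagonal m, ∑ u ∈ wordsOf x.1, ∑ v ∈ wordsOf x.2, H u v

theorem pairSum_congr {m : L →₀ ℕ} {H G : List L → List L → M}
    (h : ∀ u v, content u + content v = m → H u v = G u v) : pairSum m H = pairSum m G := by
  refine Finset.sum_congr rfl fun x hx => Finset.sum_congr rfl fun u hu =>
    Finset.sum_congr rfl fun v hv => h u v ?_
  rw [mem_wordsOf.1 hu, mem_wordsOf.1 hv, Finset.HasAntidiagonal.mem_antidiagonal.1 hx]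

theorem pairSum_add (m : L →₀ ℕ) (H G : List L → List L → M) :
    pairSum m (fun u v => H u v + G u v) = pairSum m H + pairSum m G := by
  simp only [pairSum, Finset.sum_add_distrib]

theorem pairSum_swap (m : L →₀ ℕ) (H : List L → List L → M) :
    pairSum m H = pairSum m fun u v => H v u := by
  rw [pairSum, pairSum]
  refine Finset.sum_nbij' Prod.swap Prod.swap ?_ ?_ ?_ ?_ ?_
  · intro x hx
    rw [Finset.HasAntidiagonal.mem_antidiagonal] at *
    rw [← hx, add_comm]; rfl
  · intro x hx
    rw [Finset.HasAntidiagonal.mem_antidiagonal] at *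
    rw [← hx, add_comm]; rfl
  · intro x _; rfl
  · intro x _; rfl
  · intro x _
    exact Finset.sum_comm

/-- Both sides run over the decompositions of `m` into a distinguished letter and an ordered pair of
remainders. -/
theorem sum_antidiagonal_support (m : L →₀ ℕ) (G : L → (L →₀ ℕ) → (L →₀ ℕ) → M) :
    ∑ x ∈ Finset.HasAntidiagonal.antidiagonal m, ∑ a ∈ x.1.support,
      G a (x.1 - Finsupp.single a 1) x.2 =
    ∑ a ∈ m.support, ∑ x ∈ Finset.HasAntidiagonal.antidiagonal (m - Finsupp.single a 1),
      G a x.1 x.2 := by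
  rw [Finset.sum_sigma', Finset.sum_sigma']
  refine Finset.sum_nbij' (fun y => ⟨y.2, (y.1.1 - Finsupp.single y.2 1, y.1.2)⟩)
    (fun y => ⟨(y.2.1 + Finsupp.single y.1 1, y.2.2), y.1⟩) ?_ ?_ ?_ ?_ ?_
  · rintro ⟨⟨p, q⟩, a⟩ h
    simp only [Finset.mem_sigma, Finset.HasAntidiagonal.mem_antidiagonal] at h ⊢
    obtain ⟨h1, h2⟩ := h
    have h3 := single_le_of_mem_support h2
    refine ⟨?_, ?_⟩
    · rw [← h1, Finsupp.mem_support_iff, Finsupp.add_apply]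
      have := Finsupp.mem_support_iff.1 h2
      omega
    · rw [← h1, tsub_add_eq_add_tsub h3]
  · rintro ⟨a, ⟨p, q⟩⟩ h
    simp only [Finset.mem_sigma, Finset.HasAntidiagonal.mem_antidiagonal] at h ⊢
    obtain ⟨h1, h2⟩ := h
    have h3 := single_le_of_mem_support h1
    refine ⟨?_, ?_⟩
    · rw [add_right_comm, h2, tsub_add_cancel_of_le h3]
    · rw [Finsupp.mem_support_iff, Finsupp.add_apply]
      simp
  · rintro ⟨⟨p, q⟩, a⟩ h
    simp only [Finset.mem_sigma] at h
    simp [tsub_add_cancel_of_le (single_le_of_mem_support h.2)]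
  · rintro ⟨a, ⟨p, q⟩⟩ _
    simp
  · rintro ⟨⟨p, q⟩, a⟩ _
    rfl

theorem pairSum_left (m : L →₀ ℕ) (H : List L → List L → M) :
    pairSum m H = ∑ v ∈ wordsOf m, H [] v +
      ∑ a ∈ m.support, pairSum (m - Finsupp.single a 1) fun u v => H (a :: u) v := by
  have h1 : pairSum m H = ∑ x ∈ Finset.HasAntidiagonal.antidiagonal m,
      ((if x.1 = 0 then ∑ v ∈ wordsOf x.2, H [] v else 0) + ∑ a ∈ x.1.support,
        ∑ u ∈ wordsOf (x.1 - Finsupp.single a 1), ∑ v ∈ wordsOf x.2, H (a :: u) v) :=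
    Finset.sum_congr rfl fun x _ => sum_wordsOf _ _
  rw [h1, Finset.sum_add_distrib]
  congr 1
  · rw [Finset.sum_eq_single (0, m)]
    · simp
    · intro x hx hne
      rw [if_neg]
      intro h0
      apply hne
      rw [Finset.HasAntidiagonal.mem_antidiagonal, h0, zero_add] at hx
      exact Prod.ext h0 hx
    · intro h
      exact absurd (Finset.HasAntidiagonal.mem_antidiagonal.2 (zero_add m)) h
  · exact sum_antidiagonal_support m fun a p q =>
      ∑ u ∈ wordsOf p, ∑ v ∈ wordsOf q, H (a :: u) v

theorem pairSum_right (m : L →₀ ℕ) (H : List L → List L → M) :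
    pairSum m H = ∑ u ∈ wordsOf m, H u [] +
      ∑ a ∈ m.support, pairSum (m - Finsupp.single a 1) fun u v => H u (a :: v) := by
  rw [pairSum_swap, pairSum_left]
  congr 1
  exact Finset.sum_congr rfl fun a _ => pairSum_swap _ _

/-- A pair of words is a word with a cut. -/
theorem pairSum_eq_sum_splitSum (m : L →₀ ℕ) (H : List L → List L → M) :
    pairSum m H = ∑ w ∈ wordsOf m, splitSum H w := by
  induction hn : m.degree using Nat.strong_induction_on generalizing m H with
  | _ n ih =>
  rw [pairSum_left, sum_wordsOf m (splitSum H), sum_wordsOf m (H []), add_assoc,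
    ← Finset.sum_add_distrib]
  congr 1
  refine Finset.sum_congr rfl fun a ha => ?_
  have hd := degree_sub_single ha
  rw [ih _ (by omega) _ _ rfl, ← Finset.sum_add_distrib]
  rfl

/-- Unshuffling is the adjoint of shuffling. The induction sorts by the origin of the first letter
of the shuffle, which is `u` in `H₁` and `v` in `H₂`. -/
theorem pairSum_shuffleSum {K : Type*} [CommRing K] {M : Type*} [AddCommGroup M] [Module K M]
    (m : L →₀ ℕ) (F : List L → K) (B : List L → List L → M) :
    pairSum m (fun u v => shuffleSum u v F • B u v) =
      ∑ w ∈ wordsOf m, F w • unshuffleSum B w := by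
  induction hn : m.degree using Nat.strong_induction_on generalizing m F B with
  | _ n ih =>
  by_cases hm : m = 0
  · subst hm
    rw [pairSum_left]
    simp [sum_wordsOf_zero, unshuffleSum]
  · let H₁ : List L → List L → M := fun u v => match u with
      | [] => 0
      | a :: u => shuffleSum u v (fun w => F (a :: w)) • B (a :: u) v
    let H₂ : List L → List L → M := fun u v => match v with
      | [] => 0
      | b :: v => shuffleSum u v (fun w => F (b :: w)) • B u (b :: v)
    have e : pairSum m (fun u v => shuffleSum u v F • B u v) =
        pairSum m fun u v => H₁ u v + H₂ u v := by
      refine pairSum_congr (M := M) fun u v huv => ?_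
      match u, v with
      | [], [] => exact absurd huv.symm hm
      | a :: u, [] => simp [H₁, H₂]
      | [], b :: v => simp [H₁, H₂]
      | a :: u, b :: v => simp only [H₁, H₂, shuffleSum_cons_cons, add_smul]
    rw [e, pairSum_add, pairSum_left m H₁, pairSum_right m H₂,
      sum_wordsOf_of_ne hm fun w => F w • unshuffleSum B w]
    simp only [H₁, H₂, Finset.sum_const_zero, zero_add]
    rw [← Finset.sum_add_distrib]
    refine Finset.sum_congr rfl fun a ha => ?_
    have hd := degree_sub_single ha
    rw [ih _ (by omega) _ _ _ rfl, ih _ (by omega) _ _ _ rfl, ← Finset.sum_add_distrib]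
    refine Finset.sum_congr rfl fun w _ => ?_
    rw [unshuffleSum, smul_add]

/-- Tuples with a given content. -/
def tuplesOf (n : ℕ) (m : L →₀ ℕ) : Finset (Fin n → L) :=
  (Fintype.piFinset fun _ : Fin n => m.support).filter fun f => content (List.ofFn f) = m

theorem mem_tuplesOf {n : ℕ} {m : L →₀ ℕ} {f : Fin n → L} :
    f ∈ tuplesOf n m ↔ content (List.ofFn f) = m := by
  refine ⟨fun h => (Finset.mem_filter.1 h).2, fun h => Finset.mem_filter.2 ⟨?_, h⟩⟩
  rw [Fintype.mem_piFinset]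
  intro i
  rw [← h]
  exact mem_support_content (by simp)

theorem sum_wordsOf_eq_sum_tuplesOf {n : ℕ} {m : L →₀ ℕ} (h : m.degree = n) (F : List L → M) :
    ∑ w ∈ wordsOf m, F w = ∑ f ∈ tuplesOf n m, F (List.ofFn f) := by
  symm
  refine Finset.sum_bij (fun f _ => List.ofFn f) ?_ ?_ ?_ ?_
  · intro f hf
    exact mem_wordsOf.2 (mem_tuplesOf.1 hf)
  · intro f _ g _ hfg
    exact List.ofFn_injective hfg
  · intro w hw
    have hl : w.length = n := (length_of_mem_wordsOf hw).trans h
    subst hl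
    exact ⟨w.get, mem_tuplesOf.2 (by rw [List.ofFn_get]; exact mem_wordsOf.1 hw),
      List.ofFn_get w⟩
  · intro f _; rfl

theorem sum_tuplesOf_comp {n : ℕ} (m : L →₀ ℕ) (σ : Equiv.Perm (Fin n))
    (F : (Fin n → L) → M) :
    ∑ f ∈ tuplesOf n m, F (f ∘ σ) = ∑ f ∈ tuplesOf n m, F f := by
  refine Finset.sum_nbij' (fun f => f ∘ σ) (fun f => f ∘ σ.symm) ?_ ?_ ?_ ?_ ?_
  · intro f hf
    rw [mem_tuplesOf, content_ofFn_comp, mem_tuplesOf.1 hf]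
  · intro f hf
    rw [mem_tuplesOf, content_ofFn_comp, mem_tuplesOf.1 hf]
  · intro f _; ext i; simp
  · intro f _; ext i; simp
  · intro f _; rfl

theorem sum_tuplesOf_succ {n : ℕ} (m : L →₀ ℕ) (F : (Fin (n + 1) → L) → M) :
    ∑ f ∈ tuplesOf (n + 1) m, F f =
      ∑ a ∈ m.support, ∑ f ∈ tuplesOf n (m - Finsupp.single a 1), F (Fin.cons a f) := by
  rw [Finset.sum_sigma']
  refine Finset.sum_nbij' (fun f => ⟨f 0, Fin.tail f⟩) (fun y => Fin.cons y.1 y.2) ?_ ?_ ?_ ?_ ?_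
  · intro f hf
    have h := mem_tuplesOf.1 hf
    rw [List.ofFn_succ, content_cons] at h
    simp only [Finset.mem_sigma, mem_tuplesOf]
    refine ⟨?_, ?_⟩
    · rw [← h, Finsupp.mem_support_iff, Finsupp.add_apply]; simp
    · rw [← h, add_tsub_cancel_left]; rfl
  · rintro ⟨a, f⟩ h
    simp only [Finset.mem_sigma, mem_tuplesOf] at h ⊢
    rw [List.ofFn_cons, content_cons, h.2, add_tsub_cancel_of_le (single_le_of_mem_support h.1)]
  · intro f _; simp
  · rintro ⟨a, f⟩ _; simp
  · intro f _; simp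

end Content

/-! ### The identity exp(log(1 + X)) = 1 + X for truncated power series. -/

section ExpLog

open PowerSeries in
theorem log_pow_coeff_of_lt {n j : ℕ} (h : j < n) : coeff j (log ℂ ^ n) = 0 := by
  have h1 : (X : ℂ⟦X⟧) ∣ log ℂ := X_dvd_iff.2 constantCoeff_log
  exact X_pow_dvd_iff.1 (pow_dvd_pow_of_dvd h1 n) j h

open PowerSeries in
theorem one_add_X_mul_deriv_log : (1 + X) * derivative ℂ (log ℂ) = 1 := by
  rw [deriv_log]
  ext n
  rw [add_mul, one_mul, map_add, coeff_mk, coeff_one]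
  cases n with
  | zero => simp
  | succ n => rw [mul_comm, coeff_succ_mul_X, coeff_mk]; simp [pow_succ]

open PowerSeries in
/-- The partial sums of `exp (log (1 + X))`. -/
def expLogPartial (N : ℕ) : ℂ⟦X⟧ := ∑ n ∈ Finset.range N, ((n.factorial : ℂ)⁻¹) • log ℂ ^ n

-- Differentiating log^n/n! lowers n by one and produces 1/(1+X); this is the truncated form of
-- (1+X)f' = f.
open PowerSeries in
theorem one_add_X_mul_deriv_expLogPartial (N : ℕ) :
    (1 + X) * derivative ℂ (expLogPartial (N + 1)) = expLogPartial N := by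
  rw [expLogPartial, expLogPartial, map_sum, Finset.mul_sum, Finset.sum_range_succ']
  have h0 : (1 + X) * (derivative ℂ) (((Nat.factorial 0 : ℕ) : ℂ)⁻¹ • log ℂ ^ 0) = 0 := by
    rw [pow_zero, Derivation.map_smul, Derivation.map_one_eq_zero, smul_zero, mul_zero]
  rw [h0, add_zero]
  refine Finset.sum_congr rfl fun n _ => ?_
  rw [Derivation.map_smul, Derivation.leibniz_pow, add_tsub_cancel_right, mul_smul_comm,
    smul_eq_mul, mul_smul_comm, mul_left_comm, one_add_X_mul_deriv_log, mul_one,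
    Nat.factorial_succ, ← Nat.cast_smul_eq_nsmul ℂ, smul_smul]
  congr 1
  have h1 : (n.factorial : ℂ) ≠ 0 := by exact_mod_cast n.factorial_ne_zero
  have h2 : ((n : ℂ) + 1) ≠ 0 := by exact_mod_cast n.succ_ne_zero
  push_cast
  field_simp

-- The differential equation gives (j+1)a_{j+1} = (1−j)a_j with a₀ = 1, whose solution is 1 + X.
open PowerSeries in
theorem coeff_expLogPartial {N j : ℕ} (h : j < N) :
    coeff j (expLogPartial N) = coeff j (1 + X : ℂ⟦X⟧) := by
  have stab : ∀ N j : ℕ, j < N → coeff j (expLogPartial (N + 1)) = coeff j (expLogPartial N) := by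
    intro N j hj
    rw [expLogPartial, Finset.sum_range_succ, map_add, map_smul, log_pow_coeff_of_lt hj,
      smul_zero, add_zero]
    rfl
  have hrec : ∀ N j : ℕ, j < N → ((j : ℂ) + 1) * coeff (j + 1) (expLogPartial (N + 1)) =
      (1 - j) * coeff j (expLogPartial N) := by
    intro N j hj
    have h1 := congrArg (coeff j) (one_add_X_mul_deriv_expLogPartial N)
    rw [add_mul, one_mul, map_add, coeff_derivative] at h1
    cases j with
    | zero => simp at h1 ⊢; exact h1
    | succ j =>
      rw [mul_comm X, coeff_succ_mul_X, coeff_derivative, stab N _ hj] at h1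
      push_cast at h1 ⊢
      linear_combination h1
  induction j generalizing N with
  | zero =>
    obtain ⟨N, rfl⟩ : ∃ N', N = N' + 1 := ⟨N - 1, by omega⟩
    clear h
    induction N with
    | zero => simp [expLogPartial]
    | succ N ih => rw [stab _ _ (by omega), ih]
  | succ j ih =>
    obtain ⟨N, rfl⟩ : ∃ N', N = N' + 1 := ⟨N - 1, by omega⟩
    have h1 := hrec N j (by omega)
    rw [ih (by omega)] at h1
    have h2 : ((j : ℂ) + 1) ≠ 0 := by exact_mod_cast j.succ_ne_zero
    apply mul_left_cancel₀ h2
    rw [h1]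
    match j with
    | 0 => simp
    | 1 => simp [coeff_X, coeff_one]
    | j + 2 => simp [coeff_X, coeff_one]

end ExpLog

/-! ### One-variable power series evaluated at noncommutative formal series, and exp(−ad h). -/

section Ring

variable {L A : Type*} [DecidableEq L] [Ring A] [Algebra ℂ A]

theorem mvps_mul_apply (f g : MvPowerSeries L A) (m : L →₀ ℕ) :
    (f * g) m = ∑ x ∈ Finset.HasAntidiagonal.antidiagonal m, f x.1 * g x.2 :=
  MvPowerSeries.coeff_mul m f g

theorem mvps_smul_apply (c : ℂ) (f : MvPowerSeries L A) (m : L →₀ ℕ) : (c • f) m = c • f m := rfl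

theorem mvps_add_apply (f g : MvPowerSeries L A) (m : L →₀ ℕ) : (f + g) m = f m + g m := rfl

theorem mvps_sub_apply (f g : MvPowerSeries L A) (m : L →₀ ℕ) : (f - g) m = f m - g m := rfl

theorem mvps_sum_apply {ι : Type*} (s : Finset ι) (f : ι → MvPowerSeries L A) (m : L →₀ ℕ) :
    (∑ i ∈ s, f i) m = ∑ i ∈ s, f i m :=
  map_sum (MvPowerSeries.coeff m) f s

theorem mvps_one_apply (m : L →₀ ℕ) : (1 : MvPowerSeries L A) m = if m = 0 then 1 else 0 :=
  MvPowerSeries.coeff_one m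

/-- `f` starts in total degree at least `n`. -/
def OrderGE (n : ℕ) (f : MvPowerSeries L A) : Prop := ∀ m : L →₀ ℕ, m.degree < n → f m = 0

theorem OrderGE.mul {i j : ℕ} {f g : MvPowerSeries L A} (hf : OrderGE i f) (hg : OrderGE j g) :
    OrderGE (i + j) (f * g) := by
  intro m hm
  rw [mvps_mul_apply]
  refine Finset.sum_eq_zero fun x hx => ?_
  rw [Finset.HasAntidiagonal.mem_antidiagonal] at hx
  rw [← hx, map_add] at hm
  by_cases h : x.1.degree < i
  · rw [hf _ h, zero_mul]
  · rw [hg _ (by omega), mul_zero]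

theorem OrderGE.pow {f : MvPowerSeries L A} (hf : OrderGE 1 f) (n : ℕ) : OrderGE n (f ^ n) := by
  induction n with
  | zero => intro m hm; omega
  | succ n ih => rw [pow_succ]; exact ih.mul hf

theorem mul_congr_below {N : ℕ} {f f' g g' : MvPowerSeries L A}
    (hf : ∀ m : L →₀ ℕ, m.degree < N → f m = f' m) (hg : ∀ m : L →₀ ℕ, m.degree < N → g m = g' m) :
    ∀ m : L →₀ ℕ, m.degree < N → (f * g) m = (f' * g') m := by
  intro m hm
  rw [mvps_mul_apply, mvps_mul_apply]
  refine Finset.sum_congr rfl fun x hx => ?_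
  rw [Finset.HasAntidiagonal.mem_antidiagonal] at hx
  rw [← hx, map_add] at hm
  rw [hf _ (by omega), hg _ (by omega)]

/-- Substitution of a series without constant term into a power series in one variable. -/
def psEval (J : MvPowerSeries L A) (f : PowerSeries ℂ) : MvPowerSeries L A :=
  fun m => ∑ n ∈ Finset.range (m.degree + 1), PowerSeries.coeff n f • (J ^ n) m

theorem psEval_apply {J : MvPowerSeries L A} (hJ : OrderGE 1 J) (f : PowerSeries ℂ) {m : L →₀ ℕ}
    {N : ℕ} (hN : m.degree < N) :
    psEval J f m = (∑ n ∈ Finset.range N, PowerSeries.coeff n f • J ^ n) m := by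
  rw [mvps_sum_apply]
  refine Finset.sum_subset (Finset.range_mono hN) fun n _ hn => ?_
  rw [hJ.pow n m (by simpa using hn), smul_zero]

/-- In each degree finitely many powers of `J` matter, so both factors may be truncated to
polynomials, on which `aeval` is multiplicative. -/
theorem psEval_mul {J : MvPowerSeries L A} (hJ : OrderGE 1 J) (f g : PowerSeries ℂ) :
    psEval J f * psEval J g = psEval J (f * g) := by
  have e : ∀ (N : ℕ) (p : Polynomial ℂ), (∀ k, N ≤ k → p.coeff k = 0 ∨ True) → ∀ m : L →₀ ℕ,
      m.degree < N → (Polynomial.aeval J p) m =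
        (∑ n ∈ Finset.range N, p.coeff n • J ^ n) m := by
    intro N p _ m hm
    rw [Polynomial.aeval_eq_sum_range' (n := max N (p.natDegree + 1)) (by omega)]
    rw [mvps_sum_apply, mvps_sum_apply]
    symm
    refine Finset.sum_subset (Finset.range_mono (le_max_left _ _)) fun n _ hn => ?_
    rw [mvps_smul_apply, hJ.pow n m (by simp at hn; omega), smul_zero]
  have e' : ∀ (N : ℕ) (f : PowerSeries ℂ) (m : L →₀ ℕ), m.degree < N →
      psEval J f m = (Polynomial.aeval J (PowerSeries.trunc N f)) m := by
    intro N f m hm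
    rw [e N _ (fun _ _ => Or.inr trivial) m hm, psEval_apply hJ f hm, mvps_sum_apply, mvps_sum_apply]
    refine Finset.sum_congr rfl fun n hn => ?_
    rw [PowerSeries.coeff_trunc, if_pos (Finset.mem_range.1 hn)]
  funext m
  have hm := Nat.lt_succ_self m.degree
  rw [mul_congr_below (e' _ f) (e' _ g) m hm, ← map_mul, e _ _ (fun _ _ => Or.inr trivial) m hm,
    psEval_apply hJ _ hm, mvps_sum_apply, mvps_sum_apply]
  refine Finset.sum_congr rfl fun n hn => ?_
  rw [PowerSeries.coeff_mul_eq_coeff_trunc_mul_trunc _ _ (Finset.mem_range.1 hn),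
    ← Polynomial.coe_mul, Polynomial.coeff_coe]

theorem psEval_one (J : MvPowerSeries L A) : psEval J 1 = 1 := by
  funext m
  rw [psEval, Finset.sum_range_succ', Finset.sum_eq_zero, zero_add]
  · simp
  · intro n _
    simp [PowerSeries.coeff_one]

theorem psEval_one_add_X {J : MvPowerSeries L A} (hJ : OrderGE 1 J) :
    psEval J (1 + PowerSeries.X) = 1 + J := by
  funext m
  rw [psEval_apply hJ _ (show m.degree < m.degree + 2 by omega), Finset.sum_range_succ',
    Finset.sum_range_succ', Finset.sum_eq_zero, zero_add]
  · simp [PowerSeries.coeff_X, PowerSeries.coeff_one, add_comm]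
  · intro n _
    simp [PowerSeries.coeff_X, PowerSeries.coeff_one]

theorem orderGE_psEval {J : MvPowerSeries L A} (hJ : OrderGE 1 J) {f : PowerSeries ℂ}
    (hf : PowerSeries.coeff 0 f = 0) : OrderGE 1 (psEval J f) := by
  intro m hm
  rw [psEval_apply hJ f hm, Finset.sum_range_one, hf, zero_smul]
  rfl

theorem psEval_pow {J : MvPowerSeries L A} (hJ : OrderGE 1 J) (f : PowerSeries ℂ) (n : ℕ) :
    psEval J f ^ n = psEval J (f ^ n) := by
  induction n with
  | zero => rw [pow_zero, pow_zero, psEval_one]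
  | succ n ih => rw [pow_succ, ih, psEval_mul hJ, pow_succ]

/-- Only powers of the single element `J` occur; exchanging two finite sums leaves the scalar
coefficients of exp(log(1 + X)). -/
theorem psEval_exp_log {J : MvPowerSeries L A} (hJ : OrderGE 1 J) :
    psEval (psEval J (PowerSeries.log ℂ)) (PowerSeries.exp ℂ) = 1 + J := by
  have hh : OrderGE 1 (psEval J (PowerSeries.log ℂ)) := orderGE_psEval hJ (by simp)
  rw [← psEval_one_add_X hJ]
  funext m
  have hm := Nat.lt_succ_self m.degree
  rw [psEval_apply hh _ hm, mvps_sum_apply]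
  simp only [psEval_pow hJ, mvps_smul_apply, psEval_apply hJ _ hm, mvps_sum_apply, Finset.smul_sum]
  rw [Finset.sum_comm]
  refine Finset.sum_congr rfl fun j hj => ?_
  rw [← coeff_expLogPartial (Finset.mem_range.1 hj), expLogPartial, map_sum, Finset.sum_smul]
  refine Finset.sum_congr rfl fun n _ => ?_
  rw [smul_smul, PowerSeries.coeff_exp, map_smul, smul_eq_mul]
  simp

/-- The exponential of a series without constant term. -/
def expSer (h : MvPowerSeries L A) : MvPowerSeries L A := psEval h (PowerSeries.exp ℂ)

/-- The exponential of minus a series without constant term. -/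
def expNegSer (h : MvPowerSeries L A) : MvPowerSeries L A :=
  psEval h (PowerSeries.evalNegHom (PowerSeries.exp ℂ))

theorem expNegSer_mul_expSer {h : MvPowerSeries L A} (hh : OrderGE 1 h) :
    expNegSer h * expSer h = 1 := by
  rw [expNegSer, expSer, psEval_mul hh, mul_comm, PowerSeries.exp_mul_exp_neg_eq_one, psEval_one]

theorem sum_range_mul_sum_range {M : Type*} [AddCommMonoid M] (N : ℕ) (G : ℕ → ℕ → M)
    (hG : ∀ i j, N ≤ i + j → G i j = 0) :
    ∑ i ∈ Finset.range N, ∑ j ∈ Finset.range N, G i j =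
      ∑ n ∈ Finset.range N, ∑ x ∈ Finset.HasAntidiagonal.antidiagonal n, G x.1 x.2 := by
  rw [← Finset.sum_product', Finset.sum_sigma']
  symm
  refine Finset.sum_bij_ne_zero (fun y _ _ => y.2) ?_ ?_ ?_ ?_
  · rintro ⟨n, x⟩ h _
    simp only [Finset.mem_sigma, Finset.HasAntidiagonal.mem_antidiagonal, Finset.mem_range,
      Finset.mem_product] at h ⊢
    omega
  · rintro ⟨n, x⟩ h _ ⟨n', x'⟩ h' _ hx
    simp only [Finset.mem_sigma, Finset.HasAntidiagonal.mem_antidiagonal] at h h' hx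
    subst hx
    rw [← h.2, ← h'.2]
  · intro x _ hne
    refine ⟨⟨x.1 + x.2, x⟩, ?_, hne, rfl⟩
    simp only [Finset.mem_sigma, Finset.HasAntidiagonal.mem_antidiagonal, Finset.mem_range, and_true]
    by_contra hc
    exact hne (hG _ _ (by omega))
  · intro _ _ _; rfl

/-- `exp (-ad_h) c = exp (-h) c exp h`, degree by degree. -/
theorem sum_ad_eq {h : MvPowerSeries L A} (hh : OrderGE 1 h) (c : MvPowerSeries L A)
    (m : L →₀ ℕ) :
    ∑ n ∈ Finset.range (m.degree + 1), ((-1 : ℂ) ^ n / (n.factorial : ℂ)) •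
      ((fun x => h * x - x * h)^[n] c) m = (expNegSer h * c * expSer h) m := by
  have hm := Nat.lt_succ_self m.degree
  have key := mul_congr_below (N := m.degree + 1) (f := expNegSer h * c) (g := expSer h)
    (fun q hq => mul_congr_below (f := expNegSer h) (g := c)
      (fun q hq => psEval_apply hh (PowerSeries.evalNegHom (PowerSeries.exp ℂ)) hq)
      (fun _ _ => rfl) q hq)
    (fun q hq => psEval_apply hh (PowerSeries.exp ℂ) hq) m hm
  rw [key, Finset.sum_mul, Finset.sum_mul_sum]
  simp only [mvps_sum_apply]
  rw [sum_range_mul_sum_range]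
  · refine Finset.sum_congr rfl fun n _ => ?_
    have h1 : (fun x => h * x - x * h)^[n] c =
        ((LinearMap.mulLeft ℂ h - LinearMap.mulRight ℂ h) ^ n) c := by
      rw [Module.End.pow_apply]
      rfl
    -- Left and right multiplications commute, so the binomial theorem expands the powers of ad h.
    have h2 : Commute (LinearMap.mulLeft ℂ h) (-LinearMap.mulRight ℂ h) :=
      (LinearMap.commute_mulLeft_right (R := ℂ) h h).neg_right
    rw [h1, sub_eq_add_neg, h2.add_pow', LinearMap.sum_apply, mvps_sum_apply, Finset.smul_sum]
    refine Finset.sum_congr rfl fun x hx => ?_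
    rw [Finset.HasAntidiagonal.mem_antidiagonal] at hx
    rw [neg_pow (LinearMap.mulRight ℂ h), LinearMap.pow_mulLeft, LinearMap.pow_mulRight]
    have h3 : (n.choose x.1 • (LinearMap.mulLeft ℂ (h ^ x.1) * ((-1) ^ x.2 *
        LinearMap.mulRight ℂ (h ^ x.2)))) c =
        (((n.choose x.1 : ℂ)) * (-1) ^ x.2) • (h ^ x.1 * c * h ^ x.2) := by
      rw [← Nat.cast_smul_eq_nsmul ℂ, LinearMap.smul_apply, mul_smul]
      congr 1
      have : ((-1 : Module.End ℂ (MvPowerSeries L A)) ^ x.2) = ((-1 : ℂ) ^ x.2) • 1 := by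
        rw [show (-1 : Module.End ℂ (MvPowerSeries L A)) = (-1 : ℂ) • 1 from (neg_one_smul ℂ _).symm,
          smul_pow, one_pow]
      rw [this, smul_mul_assoc, one_mul, mul_smul_comm, LinearMap.smul_apply]
      congr 1
      simp [mul_assoc]
    rw [h3, mvps_smul_apply, smul_smul]
    simp only [smul_mul_assoc, mul_smul_comm, smul_smul, mvps_smul_apply]
    congr 1
    rw [PowerSeries.evalNegHom, PowerSeries.coeff_rescale, PowerSeries.coeff_exp, PowerSeries.coeff_exp, ← hx]
    simp only [map_div₀, map_one, map_natCast]
    have h4 : ((x.1 + x.2).choose x.1 : ℂ) * (x.1.factorial : ℂ) * (x.2.factorial : ℂ) =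
        ((x.1 + x.2).factorial : ℂ) := by
      have := Nat.choose_mul_factorial_mul_factorial (Nat.le_add_right x.1 x.2)
      rw [Nat.add_sub_cancel_left] at this
      exact_mod_cast this
    have f1 : (x.1.factorial : ℂ) ≠ 0 := by exact_mod_cast Nat.factorial_ne_zero _
    have f2 : (x.2.factorial : ℂ) ≠ 0 := by exact_mod_cast Nat.factorial_ne_zero _
    have f3 : ((x.1 + x.2).factorial : ℂ) ≠ 0 := by exact_mod_cast Nat.factorial_ne_zero _
    have f4 : ((-1 : ℂ) ^ x.2) * (-1) ^ x.2 = 1 := by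
      rw [← mul_pow]; simp
    rw [pow_add]
    field_simp
    rw [← h4]
    linear_combination (((x.1 + x.2).choose x.1 : ℂ) * (x.1.factorial : ℂ) *
      (x.2.factorial : ℂ)) * f4
  · intro i j hij
    have := ((hh.pow i).mul (j := 0) (g := c) (fun _ h => absurd h (by omega))).mul (hh.pow j) m
      (by omega)
    simp only [smul_mul_assoc, mul_smul_comm, mvps_smul_apply, this, smul_zero]

end Ring

/-! ### Word series in an algebra: conjugation by characters and the Dynkin–Specht–Wever formula. -/

section WordSeries

variable {L A : Type*} [DecidableEq L] [Ring A] [Algebra ℂ A]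

/-- The series `∑_w f(w)`, graded by the content of the words. -/
def ser (f : List L → A) : MvPowerSeries L A := fun m => ∑ w ∈ wordsOf m, f w

theorem ser_mul (f g : List L → A) :
    ser f * ser g = ser fun w => splitSum (fun u v => f u * g v) w := by
  funext m
  rw [mvps_mul_apply, ser, ← pairSum_eq_sum_splitSum]
  refine Finset.sum_congr rfl fun x _ => ?_
  rw [ser, ser, Finset.sum_mul_sum]

/-- The iterated commutator `[… [[P, x₁], x₂] …, x_n]`. -/
def adWord (ξ : L → A) : A → List L → A
  | P, [] => P
  | P, a :: w => adWord ξ (P * ξ a - ξ a * P) w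

theorem adWord_zero (ξ : L → A) (w : List L) : adWord ξ 0 w = 0 := by
  induction w with
  | nil => rfl
  | cons a w ih => simpa [adWord] using ih

theorem adWord_one (ξ : L → A) {w : List L} (h : w ≠ []) : adWord ξ 1 w = 0 := by
  cases w with
  | nil => exact absurd rfl h
  | cons a w => simp [adWord, adWord_zero]

/-- Each commutator puts its letter on the right with sign + or on the left with sign −; letters put
on the left accumulate in reversed order. -/
theorem unshuffleSum_eq_adWord (ξ : L → A) (P : A) (w : List L) :
    unshuffleSum (fun u v => (-1 : ℂ) ^ u.length • ((u.reverse.map ξ).prod * P * (v.map ξ).prod)) w =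
      adWord ξ P w := by
  induction w generalizing P with
  | nil => simp [unshuffleSum, adWord]
  | cons a w ih =>
    rw [unshuffleSum, adWord, ← ih, ← unshuffleSum_add]
    congr 1
    funext u v
    simp only [List.length_cons, List.reverse_cons, List.map_append, List.prod_append,
      List.map_cons, List.map_nil, List.prod_cons, List.prod_nil, mul_one]
    rw [pow_succ, mul_neg_one, neg_smul, neg_add_eq_sub, ← smul_sub]
    congr 1
    noncomm_ring

theorem sum_smul_adWord (ξ : L → A) (P : A) (F : List L → ℂ) (m : L →₀ ℕ) :
    ∑ w ∈ wordsOf m, F w • adWord ξ P w = pairSum m fun u v => shuffleSum u v F •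
      (-1 : ℂ) ^ u.length • ((u.reverse.map ξ).prod * P * (v.map ξ).prod) := by
  rw [pairSum_shuffleSum]
  exact Finset.sum_congr rfl fun w _ => by rw [unshuffleSum_eq_adWord]

/-- The series `∑_w χ(w) x_w`. -/
def wordSer (ξ : L → A) (χ : List L → ℂ) : MvPowerSeries L A :=
  ser fun w => χ w • (w.map ξ).prod

theorem pairSum_reverse_left {M : Type*} [AddCommMonoid M] (m : L →₀ ℕ)
    (H : List L → List L → M) : pairSum m (fun u v => H u.reverse v) = pairSum m H := by
  unfold pairSum
  exact Finset.sum_congr rfl fun x _ =>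
    sum_wordsOf_reverse x.1 fun u => ∑ v ∈ wordsOf x.2, H u v

theorem ser_mul_C_mul_ser (f g : List L → A) (P : A) (m : L →₀ ℕ) :
    (ser f * MvPowerSeries.C P * ser g : MvPowerSeries L A) m = pairSum m fun u v => f u * P * g v := by
  rw [mvps_mul_apply]
  refine Finset.sum_congr rfl fun x _ => ?_
  have : (ser f * MvPowerSeries.C P : MvPowerSeries L A) x.1 = ser f x.1 * P := MvPowerSeries.coeff_mul_C _ _ _
  rw [this, ser, ser, Finset.sum_mul, Finset.sum_mul_sum]

/-- The inverse of `wordSer`. -/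
def wordSerInv (ξ : L → A) (χ : List L → ℂ) : MvPowerSeries L A :=
  ser fun u => ((-1) ^ u.length * χ u.reverse) • (u.map ξ).prod

/-- After undoing the reversal, the coefficient χ(u)χ(v) is a shuffle sum, and adjointness collects
the terms of each nested commutator. -/
theorem wordSerInv_mul_C_mul {χ : List L → ℂ} (h : IsShuffleChar χ) (ξ : L → A) (P : A) :
    wordSerInv ξ χ * MvPowerSeries.C P * wordSer ξ χ = ser fun w => χ w • adWord ξ P w := by
  funext m
  rw [wordSerInv, wordSer, ser_mul_C_mul_ser, ser, sum_smul_adWord, ← pairSum_reverse_left]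
  congr 1
  funext u v
  rw [← h.mul, List.reverse_reverse, List.length_reverse, smul_smul, smul_mul_assoc, smul_mul_assoc,
    mul_smul_comm, smul_smul]
  congr 1
  ring

/-- The case P = 1 of the preceding identity: commutators with 1 vanish, so only the empty word
survives. -/
theorem wordSerInv_mul_wordSer {χ : List L → ℂ} (h : IsShuffleChar χ) (ξ : L → A) :
    wordSerInv ξ χ * wordSer ξ χ = 1 := by
  have := wordSerInv_mul_C_mul h ξ (1 : A)
  rw [map_one, mul_one] at this
  rw [this]
  funext m
  rw [ser, sum_wordsOf, mvps_one_apply, Finset.sum_eq_zero, add_zero]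
  · simp [h.nil, adWord]
  · intro a _
    exact Finset.sum_eq_zero fun w _ => by rw [adWord_one _ (by simp), smul_zero]

theorem orderGE_wordSer_sub_one {χ : List L → ℂ} (h : χ [] = 1) (ξ : L → A) :
    OrderGE 1 (wordSer ξ χ - 1) := by
  intro m hm
  have : m = 0 := by
    rw [Nat.lt_one_iff, Finsupp.degree_eq_zero_iff] at hm
    exact hm
  subst this
  rw [mvps_sub_apply, wordSer, ser, sum_wordsOf_zero, mvps_one_apply]
  simp [h]

/-- The geometric series `(1 + X)⁻¹`. -/
def invSer : PowerSeries ℂ := PowerSeries.mk fun n => (-1) ^ n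

theorem invSer_mul : invSer * (1 + PowerSeries.X) = 1 := by
  ext n
  rw [mul_add, mul_one, map_add, invSer, PowerSeries.coeff_mk, PowerSeries.coeff_one]
  cases n with
  | zero => simp
  | succ n => rw [PowerSeries.coeff_succ_mul_X, PowerSeries.coeff_mk]; simp [pow_succ]

theorem psEval_invSer {J : MvPowerSeries L A} (hJ : OrderGE 1 J) :
    psEval J invSer * (1 + J) = 1 ∧ (1 + J) * psEval J invSer = 1 := by
  rw [← psEval_one_add_X hJ, psEval_mul hJ, psEval_mul hJ, mul_comm (1 + PowerSeries.X), invSer_mul,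
    psEval_one]
  exact ⟨rfl, rfl⟩

/-- Conjugation by a character. -/
theorem psEval_inv_mul_C_mul {χ : List L → ℂ} (h : IsShuffleChar χ) (ξ : L → A) (P : A) :
    psEval (wordSer ξ χ - 1) invSer * MvPowerSeries.C P * wordSer ξ χ =
      ser fun w => χ w • adWord ξ P w := by
  have h1 := (psEval_invSer (orderGE_wordSer_sub_one h.nil ξ)).2
  rw [add_sub_cancel] at h1
  -- A left inverse and a right inverse of the same element agree.
  have h2 : wordSerInv ξ χ = psEval (wordSer ξ χ - 1) invSer := by
    have h3 := congrArg (wordSerInv ξ χ * ·) h1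
    simp only [← mul_assoc, wordSerInv_mul_wordSer h, one_mul, mul_one] at h3
    exact h3.symm
  rw [← h2, wordSerInv_mul_C_mul h]

/-- Products of word series are convolutions of their coefficients, and subtracting 1 removes the
empty word. -/
theorem wordSer_sub_one_pow {χ : List L → ℂ} (h : χ [] = 1) (ξ : L → A) (k : ℕ) :
    (wordSer ξ χ - 1) ^ k = wordSer ξ (convPow χ k) := by
  induction k with
  | zero =>
    rw [pow_zero]
    funext m
    rw [mvps_one_apply, wordSer, ser, sum_wordsOf, Finset.sum_eq_zero, add_zero]
    · simp [convPow]
    · intro a _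
      exact Finset.sum_eq_zero fun w _ => by simp [convPow]
  | succ k ih =>
    have e : wordSer ξ χ - 1 = ser fun w => (if w = [] then 0 else χ w) • (w.map ξ).prod := by
      funext m
      rw [mvps_sub_apply, wordSer, ser, ser, sum_wordsOf, sum_wordsOf, mvps_one_apply]
      simp [h]
    rw [pow_succ', ih, e, wordSer, ser_mul]
    congr 1
    funext w
    have e2 : ∀ u v : List L, ((if u = [] then 0 else χ u) • (u.map ξ).prod) *
        (convPow χ k v • (v.map ξ).prod) =
        ((if u = [] then 0 else χ u) * convPow χ k v) • ((u ++ v).map ξ).prod := by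
      intro u v
      rw [smul_mul_smul_comm, List.map_append, List.prod_append]
    simp only [e2]
    rw [splitSum_congr (G := fun u v => ((if u = [] then 0 else χ u) * convPow χ k v) •
      (w.map ξ).prod) fun u v huv => by rw [huv]]
    have := map_splitSum (LinearMap.toSpanSingleton ℂ A (w.map ξ).prod).toAddMonoidHom
      (fun u v => (if u = [] then 0 else χ u) * convPow χ k v) w
    simp only [LinearMap.toAddMonoidHom_coe, LinearMap.toSpanSingleton_apply] at this
    rw [← this]
    congr 1
    cases w with
    | nil => simp [splitSum, convPow]
    | cons a w => simp [splitSum, convPow]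

theorem psEval_log {χ : List L → ℂ} (h : χ [] = 1) (ξ : L → A) :
    psEval (wordSer ξ χ - 1) (PowerSeries.log ℂ) = wordSer ξ (wordLog χ) := by
  funext m
  rw [psEval]
  simp only [wordSer_sub_one_pow h]
  simp only [wordSer, ser, Finset.smul_sum, smul_smul]
  rw [Finset.sum_comm]
  refine Finset.sum_congr rfl fun w hw => ?_
  rw [← Finset.sum_smul, wordLog, length_of_mem_wordsOf hw]
  congr 1
  refine Finset.sum_congr rfl fun k _ => ?_
  rw [PowerSeries.coeff_log, logCoeff]
  split_ifs <;> simp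

theorem commutator_prod (ξ : L → A) (E : A) (hE : ∀ a, E * ξ a - ξ a * E = ξ a) (w : List L) :
    E * (w.map ξ).prod - (w.map ξ).prod * E = (w.length : ℂ) • (w.map ξ).prod := by
  induction w with
  | nil => simp
  | cons a w ih =>
    simp only [List.map_cons, List.prod_cons, List.length_cons]
    have : E * (ξ a * (w.map ξ).prod) - ξ a * (w.map ξ).prod * E =
        (E * ξ a - ξ a * E) * (w.map ξ).prod +
          ξ a * (E * (w.map ξ).prod - (w.map ξ).prod * E) := by noncomm_ring
    rw [this, hE, ih, mul_smul_comm]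
    push_cast
    rw [add_smul, one_smul, add_comm]

/-- Shuffles of two nonempty words are killed, so only the pairs with an empty member remain. -/
theorem pairSum_infinitesimal {M : Type*} [AddCommGroup M] [Module ℂ M] {F : List L → ℂ}
    (h0 : F [] = 0) (hF : ∀ a b u v, shuffleSum (a :: u) (b :: v) F = 0) (m : L →₀ ℕ)
    (B : List L → List L → M) :
    pairSum m (fun u v => shuffleSum u v F • B u v) =
      (∑ v ∈ wordsOf m, F v • B [] v) + ∑ u ∈ wordsOf m, F u • B u [] := by
  rw [pairSum_left]
  congr 1
  · simp
  · rw [sum_wordsOf m fun u => F u • B u []]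
    have : (if m = 0 then F [] • B [] [] else 0) = 0 := by simp [h0]
    rw [this, zero_add]
    refine Finset.sum_congr rfl fun a _ => ?_
    rw [pairSum_right]
    simp [hF, pairSum]

/-- The iterated commutators of an infinitesimal character. -/
theorem sum_smul_adWord_infinitesimal {F : List L → ℂ} (h0 : F [] = 0)
    (hF : ∀ a b u v, shuffleSum (a :: u) (b :: v) F = 0) (ξ : L → A) (P : A) (m : L →₀ ℕ) :
    ∑ w ∈ wordsOf m, F w • adWord ξ P w = P * wordSer ξ F m - wordSer ξ F m * P := by
  have key : ∀ P : A, ∑ w ∈ wordsOf m, F w • adWord ξ P w = P * wordSer ξ F m +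
      (∑ u ∈ wordsOf m, F u • (-1 : ℂ) ^ u.length • (u.reverse.map ξ).prod) * P := by
    intro P
    rw [sum_smul_adWord, pairSum_infinitesimal h0 hF, wordSer, ser, Finset.mul_sum, Finset.sum_mul]
    congr 1
    · refine Finset.sum_congr rfl fun v _ => ?_
      simp
    · refine Finset.sum_congr rfl fun u _ => ?_
      simp
  -- At P = 1 the commutators vanish, which identifies the reversed signed sum with minus the word
  -- series.
  have h1 := key 1
  rw [Finset.sum_eq_zero, one_mul, mul_one] at h1
  · rw [key, eq_neg_of_add_eq_zero_right h1.symm, neg_mul, sub_eq_add_neg]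
  · intro w _
    cases w with
    | nil => simp [h0]
    | cons a w => rw [adWord_one _ (by simp), smul_zero]

/-- The Dynkin–Specht–Wever formula for the logarithm of a character. -/
theorem degree_smul_wordSer_wordLog {χ : List L → ℂ} (h : IsShuffleChar χ) (ξ : L → A) (E : A)
    (hE : ∀ a, E * ξ a - ξ a * E = ξ a) (m : L →₀ ℕ) :
    (m.degree : ℂ) • wordSer ξ (wordLog χ) m =
      ∑ w ∈ wordsOf m, wordLog χ w • adWord ξ E w := by
  rw [sum_smul_adWord_infinitesimal (wordLog_nil χ) (fun a b u v => shuffleSum_wordLog h a b u v),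
    wordSer, ser, Finset.mul_sum, Finset.sum_mul, ← Finset.sum_sub_distrib, Finset.smul_sum]
  refine Finset.sum_congr rfl fun w hw => ?_
  -- Commutation with `E` multiplies a word by its length, which is `m.degree` for every word of
  -- content `m`.
  rw [mul_smul_comm, smul_mul_assoc, ← smul_sub, commutator_prod ξ E hE, smul_comm,
    length_of_mem_wordsOf hw]

end WordSeries

/-! ### Integrable majorants of the kernel 1/(e^z − 1). -/

section KernelBounds

theorem norm_exp_sub_one_sq (x θ : ℝ) : ‖Complex.exp (x + θ * Complex.I) - 1‖ ^ 2 =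
    (Real.exp x - 1) ^ 2 + 4 * Real.exp x * Real.sin (θ / 2) ^ 2 := by
  have h1 : Real.cos θ = 1 - 2 * Real.sin (θ / 2) ^ 2 := by
    rw [show θ = 2 * (θ / 2) by ring, Real.cos_two_mul, Real.cos_sq']
    ring_nf
  rw [Complex.sq_norm, Complex.normSq_apply]
  simp only [Complex.sub_re, Complex.sub_im, Complex.exp_re, Complex.exp_im, Complex.add_re,
    Complex.add_im, Complex.ofReal_re, Complex.ofReal_im, Complex.mul_re, Complex.mul_im,
    Complex.I_re, Complex.I_im, Complex.one_re, Complex.one_im]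
  have h2 := Real.sin_sq_add_cos_sq θ
  simp only [mul_zero, sub_zero, add_zero, zero_add, mul_one]
  linear_combination (Real.exp x) ^ 2 * h2 - 2 * Real.exp x * h1

/-- Compare |e^z − 1|² = (e^x − 1)² + 4e^x sin²(θ/2) with (1 + e^x)² = (e^x − 1)² + 4e^x. -/
theorem one_add_exp_mul_abs_sin_le (z : ℂ) :
    |Real.sin (z.im / 2)| * (1 + Real.exp z.re) ≤ ‖Complex.exp z - 1‖ := by
  have h := norm_exp_sub_one_sq z.re z.im
  rw [Complex.re_add_im] at h
  refine abs_le_of_sq_le_sq' ?_ (norm_nonneg _) |>.2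
  rw [h, mul_pow, sq_abs]
  nlinarith [mul_nonneg (sq_nonneg (Real.exp z.re - 1))
    (sub_nonneg.2 (Real.sin_sq_le_one (z.im / 2)))]

theorem abs_exp_re_sub_one_le (z : ℂ) : |Real.exp z.re - 1| ≤ ‖Complex.exp z - 1‖ := by
  have h := norm_exp_sub_one_sq z.re z.im
  rw [Complex.re_add_im] at h
  refine abs_le_of_sq_le_sq' ?_ (norm_nonneg _) |>.2
  rw [h, sq_abs]
  have := mul_nonneg (Real.exp_pos z.re).le (sq_nonneg (Real.sin (z.im / 2)))
  linarith

theorem max_mul_le_abs_exp_sub_one {x : ℝ} :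
    max 1 (Real.exp x) * (|x| / (1 + |x|)) ≤ |Real.exp x - 1| := by
  have key : ∀ y : ℝ, 0 ≤ y → y / (1 + y) ≤ 1 - Real.exp (-y) := by
    intro y hy
    have h1 := Real.add_one_le_exp y
    rw [Real.exp_neg, div_le_iff₀ (by linarith)]
    have h2 : (Real.exp y)⁻¹ * (1 + y) ≤ 1 := by
      rw [inv_mul_le_iff₀ (Real.exp_pos y)]; linarith
    nlinarith
  rcases le_total 0 x with hx | hx
  · have h1 : 1 ≤ Real.exp x := Real.one_le_exp hx
    rw [max_eq_right h1, abs_of_nonneg hx, abs_of_nonneg (by linarith)]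
    have := mul_le_mul_of_nonneg_left (key x hx) (Real.exp_pos x).le
    rw [mul_sub, ← Real.exp_add] at this
    simpa using this
  · have h1 : Real.exp x ≤ 1 := Real.exp_le_one_iff.2 hx
    rw [max_eq_left h1, abs_of_nonpos hx, abs_of_nonpos (by linarith)]
    have := key (-x) (by linarith)
    rw [neg_neg] at this
    linarith

/-- The angular majorant of the kernel `1 / (e^z - 1)`. -/
def angMaj (θ : ℝ) : ℝ := |Real.sin (θ / 2)| ^ (-(1 / 2) : ℝ)

/-- The radial majorant of the kernel `1 / (e^z - 1)`. -/
def radMaj (x : ℝ) : ℝ := (max 1 (Real.exp x))⁻¹ * (1 + |x| ^ (-(1 / 2) : ℝ))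

theorem angMaj_nonneg (θ : ℝ) : 0 ≤ angMaj θ := Real.rpow_nonneg (abs_nonneg _) _

theorem radMaj_nonneg (x : ℝ) : 0 ≤ radMaj x :=
  mul_nonneg (inv_nonneg.2 (le_max_of_le_left zero_le_one))
    (add_nonneg zero_le_one (Real.rpow_nonneg (abs_nonneg _) _))

/-- The geometric mean of an angular and a radial lower bound of |e^z − 1|. Each variable gets a
singularity of exponent −1/2, so the majorant is a product of locally integrable functions. The
zeros are excluded because `0 ^ (-1/2) = 0` for real powers. -/
theorem norm_inv_exp_sub_one_le {z : ℂ} (h1 : Real.sin (z.im / 2) ≠ 0) (h2 : z.re ≠ 0) :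
    ‖(Complex.exp z - 1)⁻¹‖ ≤ angMaj z.im * radMaj z.re := by
  set N := ‖Complex.exp z - 1‖
  set s := |Real.sin (z.im / 2)| with hs
  set m := max 1 (Real.exp z.re)
  set x := |z.re|
  have hs0 : 0 < s := abs_pos.2 h1
  have hx0 : 0 < x := abs_pos.2 h2
  have hm : 0 < m := lt_max_of_lt_left one_pos
  have hN1 : s * m ≤ N := le_trans (mul_le_mul_of_nonneg_left
    (max_le (by linarith [Real.exp_pos z.re]) (by linarith)) hs0.le) (one_add_exp_mul_abs_sin_le z)
  have hN2 : m * (x / (1 + x)) ≤ N := max_mul_le_abs_exp_sub_one.trans (abs_exp_re_sub_one_le z)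
  have hx1 : 0 < x / (1 + x) := by positivity
  have hN0 : 0 < N := (mul_pos hs0 hm).trans_le hN1
  have hsq : (s * (m ^ 2) * (x / (1 + x))) ≤ N ^ 2 := by
    calc s * m ^ 2 * (x / (1 + x)) = (s * m) * (m * (x / (1 + x))) := by ring
      _ ≤ N * N := mul_le_mul hN1 hN2 (by positivity) hN0.le
      _ = N ^ 2 := by ring
  rw [norm_inv]
  have hR : 0 ≤ angMaj z.im * radMaj z.re := mul_nonneg (angMaj_nonneg _) (radMaj_nonneg _)
  refine abs_le_of_sq_le_sq' ?_ hR |>.2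
  have ha : angMaj z.im ^ 2 = s⁻¹ := by
    rw [angMaj, ← hs, ← Real.rpow_natCast, ← Real.rpow_mul hs0.le]
    norm_num [Real.rpow_neg_one]
  have hb : x⁻¹ + 1 ≤ (1 + x ^ (-(1 / 2) : ℝ)) ^ 2 := by
    have hxs : (x ^ (-(1 / 2) : ℝ)) ^ 2 = x⁻¹ := by
      rw [← Real.rpow_natCast, ← Real.rpow_mul hx0.le]
      norm_num [Real.rpow_neg_one]
    have := Real.rpow_nonneg hx0.le (-(1 / 2) : ℝ)
    nlinarith
  have e : (N⁻¹) ^ 2 ≤ (s * m ^ 2 * (x / (1 + x)))⁻¹ := by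
    rw [inv_pow]
    exact inv_anti₀ (by positivity) hsq
  refine e.trans ?_
  rw [mul_pow, ha, radMaj, mul_pow]
  have e2 : (s * m ^ 2 * (x / (1 + x)))⁻¹ = s⁻¹ * ((m⁻¹) ^ 2 * (x⁻¹ + 1)) := by
    field_simp
  rw [e2]
  gcongr

/-- The majorant decays like e^{−x} at +∞ and is bounded at −∞, so the weight e^{ηx} with 0 < η < 1
is admissible at both ends. -/
theorem integrable_radMaj {η : ℝ} (h0 : 0 < η) (h1 : η < 1) :
    Integrable fun x : ℝ => Real.exp (η * x) * radMaj x := by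
  have hm : Measurable fun x : ℝ => Real.exp (η * x) * radMaj x := by unfold radMaj; fun_prop
  have key : ∀ b : ℝ, 0 < b →
      IntegrableOn (fun x : ℝ => Real.exp (-b * x) * (1 + x ^ (-(1 / 2) : ℝ))) (Set.Ioi 0) := by
    intro b hb
    have a1 := exp_neg_integrableOn_Ioi 0 hb
    have a2 := integrableOn_rpow_mul_exp_neg_mul_rpow (p := 1) (s := -(1 / 2)) (b := b)
      (by norm_num) one_pos hb
    refine (a1.add a2).congr_fun (fun x _ => ?_) measurableSet_Ioi
    simp only [Pi.add_apply, Real.rpow_one]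
    ring
  have kp : IntegrableOn (fun x : ℝ => Real.exp (η * x) * radMaj x) (Set.Ioi 0) := by
    refine (key (1 - η) (by linarith)).congr_fun (fun x hx => ?_) measurableSet_Ioi
    have hx : 0 < x := hx
    simp only [radMaj]
    rw [max_eq_right (Real.one_le_exp hx.le), abs_of_pos hx, ← Real.exp_neg, ← mul_assoc,
      ← Real.exp_add]
    congr 2
    ring
  have kn : IntegrableOn (fun x : ℝ => Real.exp (η * x) * radMaj x) (Set.Iio 0) := by
    have k := ((integrable_indicator_iff measurableSet_Ioi).2 (key η h0)).comp_neg
    rw [← integrable_indicator_iff measurableSet_Iio]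
    refine k.congr (Filter.Eventually.of_forall fun x => ?_)
    beta_reduce
    by_cases hx : x < 0
    · rw [Set.indicator_of_mem (by simpa using hx), Set.indicator_of_mem (by simpa using hx), radMaj,
        max_eq_left (Real.exp_le_one_iff.2 hx.le), abs_of_neg hx]
      ring_nf
    · rw [Set.indicator_of_notMem (by simpa using hx), Set.indicator_of_notMem (by simpa using hx)]
  rw [← integrableOn_univ, ← Set.Iio_union_Ici (a := (0 : ℝ)), integrableOn_union,
    integrableOn_Ici_iff_integrableOn_Ioi]
  exact ⟨kn, kp⟩

theorem angMaj_periodic : Function.Periodic angMaj (2 * Real.pi) := by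
  intro θ
  rw [angMaj, angMaj, show (θ + 2 * Real.pi) / 2 = θ / 2 + Real.pi by ring, Real.sin_add_pi, abs_neg]

theorem measurable_angMaj : Measurable angMaj := by unfold angMaj; fun_prop

theorem intervalIntegrable_angMaj (a b : ℝ) : IntervalIntegrable angMaj volume a b := by
  refine angMaj_periodic.intervalIntegrable Real.two_pi_pos.ne' (t := -Real.pi) ?_ a b
  have h0 : IntervalIntegrable angMaj volume 0 Real.pi := by
    have h := (intervalIntegral.intervalIntegrable_rpow' (r := -(1 / 2)) (by norm_num)
      (a := 0) (b := Real.pi)).const_mul (Real.pi⁻¹ ^ (-(1 / 2) : ℝ))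
    refine h.mono_fun' measurable_angMaj.aestronglyMeasurable ?_
    rw [Filter.EventuallyLE, ae_restrict_iff' measurableSet_uIoc]
    refine Filter.Eventually.of_forall fun x hx => ?_
    rw [Set.uIoc_of_le Real.pi_pos.le] at hx
    -- Jordan's inequality compares `angMaj` with a multiple of x^{−1/2}.
    have h1 : Real.pi⁻¹ * x ≤ |Real.sin (x / 2)| := by
      have := Real.mul_le_sin (x := x / 2) (by linarith [hx.1]) (by linarith [hx.2])
      refine le_trans (le_of_eq ?_) (this.trans (le_abs_self _))
      field_simp
    have h2 : 0 < Real.pi⁻¹ * x := mul_pos (inv_pos.2 Real.pi_pos) hx.1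
    rw [Real.norm_of_nonneg (angMaj_nonneg x), ← Real.mul_rpow (inv_pos.2 Real.pi_pos).le hx.1.le]
    exact Real.rpow_le_rpow_of_nonpos h2 h1 (by norm_num)
  have h1 : IntervalIntegrable angMaj volume (-Real.pi) 0 := by
    have := h0.symm.comp_mul_left (c := -1)
    have e : (fun x => angMaj (-1 * x)) = angMaj := by
      funext x
      rw [angMaj, angMaj, neg_one_mul, neg_div, Real.sin_neg, abs_neg]
    rw [e] at this
    simpa [div_neg] using this
  have := h1.trans h0
  rwa [show -Real.pi + 2 * Real.pi = Real.pi by ring]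

/-- The integral of the angular majorant over a period. -/
def angConst : ℝ := ∫ θ in (-Real.pi)..Real.pi, angMaj θ

/-- The interval fits into one period, and periodicity removes ψ. Uniformity in ψ makes the later
bounds uniform in the argument of t. -/
theorem setIntegral_angMaj_le {ε : ℝ} (hε : 0 < ε) (hε1 : ε < 1) (ψ : ℝ) :
    ∫ φ in Set.Ioo (-ε) ε, angMaj (φ - ψ) ≤ angConst := by
  have hpi := Real.pi_gt_three
  have h1 : ∫ φ in Set.Ioo (-ε) ε, angMaj (φ - ψ) ≤
      ∫ φ in Set.Ioc (-Real.pi) Real.pi, angMaj (φ - ψ) := by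
    refine setIntegral_mono_set ?_ (Filter.Eventually.of_forall fun _ => angMaj_nonneg _) ?_
    · rw [← intervalIntegrable_iff_integrableOn_Ioc_of_le (by linarith)]
      simpa using (intervalIntegrable_angMaj (-Real.pi - ψ) (Real.pi - ψ)).comp_sub_right ψ
    · refine LE.le.eventuallyLE fun x hx => ?_
      exact ⟨by linarith [hx.1], by linarith [hx.2]⟩
  refine h1.trans (le_of_eq ?_)
  rw [← intervalIntegral.integral_of_le (by linarith),
    intervalIntegral.integral_comp_sub_right (fun x => angMaj x), angConst]
  have := angMaj_periodic.intervalIntegral_add_eq (-Real.pi - ψ) (-Real.pi)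
  rwa [show -Real.pi - ψ + 2 * Real.pi = Real.pi - ψ by ring,
    show -Real.pi + 2 * Real.pi = Real.pi by ring] at this

theorem integrableOn_angMaj (ε ψ : ℝ) :
    IntegrableOn (fun φ => angMaj (φ - ψ)) (Set.Ioo (-ε) ε) := by
  rcases le_total (-ε) ε with h | h
  · have := (intervalIntegrable_angMaj (-ε - ψ) (ε - ψ)).comp_sub_right ψ
    simp only [sub_add_cancel] at this
    rw [intervalIntegrable_iff_integrableOn_Ioo_of_le h] at this
    exact this
  · rw [Set.Ioo_eq_empty (not_lt.2 h)]
    exact integrableOn_empty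

end KernelBounds

/-! ### Integrals over a sector in logarithmic coordinates. -/

section SectorIntegral

/-- The point `d e^{u + iφ}`. -/
def sPt (d : ℂ) (p : ℝ × ℝ) : ℂ := d * Complex.exp (p.2 + p.1 * Complex.I)

theorem sPt_ne_zero {d : ℂ} (hd : d ≠ 0) (p : ℝ × ℝ) : sPt d p ≠ 0 :=
  mul_ne_zero hd (Complex.exp_ne_zero _)

theorem norm_sPt (d : ℂ) (p : ℝ × ℝ) : ‖sPt d p‖ = ‖d‖ * Real.exp p.2 := by
  rw [sPt, norm_mul, Complex.norm_exp]
  simp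

theorem measurable_sPt (d : ℂ) : Measurable (sPt d) := by
  unfold sPt
  fun_prop

/-- The sector of opening `ε` in logarithmic coordinates. -/
def sectorMeas (ε : ℝ) : Measure (ℝ × ℝ) := (volume.restrict (Set.Ioo (-ε) ε)).prod volume

instance (ε : ℝ) : SFinite (sectorMeas ε) := by unfold sectorMeas; infer_instance

theorem ae_sectorMeas_ne (ε a b : ℝ) : ∀ᵐ p ∂sectorMeas ε, p.1 ≠ a ∧ p.2 ≠ b := by
  have h1 : ∀ᵐ φ ∂(volume.restrict (Set.Ioo (-ε) ε)), φ ≠ a :=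
    ae_restrict_of_ae (Measure.ae_ne volume a)
  have h2 : ∀ᵐ u ∂(volume : Measure ℝ), u ≠ b := Measure.ae_ne volume b
  exact (Measure.quasiMeasurePreserving_fst.ae h1).and (Measure.quasiMeasurePreserving_snd.ae h2)

theorem ae_sectorMeas_mem (ε : ℝ) : ∀ᵐ p ∂sectorMeas ε, p.1 ∈ Set.Ioo (-ε) ε :=
  Measure.quasiMeasurePreserving_fst.ae (ae_restrict_mem measurableSet_Ioo)

/-- The kernel `t / (s - t)`. -/
def sK (t s : ℂ) : ℂ := t / (s - t)

theorem measurable_sK : Measurable fun p : ℂ × ℂ => sK p.1 p.2 := by unfold sK; fun_prop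

/-- Bounds in a sector. -/
structure SectorBound (d : ℂ) (g : ℂ → ℂ) : Prop where
  measurable : Measurable g
  bound : ∀ η : ℝ, 0 < η → η < 1 → ∃ C : ℝ, 0 ≤ C ∧ ∀ p : ℝ × ℝ, |p.1| < 1 →
    ‖g (sPt d p)‖ ≤ C * Real.exp (η * p.2)

variable {d : ℂ} {ε : ℝ}

/-- The logarithmic coordinate of `t` in the direction `d`. -/
theorem sK_sPt {t : ℂ} (ht : t ≠ 0) (hd : d ≠ 0) (p : ℝ × ℝ) :
    sK t (sPt d p) = (Complex.exp (p.2 + p.1 * Complex.I - Complex.log (t / d)) - 1)⁻¹ := by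
  rw [Complex.exp_sub, Complex.exp_log (div_ne_zero ht hd), sK, sPt, ← one_div]
  have : d * Complex.exp (p.2 + p.1 * Complex.I) - t =
      t * (Complex.exp (p.2 + p.1 * Complex.I) / (t / d) - 1) := by
    field_simp
  rw [this, ← div_div, div_self ht]

theorem sin_half_sub_ne_zero {φ ψ : ℝ} (hφ : |φ| < 1) (hψ : ψ ∈ Set.Ioc (-Real.pi) Real.pi)
    (h : φ ≠ ψ) : Real.sin ((φ - ψ) / 2) ≠ 0 := by
  have hpi := Real.pi_gt_three
  rw [abs_lt] at hφ
  intro h0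
  refine h (sub_eq_zero.1 ?_)
  have := (Real.sin_eq_zero_iff_of_lt_of_lt (x := (φ - ψ) / 2) (by linarith [hψ.2])
    (by linarith [hψ.1])).1 h0
  linarith

/-- Relative to log(t/d) the kernel is 1/(e^z − 1). Centring e^{ηu} at Re log(t/d) extracts the
factor that becomes |t/d|^η. -/
theorem ae_norm_sK_mul_le (hε1 : ε < 1) (hd : d ≠ 0) {g : ℂ → ℂ} {η C : ℝ}
    (hg : ∀ p : ℝ × ℝ, |p.1| < 1 → ‖g (sPt d p)‖ ≤ C * Real.exp (η * p.2)) {t : ℂ} (ht : t ≠ 0) :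
    ∀ᵐ p ∂sectorMeas ε, ‖sK t (sPt d p) * g (sPt d p)‖ ≤
      C * Real.exp (η * (Complex.log (t / d)).re) * (angMaj (p.1 - (Complex.log (t / d)).im) *
        (Real.exp (η * (p.2 - (Complex.log (t / d)).re)) *
          radMaj (p.2 - (Complex.log (t / d)).re))) := by
  have hmem : (Complex.log (t / d)).im ∈ Set.Ioc (-Real.pi) Real.pi :=
    ⟨Complex.neg_pi_lt_log_im _, Complex.log_im_le_pi _⟩
  rw [Set.mem_Ioc] at hmem
  simp only [sK_sPt ht hd]
  set ζ := Complex.log (t / d)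
  filter_upwards [ae_sectorMeas_ne ε ζ.im ζ.re, ae_sectorMeas_mem ε] with p hp hp1
  have hφ : |p.1| < 1 := abs_lt.2 ⟨by linarith [hp1.1], by linarith [hp1.2]⟩
  rw [norm_mul]
  have him : (p.2 + p.1 * Complex.I - ζ).im = p.1 - ζ.im := by simp
  have hre : (p.2 + p.1 * Complex.I - ζ).re = p.2 - ζ.re := by simp
  have h1 := norm_inv_exp_sub_one_le (z := p.2 + p.1 * Complex.I - ζ)
    (by rw [him]; exact sin_half_sub_ne_zero hφ hmem hp.1) (by rw [hre]; exact sub_ne_zero.2 hp.2)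
  rw [him, hre] at h1
  refine (mul_le_mul h1 (hg p hφ) (norm_nonneg _)
    (mul_nonneg (angMaj_nonneg _) (radMaj_nonneg _))).trans (le_of_eq ?_)
  rw [show η * p.2 = η * ζ.re + η * (p.2 - ζ.re) by ring, Real.exp_add]
  ring

theorem integrable_majorant {η : ℝ} (h0 : 0 < η) (h1 : η < 1) (ψ ξ : ℝ) :
    Integrable (fun p : ℝ × ℝ => angMaj (p.1 - ψ) *
      (Real.exp (η * (p.2 - ξ)) * radMaj (p.2 - ξ))) (sectorMeas ε) :=
  (integrableOn_angMaj ε ψ).mul_prod ((integrable_radMaj h0 h1).comp_sub_right ξ)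

theorem SectorBound.measurable_mul {g : ℂ → ℂ} (hg : SectorBound d g) (t : ℂ) :
    Measurable fun p => sK t (sPt d p) * g (sPt d p) :=
  ((measurable_sK.comp (measurable_const.prodMk measurable_id)).comp (measurable_sPt d)).mul
    (hg.measurable.comp (measurable_sPt d))

theorem integrable_sK_mul (hε1 : ε < 1) (hd : d ≠ 0) {g : ℂ → ℂ}
    (hg : SectorBound d g) (t : ℂ) :
    Integrable (fun p => sK t (sPt d p) * g (sPt d p)) (sectorMeas ε) := by
  by_cases ht : t = 0
  · simp [ht, sK]
  obtain ⟨C, _, hb⟩ := hg.bound (1 / 2) (by norm_num) (by norm_num)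
  exact ((integrable_majorant (by norm_num) (by norm_num) _ _).const_mul _).mono'
    (hg.measurable_mul t).aestronglyMeasurable (ae_norm_sK_mul_le hε1 hd hb ht)

/-- Translation invariance in u makes the radial integral independent of t, and the angular one is
bounded uniformly; what remains is |t/d|^η. -/
theorem integral_sK_mul_le (hε : 0 < ε) (hε1 : ε < 1) (hd : d ≠ 0) {g : ℂ → ℂ}
    (hg : SectorBound d g) {η : ℝ} (h0 : 0 < η) (h1 : η < 1) : ∃ C : ℝ, 0 ≤ C ∧ ∀ t : ℂ,
      ∫ p, ‖sK t (sPt d p) * g (sPt d p)‖ ∂sectorMeas ε ≤ C * ‖t‖ ^ η := by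
  obtain ⟨C, hC, hb⟩ := hg.bound η h0 h1
  have hang : 0 ≤ angConst :=
    (setIntegral_nonneg measurableSet_Ioo fun _ _ => angMaj_nonneg _).trans
      (setIntegral_angMaj_le hε hε1 0)
  have hrad : 0 ≤ ∫ x, Real.exp (η * x) * radMaj x :=
    integral_nonneg fun x => mul_nonneg (Real.exp_pos _).le (radMaj_nonneg x)
  refine ⟨C * (‖d‖⁻¹ ^ η) * (angConst * ∫ x, Real.exp (η * x) * radMaj x), by positivity,
    fun t => ?_⟩
  by_cases ht : t = 0
  · simp [ht, sK, Real.zero_rpow h0.ne']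
  refine (integral_mono_ae (integrable_sK_mul hε1 hd hg t).norm
    ((integrable_majorant h0 h1 _ _).const_mul _) (ae_norm_sK_mul_le hε1 hd hb ht)).trans ?_
  rw [integral_const_mul, sectorMeas, integral_prod_mul
    (fun φ => angMaj (φ - (Complex.log (t / d)).im)) (fun u =>
      Real.exp (η * (u - (Complex.log (t / d)).re)) * radMaj (u - (Complex.log (t / d)).re)),
    integral_sub_right_eq_self (fun u => Real.exp (η * u) * radMaj u), Complex.log_re,
    mul_comm η, ← Real.rpow_def_of_pos (norm_pos_iff.2 (div_ne_zero ht hd)), norm_div, div_eq_mul_inv,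
    Real.mul_rpow (norm_nonneg _) (inv_nonneg.2 (norm_nonneg _))]
  have := mul_le_mul_of_nonneg_right
    (setIntegral_angMaj_le hε hε1 (Complex.log (t / d)).im) hrad
  refine (mul_le_mul_of_nonneg_left this (by positivity)).trans (le_of_eq ?_)
  ring

end SectorIntegral

/-! ### Slow growth and the Rota–Baxter identity of the integral operators. -/

section RotaBaxter

/-- Measurable functions of subpolynomial growth. -/
structure SlowGrowth (f : ℂ → ℂ) : Prop where
  measurable : Measurable f
  bound : ∀ η : ℝ, 0 < η → η < 1 → ∃ C : ℝ, 0 ≤ C ∧ ∀ t, ‖f t‖ ≤ C * (1 + ‖t‖ ^ η)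

theorem SlowGrowth.const (c : ℂ) : SlowGrowth fun _ => c :=
  ⟨measurable_const, fun η _ _ => ⟨‖c‖, norm_nonneg c, fun t =>
    le_mul_of_one_le_right (norm_nonneg c) (by linarith [Real.rpow_nonneg (norm_nonneg t) η])⟩⟩

theorem SlowGrowth.add {f g : ℂ → ℂ} (hf : SlowGrowth f) (hg : SlowGrowth g) :
    SlowGrowth fun t => f t + g t := by
  refine ⟨hf.measurable.add hg.measurable, fun η h0 h1 => ?_⟩
  obtain ⟨C, hC, hfb⟩ := hf.bound η h0 h1
  obtain ⟨C', hC', hgb⟩ := hg.bound η h0 h1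
  refine ⟨C + C', add_nonneg hC hC', fun t => ?_⟩
  rw [add_mul]
  exact (norm_add_le _ _).trans (add_le_add (hfb t) (hgb t))

/-- The exponent η is shared: half of it bounds the growth of `f` and half the factor `g`. This is
why the bounds are required for all small exponents. -/
theorem SectorBound.mul_slowGrowth {d : ℂ} {f g : ℂ → ℂ} (hg : SectorBound d g)
    (hf : SlowGrowth f) : SectorBound d fun s => g s * f s := by
  refine ⟨hg.measurable.mul hf.measurable, fun η h0 h1 => ?_⟩
  obtain ⟨C₁, hC₁, hb₁⟩ := hg.bound η h0 h1
  obtain ⟨C₂, hC₂, hb₂⟩ := hg.bound (η / 2) (by linarith) (by linarith)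
  obtain ⟨C, hC, hb⟩ := hf.bound (η / 2) (by linarith) (by linarith)
  refine ⟨C * (C₁ + C₂ * ‖d‖ ^ (η / 2)), by positivity, fun p hp => ?_⟩
  rw [norm_mul]
  have e1 : ‖sPt d p‖ ^ (η / 2) = ‖d‖ ^ (η / 2) * Real.exp (η / 2 * p.2) := by
    rw [norm_sPt, Real.mul_rpow (norm_nonneg _) (Real.exp_pos _).le, ← Real.exp_mul, mul_comm p.2]
  have e2 : Real.exp (η * p.2) = Real.exp (η / 2 * p.2) * Real.exp (η / 2 * p.2) := by
    rw [← Real.exp_add]; ring_nf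
  calc ‖g (sPt d p)‖ * ‖f (sPt d p)‖ ≤ ‖g (sPt d p)‖ * (C * (1 + ‖sPt d p‖ ^ (η / 2))) :=
        mul_le_mul_of_nonneg_left (hb _) (norm_nonneg _)
    _ = C * (‖g (sPt d p)‖ + ‖g (sPt d p)‖ * (‖d‖ ^ (η / 2) * Real.exp (η / 2 * p.2))) := by
        rw [e1]; ring
    _ ≤ C * (C₁ * Real.exp (η * p.2) +
          (C₂ * Real.exp (η / 2 * p.2)) * (‖d‖ ^ (η / 2) * Real.exp (η / 2 * p.2))) := by
        gcongr
        · exact hb₁ p hp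
        · exact hb₂ p hp
    _ = _ := by rw [e2]; ring

/-- The integral operator with kernel `t / (s - t)` along the displaced ray of direction `d`. -/
def secOp (ε : ℝ) (d : ℂ) (g : ℂ → ℂ) (t : ℂ) : ℂ :=
  (1 / (2 * ε : ℂ)) * ∫ p, sK t (sPt d p) * g (sPt d p) ∂sectorMeas ε

variable {d d' : ℂ} {ε : ℝ} {g g' : ℂ → ℂ}

theorem measurable_kernel (d : ℂ) (hg : Measurable g) :
    Measurable fun x : ℂ × (ℝ × ℝ) => sK x.1 (sPt d x.2) * g (sPt d x.2) :=
  (measurable_sK.comp (measurable_fst.prodMk ((measurable_sPt d).comp measurable_snd))).mul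
    (hg.comp ((measurable_sPt d).comp measurable_snd))

theorem slowGrowth_integral_norm (hε : 0 < ε) (hε1 : ε < 1) (hd : d ≠ 0) (hg : SectorBound d g) :
    SlowGrowth fun t =>
      ((∫ p, ‖sK t (sPt d p) * g (sPt d p)‖ ∂sectorMeas ε : ℝ) : ℂ) := by
  refine ⟨Complex.measurable_ofReal.comp ?_, fun η h0 h1 => ?_⟩
  · exact ((measurable_kernel d hg.measurable).norm.stronglyMeasurable.integral_prod_right').measurable
  · obtain ⟨C, hC, hb⟩ := integral_sK_mul_le hε hε1 hd hg h0 h1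
    refine ⟨C, hC, fun t => ?_⟩
    rw [Complex.norm_real, Real.norm_of_nonneg (integral_nonneg fun _ => norm_nonneg _)]
    exact (hb t).trans (mul_le_mul_of_nonneg_left (by linarith) hC)

theorem slowGrowth_secOp (hε : 0 < ε) (hε1 : ε < 1) (hd : d ≠ 0) (hg : SectorBound d g) :
    SlowGrowth (secOp ε d g) := by
  refine ⟨Measurable.const_mul ?_ _, fun η h0 h1 => ?_⟩
  · exact ((measurable_kernel d hg.measurable).stronglyMeasurable.integral_prod_right').measurable
  · obtain ⟨C, hC, hb⟩ := integral_sK_mul_le hε hε1 hd hg h0 h1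
    refine ⟨‖(1 / (2 * ε : ℂ))‖ * C, by positivity, fun t => ?_⟩
    rw [secOp, norm_mul, mul_assoc]
    refine mul_le_mul_of_nonneg_left ((norm_integral_le_integral_norm _).trans ((hb t).trans ?_))
      (norm_nonneg _)
    exact mul_le_mul_of_nonneg_left (by linarith) hC

theorem ae_sPt_ne (hd : d ≠ 0) (ε : ℝ) (c : ℂ) : ∀ᵐ p ∂sectorMeas ε, sPt d p ≠ c := by
  filter_upwards [ae_sectorMeas_ne ε 0 (Real.log (‖c‖ / ‖d‖))] with p hp h
  refine hp.2 ?_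
  rw [← h, norm_sPt, mul_div_cancel_left₀ _ (norm_ne_zero_iff.2 hd), Real.log_exp]

/-- The inner integral of norms has slow growth, so it can be absorbed into `g` and the bound for
one integral applies again. -/
theorem integrable_double (hε : 0 < ε) (hε1 : ε < 1) (hd : d ≠ 0) (hd' : d' ≠ 0)
    (hg : SectorBound d g) (hg' : SectorBound d' g') (t : ℂ) :
    Integrable (fun x : (ℝ × ℝ) × (ℝ × ℝ) => (sK t (sPt d x.1) * g (sPt d x.1)) *
      (sK (sPt d x.1) (sPt d' x.2) * g' (sPt d' x.2))) ((sectorMeas ε).prod (sectorMeas ε)) := by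
  have hm : Measurable fun x : (ℝ × ℝ) × (ℝ × ℝ) => (sK t (sPt d x.1) * g (sPt d x.1)) *
      (sK (sPt d x.1) (sPt d' x.2) * g' (sPt d' x.2)) := by
    have a1 := hg.measurable
    have a2 := hg'.measurable
    have a3 := measurable_sPt d
    have a4 := measurable_sPt d'
    unfold sK
    fun_prop
  rw [integrable_prod_iff hm.aestronglyMeasurable]
  refine ⟨Filter.Eventually.of_forall fun p => (integrable_sK_mul hε1 hd' hg' (sPt d p)).const_mul
    (sK t (sPt d p) * g (sPt d p)), ?_⟩
  refine (integrable_sK_mul hε1 hd (hg.mul_slowGrowth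
    (slowGrowth_integral_norm hε hε1 hd' hg')) t).norm.congr (Filter.Eventually.of_forall fun p => ?_)
  beta_reduce
  simp only [norm_mul (sK t (sPt d p) * g (sPt d p))]
  rw [integral_const_mul, ← mul_assoc, norm_mul, Complex.norm_real,
    Real.norm_of_nonneg (integral_nonneg fun _ => norm_nonneg _)]

/-- At distinct points K(t,s)K(t,s') = K(t,s)K(s,s') + K(t,s')K(s',s) by partial fractions, and
absolute integrability allows the two terms to be integrated in opposite orders. -/
theorem secOp_mul_secOp (hε : 0 < ε) (hε1 : ε < 1) (hd : d ≠ 0) (hd' : d' ≠ 0)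
    (hg : SectorBound d g) (hg' : SectorBound d' g') (t : ℂ) :
    secOp ε d g t * secOp ε d' g' t =
      secOp ε d (fun s => g s * secOp ε d' g' s) t +
        secOp ε d' (fun s => g' s * secOp ε d g s) t := by
  have i1 := integrable_double hε hε1 hd hd' hg hg' t
  have i2 := (integrable_double hε hε1 hd' hd hg' hg t).swap
  have key : (∫ p, sK t (sPt d p) * g (sPt d p) ∂sectorMeas ε) *
      (∫ q, sK t (sPt d' q) * g' (sPt d' q) ∂sectorMeas ε) =
      (∫ p, (sK t (sPt d p) * g (sPt d p)) *
        ∫ q, sK (sPt d p) (sPt d' q) * g' (sPt d' q) ∂sectorMeas ε ∂sectorMeas ε) +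
      ∫ q, (sK t (sPt d' q) * g' (sPt d' q)) *
        ∫ p, sK (sPt d' q) (sPt d p) * g (sPt d p) ∂sectorMeas ε ∂sectorMeas ε := by
    have e1 := integral_prod _ i1
    have e2 := integral_prod _ (integrable_double hε hε1 hd' hd hg' hg t)
    simp only [integral_const_mul] at e1 e2
    rw [← e1, ← e2, ← integral_prod_mul, ← integral_prod_swap (fun x : (ℝ × ℝ) × (ℝ × ℝ) =>
      (sK t (sPt d' x.1) * g' (sPt d' x.1)) * (sK (sPt d' x.1) (sPt d x.2) * g (sPt d x.2)))]
    refine Eq.trans ?_ (integral_add i1 i2)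
    refine integral_congr_ae ?_
    have n1 : ∀ᵐ x ∂(sectorMeas ε).prod (sectorMeas ε), sPt d x.1 ≠ t :=
      Measure.quasiMeasurePreserving_fst.ae (ae_sPt_ne hd ε t)
    have n2 : ∀ᵐ x ∂(sectorMeas ε).prod (sectorMeas ε), sPt d' x.2 ≠ t :=
      Measure.quasiMeasurePreserving_snd.ae (ae_sPt_ne hd' ε t)
    -- Even for equal directions, coincidence is a null event: the modulus of one point fixes the
    -- radial coordinate of the other.
    have n3 : ∀ᵐ x ∂(sectorMeas ε).prod (sectorMeas ε), sPt d' x.2 ≠ sPt d x.1 := by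
      have hms : MeasurableSet {x : (ℝ × ℝ) × (ℝ × ℝ) | sPt d' x.2 ≠ sPt d x.1} :=
        (measurableSet_eq_fun ((measurable_sPt d').comp measurable_snd)
          ((measurable_sPt d).comp measurable_fst)).compl
      exact (Measure.ae_prod_mem_iff_ae_ae_mem hms).2
        (Filter.Eventually.of_forall fun p => ae_sPt_ne hd' ε (sPt d p))
    filter_upwards [n1, n2, n3] with x h1 h2 h3
    simp only [sK, Prod.swap]
    have h1 := sub_ne_zero.2 h1
    have h2 := sub_ne_zero.2 h2
    have h4 := sub_ne_zero.2 h3.symm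
    have h3 := sub_ne_zero.2 h3
    have h5 : sPt d x.1 - sPt d' x.2 = -(sPt d' x.2 - sPt d x.1) := by ring
    rw [h5]
    field_simp
    ring
  simp only [secOp]
  calc _ = (1 / (2 * ε : ℂ)) * (1 / (2 * ε : ℂ)) *
      ((∫ p, sK t (sPt d p) * g (sPt d p) ∂sectorMeas ε) *
      (∫ q, sK t (sPt d' q) * g' (sPt d' q) ∂sectorMeas ε)) := by ring
    _ = _ := by
      have r : ∀ (d d' : ℂ) (g g' : ℂ → ℂ), (∫ p, sK t (sPt d p) * (g (sPt d p) *
          ((1 / (2 * ε : ℂ)) * ∫ q, sK (sPt d p) (sPt d' q) * g' (sPt d' q) ∂sectorMeas ε))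
            ∂sectorMeas ε) = (1 / (2 * ε : ℂ)) * ∫ p, (sK t (sPt d p) * g (sPt d p)) *
          ∫ q, sK (sPt d p) (sPt d' q) * g' (sPt d' q) ∂sectorMeas ε ∂sectorMeas ε := by
        intro d d' g g'
        rw [← integral_const_mul]
        congr 1
        funext p
        ring
      rw [key, r, r]
      ring

end RotaBaxter

/-! ### Iterated integrals along displaced BPS rays as a character. -/

section RayIntegral

variable {r : ℕ} (D : RefinedBPS r)

/-- The change to logarithmic coordinates. -/
theorem integral_sector (ε : ℝ) (F : ℝ × ℝ → ℂ) :
    ∫ p in Set.Ioo (-ε) ε ×ˢ Set.Ioi (0 : ℝ), F p =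
      ∫ p, (Real.exp p.2 : ℂ) * F (p.1, Real.exp p.2) ∂sectorMeas ε := by
  have himg : (fun p : ℝ × ℝ => (p.1, Real.exp p.2)) '' (Set.Ioo (-ε) ε ×ˢ Set.univ) =
      Set.Ioo (-ε) ε ×ˢ Set.Ioi (0 : ℝ) := by
    ext ⟨a, b⟩
    simp only [Set.mem_image, Set.mem_prod, Set.mem_univ, and_true, Prod.mk.injEq, Prod.exists,
      Set.mem_Ioi]
    constructor
    · rintro ⟨x, y, hx, rfl, rfl⟩
      exact ⟨hx, Real.exp_pos y⟩
    · rintro ⟨ha, hb⟩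
      exact ⟨a, Real.log b, ha, rfl, Real.exp_log hb⟩
  have hd : ∀ p ∈ Set.Ioo (-ε) ε ×ˢ (Set.univ : Set ℝ),
      HasFDerivWithinAt (fun p : ℝ × ℝ => (p.1, Real.exp p.2))
        ((ContinuousLinearMap.id ℝ ℝ).prodMap (Real.exp p.2 • ContinuousLinearMap.id ℝ ℝ))
        (Set.Ioo (-ε) ε ×ˢ Set.univ) p := by
    intro p _
    refine HasFDerivAt.hasFDerivWithinAt ?_
    have h1 := (hasFDerivAt_id (𝕜 := ℝ) p.1).prodMap p (Real.hasDerivAt_exp p.2).hasFDerivAt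
    have e : ContinuousLinearMap.toSpanSingleton ℝ (Real.exp p.2) =
        Real.exp p.2 • ContinuousLinearMap.id ℝ ℝ := by
      ext
      simp
    rw [e] at h1
    exact h1
  have hinj : Set.InjOn (fun p : ℝ × ℝ => (p.1, Real.exp p.2))
      (Set.Ioo (-ε) ε ×ˢ Set.univ) := by
    intro p _ q _ h
    rw [Prod.mk.injEq, Real.exp_eq_exp] at h
    exact Prod.ext h.1 h.2
  rw [← himg, integral_image_eq_integral_abs_det_fderiv_smul volume
    (measurableSet_Ioo.prod MeasurableSet.univ) hd hinj, sectorMeas]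
  rw [Measure.volume_eq_prod, ← Measure.prod_restrict, Measure.restrict_univ]
  congr 1
  funext p
  have hdet : ((ContinuousLinearMap.id ℝ ℝ).prodMap
      (Real.exp p.2 • ContinuousLinearMap.id ℝ ℝ)).det = Real.exp p.2 := by
    rw [ContinuousLinearMap.det]
    have : (((ContinuousLinearMap.id ℝ ℝ).prodMap
      (Real.exp p.2 • ContinuousLinearMap.id ℝ ℝ) : ℝ × ℝ →L[ℝ] ℝ × ℝ) : ℝ × ℝ →ₗ[ℝ] ℝ × ℝ) =
      LinearMap.prodMap LinearMap.id (Real.exp p.2 • LinearMap.id) := rfl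
    rw [this, LinearMap.det_prodMap]
    simp
  rw [hdet, abs_of_pos (Real.exp_pos _), Complex.real_smul]

/-- With ρ = e^u the Jacobian turns the direction of the ray into the point t itself, so dt/t²
becomes du/t. -/
theorem rayInt_eq (ε : ℝ) (γ : Charge r) (f : ℂ → ℂ) :
    D.rayInt ε γ f = (1 / (2 * ε : ℂ)) *
      ∫ p, f (sPt (Complex.I * D.Z γ) p) / sPt (Complex.I * D.Z γ) p ∂sectorMeas ε := by
  rw [RefinedBPS.rayInt, integral_sector]
  congr 2
  funext p
  have e : D.rayPt γ p.1 (Real.exp p.2) = sPt (Complex.I * D.Z γ) p := by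
    rw [RefinedBPS.rayPt, sPt, Complex.exp_add, Complex.ofReal_exp, mul_comm (p.1 : ℂ)]
    ring
  simp only [e]
  have e2 : (Real.exp p.2 : ℂ) * (Complex.I * D.Z γ * Complex.exp (Complex.I * p.1)) =
      sPt (Complex.I * D.Z γ) p := by
    rw [← e, RefinedBPS.rayPt]
    ring
  rw [mul_left_comm, e2]
  by_cases h : sPt (Complex.I * D.Z γ) p = 0
  · simp [h]
  · field_simp

/-- The exponential factor of `X^sf`. -/
def ef (γ : Charge r) (t : ℂ) : ℂ := Complex.exp (-(2 * Real.pi * Complex.I * (D.Z γ / t)))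

/-- The operator `f ↦ ∫_{ℓ_γ} 𝒦 X^sf f`. -/
def opT (ε : ℝ) (γ : Charge r) (f : ℂ → ℂ) (t : ℂ) : ℂ :=
  D.rayInt ε γ fun s => kern t s * (ef D γ s * f s)

/-- For vanishing central charge the factor `D.Z γ` in the line element makes the integral zero. -/
theorem opT_of_Z_eq_zero {γ : Charge r} (h : D.Z γ = 0) (ε : ℝ) (f : ℂ → ℂ) (t : ℂ) :
    opT D ε γ f t = 0 := by
  simp [opT, RefinedBPS.rayInt, h]

theorem opT_eq_secOp {γ : Charge r} (h : D.Z γ ≠ 0) (ε : ℝ) (f : ℂ → ℂ) (t : ℂ) :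
    opT D ε γ f t = secOp ε (Complex.I * D.Z γ) (fun s => ef D γ s * f s) t := by
  rw [opT, rayInt_eq, secOp]
  congr 2
  funext p
  have := sPt_ne_zero (mul_ne_zero Complex.I_ne_zero h) p
  rw [kern, sK]
  field_simp

theorem measurable_ef (γ : Charge r) : Measurable (ef D γ) := by
  unfold ef
  fun_prop

theorem ef_sPt {γ : Charge r} (h : D.Z γ ≠ 0) (p : ℝ × ℝ) :
    ef D γ (sPt (Complex.I * D.Z γ) p) =
      Complex.exp (-(2 * Real.pi) * Complex.exp (-(p.2 + p.1 * Complex.I))) := by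
  rw [ef, sPt, Complex.exp_neg (p.2 + p.1 * Complex.I)]
  congr 1
  have := Complex.exp_ne_zero (p.2 + p.1 * Complex.I)
  field_simp

/-- Decay of the exponential factor in logarithmic coordinates. -/
theorem norm_exp_neg_exp_le {z : ℂ} (hz : |z.im| < 1) {η : ℝ} (h0 : 0 ≤ η) (h1 : η ≤ 1) :
    ‖Complex.exp (-(2 * Real.pi) * Complex.exp (-z))‖ ≤ Real.exp (η * z.re) := by
  rw [Complex.norm_exp, Real.exp_le_exp]
  have hre : (-(2 * Real.pi) * Complex.exp (-z)).re =
      -(2 * Real.pi * Real.cos z.im) * Real.exp (-z.re) := by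
    have : (-(2 * Real.pi) * Complex.exp (-z) : ℂ) =
        ((-(2 * Real.pi) : ℝ) : ℂ) * Complex.exp (-z) := by push_cast; ring
    rw [this, Complex.re_ofReal_mul, Complex.exp_re]
    simp
    ring
  rw [hre]
  have hcos : 1 / 2 ≤ Real.cos z.im := by
    have := Real.one_sub_sq_div_two_le_cos (x := z.im)
    have h2 : z.im ^ 2 ≤ 1 := by rw [← sq_abs]; nlinarith [abs_nonneg z.im]
    linarith
  have hpi := Real.pi_gt_three
  have hE := Real.exp_pos (-z.re)
  have hE1 := Real.add_one_le_exp (-z.re)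
  -- For Re z ≥ 0 the exponent on the left is negative. For x = Re z ≤ 0 it is at most −e^{−x} ≤ x −
  -- 1 ≤ ηx.
  have h3 : 1 ≤ 2 * Real.pi * Real.cos z.im := by nlinarith
  rcases le_total 0 z.re with hz0 | hz0
  · nlinarith [mul_nonneg h0 hz0]
  · nlinarith

theorem sectorBound_ef {γ : Charge r} (h : D.Z γ ≠ 0) :
    SectorBound (Complex.I * D.Z γ) (ef D γ) := by
  refine ⟨measurable_ef D γ, fun η h0 h1 => ⟨1, zero_le_one, fun p hp => ?_⟩⟩
  rw [ef_sPt D h, one_mul]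
  have := norm_exp_neg_exp_le (z := p.2 + p.1 * Complex.I) (by simpa using hp) h0.le h1.le
  simpa using this

variable {D} {ε : ℝ}

theorem SlowGrowth.opT {f : ℂ → ℂ} (hf : SlowGrowth f) (hε : 0 < ε) (hε1 : ε < 1)
    (γ : Charge r) : SlowGrowth (opT D ε γ f) := by
  by_cases h : D.Z γ = 0
  · have : QRH.opT D ε γ f = fun _ => 0 := funext fun t => opT_of_Z_eq_zero D h ε f t
    rw [this]
    exact SlowGrowth.const 0
  · have : QRH.opT D ε γ f = secOp ε _ fun s => ef D γ s * f s :=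
      funext fun t => opT_eq_secOp D h ε f t
    rw [this]
    exact slowGrowth_secOp hε hε1 (mul_ne_zero Complex.I_ne_zero h)
      ((sectorBound_ef D h).mul_slowGrowth hf)

theorem opT_add {f g : ℂ → ℂ} (hf : SlowGrowth f) (hg : SlowGrowth g) (hε1 : ε < 1)
    (γ : Charge r) (t : ℂ) :
    opT D ε γ (fun s => f s + g s) t = opT D ε γ f t + opT D ε γ g t := by
  by_cases h : D.Z γ = 0
  · simp only [opT_of_Z_eq_zero D h, add_zero]
  · have hd := mul_ne_zero Complex.I_ne_zero h
    simp only [opT_eq_secOp D h, secOp]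
    rw [← mul_add, ← integral_add (integrable_sK_mul hε1 hd
      ((sectorBound_ef D h).mul_slowGrowth hf) t) (integrable_sK_mul hε1 hd
      ((sectorBound_ef D h).mul_slowGrowth hg) t)]
    congr 2
    funext p
    ring

theorem opT_mul_opT {f g : ℂ → ℂ} (hf : SlowGrowth f) (hg : SlowGrowth g) (hε : 0 < ε)
    (hε1 : ε < 1) (γ γ' : Charge r) (t : ℂ) :
    opT D ε γ f t * opT D ε γ' g t =
      opT D ε γ (fun s => f s * opT D ε γ' g s) t + opT D ε γ' (fun s => opT D ε γ f s * g s) t := by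
  by_cases h : D.Z γ = 0
  · simp only [opT_of_Z_eq_zero D h, zero_mul, zero_add]
    by_cases h' : D.Z γ' = 0
    · rw [opT_of_Z_eq_zero D h']
    · simp [opT_eq_secOp D h', secOp]
  by_cases h' : D.Z γ' = 0
  · simp only [opT_of_Z_eq_zero D h', mul_zero, add_zero]
    simp [opT_eq_secOp D h, secOp]
  simp only [opT_eq_secOp D h, opT_eq_secOp D h']
  rw [secOp_mul_secOp hε hε1 (mul_ne_zero Complex.I_ne_zero h) (mul_ne_zero Complex.I_ne_zero h')
    ((sectorBound_ef D h).mul_slowGrowth hf) ((sectorBound_ef D h').mul_slowGrowth hg)]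
  congr 2
  · funext s; ring
  · funext s; ring

variable (D)

/-- The iterated integrals of a word of charges. -/
def wordInt (ε : ℝ) : List (NZCharge r) → ℂ → ℂ
  | [], _ => 1
  | a :: w, t => opT D ε a.1 (wordInt ε w) t

variable {D}

theorem slowGrowth_wordInt (hε : 0 < ε) (hε1 : ε < 1) (w : List (NZCharge r)) :
    SlowGrowth (wordInt D ε w) := by
  induction w with
  | nil => exact SlowGrowth.const 1
  | cons a w ih => exact ih.opT hε hε1 a.1

theorem opT_shuffleSum (hε1 : ε < 1) (γ : Charge r) (t : ℂ) {L : Type*} (u v : List L)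
    {F : List L → ℂ → ℂ} (hF : ∀ w, SlowGrowth (F w)) :
    SlowGrowth (fun s => shuffleSum u v fun w => F w s) ∧
    opT D ε γ (fun s => shuffleSum u v fun w => F w s) t =
      shuffleSum u v fun w => opT D ε γ (F w) t := by
  induction hn : u.length + v.length using Nat.strong_induction_on generalizing u v F with
  | _ n ih =>
  match u, v with
  | [], v => simpa using hF v
  | a :: u, [] => simpa using hF (a :: u)
  | a :: u, b :: v =>
    have h1 := ih (u.length + (b :: v).length) (by simp at hn ⊢; omega) u (b :: v)
      (F := fun w => F (a :: w)) (fun w => hF _) rfl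
    have h2 := ih ((a :: u).length + v.length) (by simp at hn ⊢; omega) (a :: u) v
      (F := fun w => F (b :: w)) (fun w => hF _) rfl
    simp only [shuffleSum_cons_cons]
    exact ⟨h1.1.add h2.1, by rw [opT_add h1.1 h2.1 hε1, h1.2, h2.2]⟩

/-- The iterated integrals form a character of the shuffle algebra. -/
theorem isShuffleChar_wordInt (hε : 0 < ε) (hε1 : ε < 1) (t : ℂ) :
    IsShuffleChar fun w => wordInt D ε w t := by
  refine ⟨rfl, fun u v => ?_⟩
  induction hn : u.length + v.length using Nat.strong_induction_on generalizing u v t with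
  | _ n ih =>
  match u, v with
  | [], v => simp [wordInt]
  | a :: u, [] => simp [wordInt]
  | a :: u, b :: v =>
    have h1 : ∀ s, wordInt D ε u s * wordInt D ε (b :: v) s = _ := fun s =>
      ih (u.length + (b :: v).length) (by simp at hn ⊢; omega) s u (b :: v) rfl
    have h2 : ∀ s, wordInt D ε (a :: u) s * wordInt D ε v s = _ := fun s =>
      ih ((a :: u).length + v.length) (by simp at hn ⊢; omega) s (a :: u) v rfl
    have gw : ∀ w, SlowGrowth (wordInt D ε w) := fun w => slowGrowth_wordInt hε hε1 w
    -- The Rota–Baxter identity leaves integrands that are products of iterated integrals with one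
    -- letter fewer in total, to be expanded by induction.
    have e := opT_mul_opT (D := D) (gw u) (gw v) hε hε1 a.1 b.1 t
    have k1 : (fun s => wordInt D ε u s * opT D ε b.1 (wordInt D ε v) s) = _ := funext h1
    have k2 : (fun s => opT D ε a.1 (wordInt D ε u) s * wordInt D ε v s) = _ := funext h2
    rw [k1, k2, (opT_shuffleSum hε1 _ _ _ _ gw).2, (opT_shuffleSum hε1 _ _ _ _ gw).2] at e
    rw [shuffleSum_cons_cons]
    exact e

end RayIntegral

/-! ### Rotation of contours in logarithmic coordinates. -/

section ContourRotation

/-- A horizontal strip around the real axis. -/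
def strip (δ : ℝ) : Set ℂ := {z | |z.im| < δ}

theorem isOpen_strip (δ : ℝ) : IsOpen (strip δ) :=
  isOpen_lt (Complex.continuous_im.abs) continuous_const

/-- Holomorphic functions on a strip which decay at `-∞` and grow slowly at `+∞`. -/
structure StripDecay (δ : ℝ) (F : ℂ → ℂ) : Prop where
  diff : DifferentiableOn ℂ F (strip δ)
  bound : ∀ η : ℝ, 0 < η → η < 1 → ∃ C : ℝ, 0 ≤ C ∧ ∀ z ∈ strip δ, ‖F z‖ ≤ C * Real.exp (η * z.re)

/-- Cauchy's theorem on the rectangle [−T,T] × [φ₁,φ₂]; the vertical sides are bounded by g(±T)(φ₂ −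
φ₁) and vanish as T → ∞. -/
theorem integral_horizontal_eq {G : ℂ → ℂ} {φ₁ φ₂ : ℝ} (h : φ₁ ≤ φ₂)
    (hG : DifferentiableOn ℂ G {z | z.im ∈ Set.Icc φ₁ φ₂}) {g : ℝ → ℝ} (hg : Integrable g)
    (hgp : Tendsto g atTop (𝓝 0)) (hgm : Tendsto g atBot (𝓝 0))
    (hb : ∀ x y : ℝ, y ∈ Set.Icc φ₁ φ₂ → ‖G (x + y * Complex.I)‖ ≤ g x) :
    ∫ x : ℝ, G (x + φ₁ * Complex.I) = ∫ x : ℝ, G (x + φ₂ * Complex.I) := by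
  have hint : ∀ y ∈ Set.Icc φ₁ φ₂, Integrable fun x : ℝ => G (x + y * Complex.I) := by
    intro y hy
    refine hg.mono' (Continuous.aestronglyMeasurable ?_) (Filter.Eventually.of_forall fun x => hb x y hy)
    refine hG.continuousOn.comp_continuous (by fun_prop) fun x => ?_
    simpa using hy
  have t1 := intervalIntegral_tendsto_integral (hint φ₁ ⟨le_rfl, h⟩) tendsto_neg_atTop_atBot tendsto_id
  have t2 := intervalIntegral_tendsto_integral (hint φ₂ ⟨h, le_rfl⟩) tendsto_neg_atTop_atBot tendsto_id
  refine sub_eq_zero.1 (tendsto_nhds_unique (t1.sub t2) ?_)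
  have hv : ∀ T : ℝ, ‖∫ y in φ₁..φ₂, G (T + y * Complex.I)‖ ≤ g T * |φ₂ - φ₁| := by
    intro T
    refine intervalIntegral.norm_integral_le_of_norm_le_const fun y hy => hb T y ?_
    rw [Set.uIoc_of_le h] at hy
    exact ⟨hy.1.le, hy.2⟩
  refine squeeze_zero_norm (a := fun T => g T * |φ₂ - φ₁| + g (-T) * |φ₂ - φ₁|) (fun T => ?_) ?_
  · have key := Complex.integral_boundary_rect_eq_zero_of_differentiableOn G
      (((-T : ℝ) : ℂ) + φ₁ * Complex.I) (T + φ₂ * Complex.I) (hG.mono fun z hz => by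
        have := hz.2
        simp only [Complex.add_im, Complex.ofReal_im, Complex.mul_im, Complex.ofReal_re,
          Complex.I_im, Complex.I_re, mul_one, mul_zero, add_zero, zero_add, Set.mem_preimage] at this
        rwa [Set.uIcc_of_le h] at this)
    simp only [Complex.add_im, Complex.ofReal_im, Complex.mul_im, Complex.ofReal_re, Complex.add_re,
      Complex.mul_re, Complex.I_im, Complex.I_re, mul_one, mul_zero, add_zero, zero_add,
      sub_self, smul_eq_mul] at key
    have e : (∫ x in (-T)..id T, G (x + φ₁ * Complex.I)) - ∫ x in (-T)..id T, G (x + φ₂ * Complex.I) =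
        -(Complex.I * ∫ y in φ₁..φ₂, G (T + y * Complex.I)) +
          Complex.I * ∫ y in φ₁..φ₂, G (((-T : ℝ) : ℂ) + y * Complex.I) := by
      simp only [id]
      linear_combination key
    rw [e]
    refine (norm_add_le _ _).trans ?_
    rw [norm_neg, norm_mul, norm_mul, Complex.norm_I, one_mul, one_mul]
    exact add_le_add (hv T) (hv (-T))
  · have a1 := hgp.mul_const |φ₂ - φ₁|
    have a2 := (hgm.comp tendsto_neg_atTop_atBot).mul_const |φ₂ - φ₁|
    simpa using a1.add a2

/-- The kernel `1 / (e^z - 1)`. -/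
def expK (z : ℂ) : ℂ := (Complex.exp z - 1)⁻¹

theorem norm_expK_le {z : ℂ} {c : ℝ} (hc : 0 < c) (h : c ≤ |Real.sin (z.im / 2)|) :
    ‖expK z‖ ≤ c⁻¹ * (1 + Real.exp z.re)⁻¹ := by
  have h1 := one_add_exp_mul_abs_sin_le z
  have h2 := Real.exp_pos z.re
  rw [expK, norm_inv, ← mul_inv]
  exact inv_anti₀ (by positivity) ((mul_le_mul_of_nonneg_right h (by positivity)).trans h1)

theorem exp_sub_one_ne_zero {z : ℂ} (h : Real.sin (z.im / 2) ≠ 0) : Complex.exp z - 1 ≠ 0 := by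
  have h1 := one_add_exp_mul_abs_sin_le z
  have h2 := Real.exp_pos z.re
  have : 0 < |Real.sin (z.im / 2)| * (1 + Real.exp z.re) := mul_pos (abs_pos.2 h) (by positivity)
  exact norm_pos_iff.1 (this.trans_le h1)

/-- The convolution with the kernel `expK` along a horizontal line. -/
def lineInt (F : ℂ → ℂ) (φ : ℝ) (ζ : ℂ) : ℂ :=
  ∫ u : ℝ, expK (u + φ * Complex.I - ζ) * F (u + φ * Complex.I)

theorem inv_one_add_exp_le_radMaj (x : ℝ) : (1 + Real.exp x)⁻¹ ≤ radMaj x := by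
  have h := Real.exp_pos x
  have h1 : (1 + Real.exp x)⁻¹ ≤ (max 1 (Real.exp x))⁻¹ :=
    inv_anti₀ (lt_max_of_lt_left one_pos) (max_le (by linarith) (by linarith))
  refine h1.trans (le_mul_of_one_le_right (inv_nonneg.2 (le_max_of_le_left zero_le_one)) ?_)
  linarith [Real.rpow_nonneg (abs_nonneg x) (-(1 / 2) : ℝ)]

theorem integrable_exp_mul_inv {η : ℝ} (h0 : 0 < η) (h1 : η < 1) (ξ : ℝ) :
    Integrable fun u : ℝ => Real.exp (η * (u - ξ)) * (1 + Real.exp (u - ξ))⁻¹ := by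
  refine Integrable.comp_sub_right (f := fun u => Real.exp (η * u) * (1 + Real.exp u)⁻¹) ?_ ξ
  refine (integrable_radMaj h0 h1).mono' (by fun_prop) (Filter.Eventually.of_forall fun u => ?_)
  have := Real.exp_pos u
  rw [Real.norm_of_nonneg (by positivity)]
  exact mul_le_mul_of_nonneg_left (inv_one_add_exp_le_radMaj u) (Real.exp_pos _).le

theorem tendsto_exp_mul_inv {η : ℝ} (h0 : 0 < η) (h1 : η < 1) (ξ : ℝ) :
    Tendsto (fun u : ℝ => Real.exp (η * (u - ξ)) * (1 + Real.exp (u - ξ))⁻¹) atTop (𝓝 0) ∧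
    Tendsto (fun u : ℝ => Real.exp (η * (u - ξ)) * (1 + Real.exp (u - ξ))⁻¹) atBot (𝓝 0) := by
  have hpos : ∀ u : ℝ, 0 ≤ Real.exp (η * (u - ξ)) * (1 + Real.exp (u - ξ))⁻¹ := fun u => by
    have := Real.exp_pos (u - ξ)
    positivity
  constructor
  · refine squeeze_zero (g := fun u => Real.exp ((η - 1) * (u - ξ))) hpos (fun u => ?_) ?_
    · have := Real.exp_pos (u - ξ)
      rw [← div_eq_mul_inv, div_le_iff₀ (by positivity), mul_add, ← Real.exp_add]
      have e : (η - 1) * (u - ξ) + (u - ξ) = η * (u - ξ) := by ring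
      rw [e]
      linarith [Real.exp_pos ((η - 1) * (u - ξ))]
    · refine Real.tendsto_exp_atBot.comp (Tendsto.const_mul_atTop_of_neg (by linarith) ?_)
      exact tendsto_atTop_add_const_right _ (-ξ) tendsto_id
  · refine squeeze_zero (g := fun u => Real.exp (η * (u - ξ))) hpos (fun u => ?_) ?_
    · have := Real.exp_pos (u - ξ)
      exact mul_le_of_le_one_right (Real.exp_pos _).le (inv_le_one_of_one_le₀ (by linarith))
    · refine Real.tendsto_exp_atBot.comp (Tendsto.const_mul_atBot h0 ?_)
      exact tendsto_atBot_add_const_right _ (-ξ) tendsto_id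

variable {δ : ℝ} {F : ℂ → ℂ}

theorem norm_lineIntegrand_le {η C c : ℝ} (hc : 0 < c)
    (hF : ∀ z ∈ strip δ, ‖F z‖ ≤ C * Real.exp (η * z.re)) {φ : ℝ} (hφ : |φ| < δ) {ζ : ℂ}
    (h : c ≤ |Real.sin ((φ - ζ.im) / 2)|) (u : ℝ) :
    ‖expK (u + φ * Complex.I - ζ) * F (u + φ * Complex.I)‖ ≤
      C * c⁻¹ * Real.exp (η * ζ.re) * (Real.exp (η * (u - ζ.re)) * (1 + Real.exp (u - ζ.re))⁻¹) := by
  have him : (u + φ * Complex.I - ζ).im = φ - ζ.im := by simp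
  have hre : (u + φ * Complex.I - ζ).re = u - ζ.re := by simp
  have h1 := norm_expK_le (z := u + φ * Complex.I - ζ) hc (by rwa [him])
  have h2 := hF (u + φ * Complex.I) (by simpa [strip] using hφ)
  have hre2 : (u + φ * Complex.I : ℂ).re = u := by simp
  rw [hre] at h1
  rw [hre2] at h2
  have := Real.exp_pos (u - ζ.re)
  rw [norm_mul]
  refine (mul_le_mul h1 h2 (norm_nonneg _) (by positivity)).trans (le_of_eq ?_)
  rw [show η * u = η * ζ.re + η * (u - ζ.re) by ring, Real.exp_add]
  ring

theorem differentiableOn_lineIntegrand (hF : DifferentiableOn ℂ F (strip δ)) (ζ : ℂ) {s : Set ℂ}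
    (hs : s ⊆ strip δ) (h : ∀ z ∈ s, Real.sin ((z.im - ζ.im) / 2) ≠ 0) :
    DifferentiableOn ℂ (fun z => expK (z - ζ) * F z) s := by
  refine DifferentiableOn.mul (fun z hz => ?_) (hF.mono hs)
  refine DifferentiableAt.differentiableWithinAt ?_
  exact DifferentiableAt.inv (by fun_prop) (exp_sub_one_ne_zero (by simpa using h z hz))

/-- The poles of the kernel lie at the heights Im ζ + 2πℤ, which the region between the two lines
avoids; compactness makes the avoidance uniform. -/
theorem lineInt_eq (hF : StripDecay δ F) {φ₁ φ₂ : ℝ} (h12 : φ₁ ≤ φ₂) (h1 : -δ < φ₁) (h2 : φ₂ < δ)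
    {ζ : ℂ} (h : ∀ φ ∈ Set.Icc φ₁ φ₂, Real.sin ((φ - ζ.im) / 2) ≠ 0) :
    lineInt F φ₁ ζ = lineInt F φ₂ ζ := by
  obtain ⟨φ₀, hφ₀, hmin⟩ := (isCompact_Icc (a := φ₁) (b := φ₂)).exists_isMinOn
    (Set.nonempty_Icc.2 h12) (f := fun φ => |Real.sin ((φ - ζ.im) / 2)|)
    (Continuous.continuousOn (by fun_prop))
  obtain ⟨C, _, hb⟩ := hF.bound (1 / 2) (by norm_num) (by norm_num)
  have hlt := tendsto_exp_mul_inv (η := 1 / 2) (by norm_num) (by norm_num) ζ.re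
  have hmem : ∀ φ ∈ Set.Icc φ₁ φ₂, |φ| < δ := fun φ hφ =>
    abs_lt.2 ⟨by linarith [hφ.1], by linarith [hφ.2]⟩
  set c := |Real.sin ((φ₀ - ζ.im) / 2)| with hc
  refine integral_horizontal_eq (G := fun z => expK (z - ζ) * F z) h12
    (differentiableOn_lineIntegrand hF.diff ζ (fun z hz => hmem _ hz) fun z hz => h _ hz)
    (g := fun u => C * c⁻¹ * Real.exp (1 / 2 * ζ.re) *
      (Real.exp (1 / 2 * (u - ζ.re)) * (1 + Real.exp (u - ζ.re))⁻¹))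
    ((integrable_exp_mul_inv (by norm_num) (by norm_num) _).const_mul _) ?_ ?_ ?_
  · simpa using hlt.1.const_mul (C * c⁻¹ * Real.exp (1 / 2 * ζ.re))
  · simpa using hlt.2.const_mul (C * c⁻¹ * Real.exp (1 / 2 * ζ.re))
  · intro x y hy
    exact norm_lineIntegrand_le (abs_pos.2 (h φ₀ hφ₀)) hb (hmem y hy) (hmin hy) x

theorem integrable_lineIntegrand (hF : StripDecay δ F) {φ : ℝ} (hφ : |φ| < δ) {ζ : ℂ}
    (h : Real.sin ((φ - ζ.im) / 2) ≠ 0) :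
    Integrable fun u : ℝ => expK (u + φ * Complex.I - ζ) * F (u + φ * Complex.I) := by
  obtain ⟨C, _, hb⟩ := hF.bound (1 / 2) (by norm_num) (by norm_num)
  refine ((integrable_exp_mul_inv (η := 1 / 2) (by norm_num) (by norm_num) ζ.re).const_mul _).mono'
    (Continuous.aestronglyMeasurable ?_)
    (Filter.Eventually.of_forall (norm_lineIntegrand_le (abs_pos.2 h) hb hφ le_rfl))
  have hd := differentiableOn_lineIntegrand (s := {z | z.im = φ}) hF.diff ζ
    (fun z hz => by rw [strip, Set.mem_ofPred_eq, show z.im = φ from hz]; exact hφ)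
    (fun z hz => by rwa [show z.im = φ from hz])
  exact hd.continuousOn.comp_continuous (by fun_prop) fun x => by simp

/-- Differentiation under the integral sign. Staying a fixed distance from the poles bounds the
kernel K and its ζ-derivative K(1 + K). -/
theorem stripDecay_lineInt_aux (hF : StripDecay δ F) {φ : ℝ} (hφ : |φ| < δ) {S : Set ℂ}
    (hS : IsOpen S) {c : ℝ} (hc : 0 < c) (h : ∀ ζ ∈ S, c ≤ |Real.sin ((φ - ζ.im) / 2)|) :
    DifferentiableOn ℂ (lineInt F φ) S ∧ ∀ η : ℝ, 0 < η → η < 1 → ∃ C : ℝ, 0 ≤ C ∧ ∀ ζ ∈ S,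
      ‖lineInt F φ ζ‖ ≤ C * Real.exp (η * ζ.re) := by
  have hne : ∀ ζ ∈ S, Real.sin ((φ - ζ.im) / 2) ≠ 0 := fun ζ hζ =>
    abs_pos.1 (hc.trans_le (h ζ hζ))
  constructor
  · intro ζ₀ hζ₀
    obtain ⟨ρ, hρ, hball⟩ := Metric.isOpen_iff.1 hS ζ₀ hζ₀
    obtain ⟨C, hC, hb⟩ := hF.bound (1 / 2) (by norm_num) (by norm_num)
    have hs : Metric.ball ζ₀ (min ρ 1) ∈ 𝓝 ζ₀ := Metric.ball_mem_nhds _ (lt_min hρ one_pos)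
    have hsub : ∀ ζ ∈ Metric.ball ζ₀ (min ρ 1), ζ ∈ S ∧ ζ.re ≤ ζ₀.re + 1 := by
      intro ζ hζ
      rw [Metric.mem_ball, lt_min_iff] at hζ
      refine ⟨hball hζ.1, ?_⟩
      have h1 := Complex.abs_re_le_norm (ζ - ζ₀)
      rw [← dist_eq_norm, Complex.sub_re] at h1
      linarith [le_abs_self (ζ.re - ζ₀.re), hζ.2]
    have hint := integrable_lineIntegrand hF hφ (hne ζ₀ hζ₀)
    have hcont : ∀ ζ ∈ S, Continuous fun u : ℝ => expK (u + φ * Complex.I - ζ) := by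
      intro ζ hζ
      refine Continuous.inv₀ (by fun_prop) fun u => exp_sub_one_ne_zero ?_
      simpa using hne ζ hζ
    have hFc : Continuous fun u : ℝ => F (u + φ * Complex.I) :=
      hF.diff.continuousOn.comp_continuous (by fun_prop) fun x => by simpa [strip] using hφ
    refine DifferentiableAt.differentiableWithinAt (HasDerivAt.differentiableAt
      (hasDerivAt_integral_of_dominated_loc_of_deriv_le (𝕜 := ℂ) hs
      (F := fun ζ (u : ℝ) => expK (u + φ * Complex.I - ζ) * F (u + φ * Complex.I))
      (F' := fun ζ (u : ℝ) => (expK (u + φ * Complex.I - ζ) * (1 + expK (u + φ * Complex.I - ζ))) *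
        F (u + φ * Complex.I))
      (bound := fun u => C * c⁻¹ * (1 + c⁻¹) * Real.exp (1 / 2 * (ζ₀.re + 1)) *
        (Real.exp (1 / 2 * (u - (ζ₀.re + 1))) * (1 + Real.exp (u - (ζ₀.re + 1)))⁻¹))
      ?_ hint ?_ ?_ ?_ ?_).2)
    · filter_upwards [hs] with ζ hζ
      exact ((hcont ζ (hsub ζ hζ).1).mul hFc).aestronglyMeasurable
    · have := hcont ζ₀ hζ₀
      exact ((this.mul (continuous_const.add this)).mul hFc).aestronglyMeasurable
    · refine Filter.Eventually.of_forall fun u ζ hζ => ?_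
      have him : (u + φ * Complex.I - ζ).im = φ - ζ.im := by simp
      have hre : (u + φ * Complex.I - ζ).re = u - ζ.re := by simp
      have h1 := norm_expK_le (z := u + φ * Complex.I - ζ) hc
        (by rw [him]; exact h ζ (hsub ζ hζ).1)
      rw [hre] at h1
      have h2 := hb (u + φ * Complex.I) (by simpa [strip] using hφ)
      have hre2 : (u + φ * Complex.I : ℂ).re = u := by simp
      rw [hre2] at h2
      have p1 := Real.exp_pos (u - ζ.re)
      have p2 := Real.exp_pos (u - (ζ₀.re + 1))
      -- On the ball Re ζ ≤ Re ζ₀ + 1, so monotonicity gives a bound free of ζ.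
      have h3 : (1 + Real.exp (u - ζ.re))⁻¹ ≤ (1 + Real.exp (u - (ζ₀.re + 1)))⁻¹ := by
        refine inv_anti₀ (by positivity) ?_
        have := Real.exp_le_exp.2 (show u - (ζ₀.re + 1) ≤ u - ζ.re by linarith [(hsub ζ hζ).2])
        linarith
      have h4 : ‖1 + expK (u + φ * Complex.I - ζ)‖ ≤ 1 + c⁻¹ := by
        refine (norm_add_le _ _).trans ?_
        rw [norm_one]
        refine add_le_add le_rfl (h1.trans (mul_le_of_le_one_right (by positivity) ?_))
        exact inv_le_one_of_one_le₀ (by linarith)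
      rw [norm_mul, norm_mul]
      have h5 := mul_le_mul (mul_le_mul (h1.trans (mul_le_mul_of_nonneg_left h3
        (inv_pos.2 hc).le)) h4 (norm_nonneg _) (by positivity)) h2 (norm_nonneg _) (by positivity)
      refine h5.trans (le_of_eq ?_)
      rw [show 1 / 2 * u = 1 / 2 * (ζ₀.re + 1) + 1 / 2 * (u - (ζ₀.re + 1)) by ring, Real.exp_add]
      ring
    · exact (integrable_exp_mul_inv (by norm_num) (by norm_num) _).const_mul _
    · refine Filter.Eventually.of_forall fun u ζ hζ => ?_
      have hn : Complex.exp (u + φ * Complex.I - ζ) - 1 ≠ 0 :=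
        exp_sub_one_ne_zero (by simpa using hne ζ (hsub ζ hζ).1)
      have h1 : HasDerivAt (fun ζ : ℂ => Complex.exp (u + φ * Complex.I - ζ) - 1)
          (Complex.exp (u + φ * Complex.I - ζ) * (-1)) ζ :=
        (((hasDerivAt_id ζ).const_sub (u + φ * Complex.I)).cexp).sub_const 1
      have h2 := (h1.inv hn).mul_const (F (u + φ * Complex.I))
      refine h2.congr_deriv ?_
      rw [expK]
      field_simp
      ring
  · intro η h0 h1
    obtain ⟨C, hC, hb⟩ := hF.bound η h0 h1
    have hI : 0 ≤ ∫ u : ℝ, Real.exp (η * u) * (1 + Real.exp u)⁻¹ := integral_nonneg fun u => by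
      have := Real.exp_pos u
      positivity
    refine ⟨C * c⁻¹ * ∫ u : ℝ, Real.exp (η * u) * (1 + Real.exp u)⁻¹, by positivity, fun ζ hζ => ?_⟩
    refine (norm_integral_le_of_norm_le ((integrable_exp_mul_inv h0 h1 ζ.re).const_mul _)
      (Filter.Eventually.of_forall (norm_lineIntegrand_le hc hb hφ (h ζ hζ)))).trans (le_of_eq ?_)
    rw [integral_const_mul, integral_sub_right_eq_self
      (fun u => Real.exp (η * u) * (1 + Real.exp u)⁻¹)]
    ring

end ContourRotation

/-! ### Independence of the averaged integrals from small displacements. -/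

section Expansion

/-- Holomorphic functions of slow growth on a strip. -/
structure StripSlow (δ : ℝ) (A : ℂ → ℂ) : Prop where
  diff : DifferentiableOn ℂ A (strip δ)
  bound : ∀ η : ℝ, 0 < η → η < 1 → ∃ C : ℝ, 0 ≤ C ∧
    ∀ z ∈ strip δ, ‖A z‖ ≤ C * (1 + Real.exp (η * z.re))

/-- The factor exp(−2πe^{−z}) is bounded both by 1 and by e^{η Re z}: the first bound serves the
growing term of the bound of `A`, the second the constant one. -/
theorem StripSlow.mul_exp {δ : ℝ} (hδ : δ ≤ 1) {A : ℂ → ℂ} (hA : StripSlow δ A) :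
    StripDecay δ fun z => Complex.exp (-(2 * Real.pi) * Complex.exp (-z)) * A z := by
  refine ⟨DifferentiableOn.mul (Differentiable.differentiableOn (by fun_prop)) hA.diff,
    fun η h0 h1 => ?_⟩
  obtain ⟨C, hC, hb⟩ := hA.bound η h0 h1
  refine ⟨2 * C, by positivity, fun z hz => ?_⟩
  have hz1 : |z.im| < 1 := lt_of_lt_of_le hz hδ
  have e1 := norm_exp_neg_exp_le hz1 h0.le h1.le
  have e0 := norm_exp_neg_exp_le hz1 le_rfl zero_le_one
  rw [zero_mul, Real.exp_zero] at e0
  rw [norm_mul]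
  have hp := Real.exp_pos (η * z.re)
  set E := ‖Complex.exp (-(2 * Real.pi) * Complex.exp (-z))‖
  calc E * ‖A z‖ ≤ E * (C * (1 + Real.exp (η * z.re))) :=
        mul_le_mul_of_nonneg_left (hb z hz) (norm_nonneg _)
    _ = C * E + C * Real.exp (η * z.re) * E := by ring
    _ ≤ C * Real.exp (η * z.re) + C * Real.exp (η * z.re) * 1 := by gcongr
    _ = _ := by ring

theorem mul_le_abs_sin {a x : ℝ} (ha : 0 < a) (h1 : a ≤ |x|) (h2 : |x| ≤ Real.pi - a) :
    2 / Real.pi * a ≤ |Real.sin x| := by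
  have hp := Real.pi_pos
  have key : ∀ y, a ≤ y → y ≤ Real.pi - a → 2 / Real.pi * a ≤ Real.sin y := by
    intro y hy1 hy2
    rcases le_total y (Real.pi / 2) with h | h
    · exact (mul_le_mul_of_nonneg_left hy1 (by positivity)).trans (Real.mul_le_sin (by linarith) h)
    · rw [← Real.sin_pi_sub]
      exact (mul_le_mul_of_nonneg_left (show a ≤ Real.pi - y by linarith) (by positivity)).trans
        (Real.mul_le_sin (by linarith) (by linarith))
  have := key |x| h1 h2
  rcases abs_cases x with h | h
  · rw [h.1] at this
    exact this.trans (le_abs_self _)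
  · rw [h.1, Real.sin_neg] at this
    exact this.trans (neg_le_abs _)

theorem stripSlow_lineInt {δ δ' : ℝ} {F : ℂ → ℂ} (hF : StripDecay δ F) (ω : ℂ) {φ c : ℝ}
    (hφ : |φ| < δ) (hc : 0 < c)
    (h : ∀ x : ℝ, |x| < δ' → c ≤ |Real.sin ((φ - (x + ω.im)) / 2)|) :
    StripSlow δ' fun ζ => lineInt F φ (ζ + ω) := by
  have hS : IsOpen {ζ : ℂ | ζ - ω ∈ strip δ'} := (isOpen_strip δ').preimage (by fun_prop)
  have haux := stripDecay_lineInt_aux hF hφ hS hc fun ζ hζ => by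
    have := h (ζ - ω).im hζ
    rwa [Complex.sub_im, sub_add_cancel] at this
  refine ⟨haux.1.comp (by fun_prop) fun ζ hζ => ?_, fun η h0 h1 => ?_⟩
  · simpa using hζ
  · obtain ⟨C, hC, hb⟩ := haux.2 η h0 h1
    refine ⟨C * Real.exp (η * ω.re), by positivity, fun z hz => ?_⟩
    have := hb (z + ω) (by simpa using hz)
    refine this.trans ?_
    rw [Complex.add_re, mul_add, Real.exp_add, mul_comm (Real.exp (η * z.re)), ← mul_assoc]
    gcongr
    linarith

/-- `ω` locates the outer direction relative to the contour. If the rays coincide, the pole may lie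
on either side of the line of integration, and all lines on one side can be moved to a fixed line at
height ±δ/2, giving two holomorphic branches. If they differ, no pole is near and both branches are
the integral at height 0. The width `δ'` does not depend on `F`. -/
theorem exists_sides {δ : ℝ} (h0 : 0 < δ) (h1 : δ ≤ 1) (ω : ℂ)
    (hω : |ω.im| ≤ Real.pi) : ∃ δ' : ℝ, 0 < δ' ∧ δ' ≤ δ ∧
    ∀ F : ℂ → ℂ, StripDecay δ F → ∃ Bm Bp : ℂ → ℂ, StripSlow δ' Bm ∧ StripSlow δ' Bp ∧
      ∀ ζ ∈ strip δ', ∀ φ : ℝ, |φ| < δ' →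
        (φ < ζ.im → Real.sin ((φ - (ζ + ω).im) / 2) ≠ 0 ∧ lineInt F φ (ζ + ω) = Bm ζ) ∧
        (ζ.im < φ → Real.sin ((φ - (ζ + ω).im) / 2) ≠ 0 ∧ lineInt F φ (ζ + ω) = Bp ζ) := by
  have hpi := Real.pi_gt_three
  by_cases hω0 : ω.im = 0
  -- Points of height below δ/4 keep the distance δ/4 from the lines at ±δ/2; the sine takes half of
  -- it, hence δ/8.
  · refine ⟨δ / 4, by linarith, by linarith, fun F hF =>
      ⟨fun ζ => lineInt F (-(δ / 2)) (ζ + ω), fun ζ => lineInt F (δ / 2) (ζ + ω),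
        stripSlow_lineInt (c := 2 / Real.pi * (δ / 8)) hF ω ?_ (by positivity) fun x hx => ?_,
        stripSlow_lineInt (c := 2 / Real.pi * (δ / 8)) hF ω ?_ (by positivity) fun x hx => ?_,
        fun ζ hζ φ hφ => ?_⟩⟩
    · rw [abs_neg, abs_of_pos (by linarith)]; linarith
    · rw [abs_lt] at hx
      rw [hω0]
      apply mul_le_abs_sin (by linarith)
      · rw [abs_of_neg (by linarith)]; linarith
      · rw [abs_of_neg (by linarith)]; linarith
    · rw [abs_of_pos (by linarith)]; linarith
    · rw [abs_lt] at hx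
      rw [hω0]
      apply mul_le_abs_sin (by linarith)
      · rw [abs_of_pos (by linarith)]; linarith
      · rw [abs_of_pos (by linarith)]; linarith
    · have hζ : |ζ.im| < δ / 4 := hζ
      rw [abs_lt] at hζ hφ
      have him : (ζ + ω).im = ζ.im := by rw [Complex.add_im, hω0, add_zero]
      have hneg : ∀ ψ : ℝ, -δ < ψ → ψ < ζ.im → Real.sin ((ψ - (ζ + ω).im) / 2) ≠ 0 := by
        intro ψ h3 h4
        rw [him]
        exact (Real.sin_neg_of_neg_of_neg_pi_lt (by linarith) (by linarith)).ne
      have hpos : ∀ ψ : ℝ, ψ < δ → ζ.im < ψ → Real.sin ((ψ - (ζ + ω).im) / 2) ≠ 0 := by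
        intro ψ h3 h4
        rw [him]
        exact (Real.sin_pos_of_pos_of_lt_pi (by linarith) (by linarith)).ne'
      refine ⟨fun h => ⟨hneg φ (by linarith) h, ?_⟩, fun h => ⟨hpos φ (by linarith) h, ?_⟩⟩
      · refine (lineInt_eq hF (by linarith) (by linarith) (by linarith) fun ψ hψ => ?_).symm
        exact hneg ψ (by linarith [hψ.1]) (by linarith [hψ.2])
      · refine lineInt_eq hF (by linarith) (by linarith) (by linarith) fun ψ hψ => ?_
        exact hpos ψ (by linarith [hψ.2]) (by linarith [hψ.1])
  · have hω1 : 0 < |ω.im| := abs_pos.2 hω0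
    -- With both heights below |Im ω|/4 the half-angle lies between |Im ω|/4 and 3|Im ω|/4, and the
    -- latter is at most π − |Im ω|/4.
    have hle : min (δ / 2) (|ω.im| / 4) ≤ |ω.im| / 4 := min_le_right _ _
    have hle' : min (δ / 2) (|ω.im| / 4) ≤ δ / 2 := min_le_left _ _
    have hsin : ∀ φ x : ℝ, |φ| < min (δ / 2) (|ω.im| / 4) → |x| < min (δ / 2) (|ω.im| / 4) →
        2 / Real.pi * (|ω.im| / 4) ≤ |Real.sin ((φ - (x + ω.im)) / 2)| := by
      intro φ x hφ hx
      rw [abs_lt] at hφ hx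
      apply mul_le_abs_sin (by linarith)
      · rcases abs_cases ω.im with ⟨h, _⟩ | ⟨h, _⟩
        · rw [h, abs_of_neg (by linarith)]; linarith
        · rw [h, abs_of_pos (by linarith)]; linarith
      · rw [abs_le]
        have := abs_le.1 hω
        have h3 := le_abs_self ω.im
        have h4 := neg_le_abs ω.im
        constructor <;> linarith
    have hc : 0 < 2 / Real.pi * (|ω.im| / 4) := by positivity
    have hm : 0 < min (δ / 2) (|ω.im| / 4) := lt_min (by linarith) (by linarith)
    have h00 : |(0 : ℝ)| < min (δ / 2) (|ω.im| / 4) := by rwa [abs_zero]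
    refine ⟨min (δ / 2) (|ω.im| / 4), hm, by linarith,
      fun F hF => ⟨fun ζ => lineInt F 0 (ζ + ω), fun ζ => lineInt F 0 (ζ + ω), ?_, ?_, ?_⟩⟩
    · exact stripSlow_lineInt hF ω (by rwa [abs_zero]) hc fun x hx => hsin 0 x h00 hx
    · exact stripSlow_lineInt hF ω (by rwa [abs_zero]) hc fun x hx => hsin 0 x h00 hx
    · intro ζ hζ φ hφ
      have hn : ∀ ψ : ℝ, |ψ| < min (δ / 2) (|ω.im| / 4) →
          Real.sin ((ψ - (ζ + ω).im) / 2) ≠ 0 := fun ψ hψ =>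
        abs_pos.1 (hc.trans_le (by rw [Complex.add_im]; exact hsin ψ ζ.im hψ hζ))
      have heq : lineInt F φ (ζ + ω) = lineInt F 0 (ζ + ω) := by
        have hφ' := abs_lt.1 hφ
        rcases le_total φ 0 with h | h
        · exact lineInt_eq hF h (by linarith) (by linarith) fun ψ hψ =>
            hn ψ (abs_lt.2 ⟨by linarith [hψ.1], by linarith [hψ.2]⟩)
        · exact (lineInt_eq hF h (by linarith) (by linarith) fun ψ hψ =>
            hn ψ (abs_lt.2 ⟨by linarith [hψ.1], by linarith [hψ.2]⟩)).symm
      exact ⟨fun _ => ⟨hn φ hφ, heq⟩, fun _ => ⟨hn φ hφ, heq⟩⟩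

/-- The family `f ε` has, near the direction `e`, a finite expansion into holomorphic functions with
coefficients depending on the angle measured in units of `ε`. -/
def Expands (f : ℝ → ℂ → ℂ) (e : ℂ) : Prop :=
  ∃ δ : ℝ, 0 < δ ∧ δ ≤ 1 ∧ ∃ (ι : Type) (_ : Fintype ι) (A : ι → ℂ → ℂ) (p : ι → ℝ → ℂ),
    (∀ k, StripSlow δ (A k)) ∧ (∀ k, Continuous (p k)) ∧
    ∀ ε : ℝ, 0 < ε → ε < δ → ∀ ζ : ℂ, |ζ.im| < ε →
      f ε (e * Complex.exp ζ) = ∑ k, A k ζ * p k (ζ.im / ε)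

/-- At ζ = 0 the ratio Im ζ/ε is 0 whatever ε is, so the value is exactly constant for ε < δ. -/
theorem Expands.eventually_const {f : ℝ → ℂ → ℂ} {e : ℂ} (h : Expands f e) :
    ∃ c : ℂ, ∀ᶠ ε in 𝓝[>] (0 : ℝ), f ε e = c := by
  obtain ⟨δ, h0, _, ι, _, A, p, -, -, hE⟩ := h
  refine ⟨∑ k, A k 0 * p k 0, ?_⟩
  filter_upwards [Ioo_mem_nhdsGT h0] with ε hε
  have := hE ε hε.1 hε.2 0 (by simpa using hε.1)
  simpa using this

theorem expands_const (c e : ℂ) : Expands (fun _ _ => c) e := by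
  refine ⟨1, one_pos, le_rfl, Unit, inferInstance, fun _ _ => c, fun _ _ => 1, fun _ => ⟨differentiableOn_const c,
    fun η _ _ => ⟨‖c‖, norm_nonneg c, fun z _ => ?_⟩⟩, fun _ => continuous_const, ?_⟩
  · exact le_mul_of_one_le_right (norm_nonneg c) (by linarith [Real.exp_pos (η * z.re)])
  · intro ε _ _ ζ _
    simp

theorem sK_mul_exp {d : ℂ} (hd : d ≠ 0) (ζ : ℂ) (p : ℝ × ℝ) :
    sK (d * Complex.exp ζ) (sPt d p) = expK (p.2 + p.1 * Complex.I - ζ) := by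
  have := Complex.exp_ne_zero ζ
  have e : d * Complex.exp (p.2 + p.1 * Complex.I) - d * Complex.exp ζ =
      (d * Complex.exp ζ) * (Complex.exp (p.2 + p.1 * Complex.I) / Complex.exp ζ - 1) := by
    field_simp
  rw [expK, Complex.exp_sub, sK, sPt, e, ← div_div, div_self (mul_ne_zero hd this), one_div]

/-- The integral of a function which is constant on both sides of a point. -/
theorem integral_two_sides {ι : Type} [Fintype ι] {ε x : ℝ} (hx : |x| < ε)
    {q : ι → ℝ → ℂ} (hq : ∀ k, Continuous (q k)) {Bm Bp : ι → ℂ} {f : ℝ → ℂ}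
    (h : ∀ φ ∈ Set.Ioo (-ε) ε, (φ < x → f φ = ∑ k, q k (φ / ε) * Bm k) ∧
      (x < φ → f φ = ∑ k, q k (φ / ε) * Bp k)) :
    (1 / (2 * ε : ℂ)) * ∫ φ in Set.Ioo (-ε) ε, f φ =
      ∑ k, (Bm k * ((1 / 2) * ∫ y in (-1)..(x / ε), q k y) +
        Bp k * ((1 / 2) * ∫ y in (x / ε)..1, q k y)) := by
  have hε : 0 < ε := (abs_nonneg x).trans_lt hx
  rw [abs_lt] at hx
  have hc : ∀ B : ι → ℂ, Continuous fun φ => ∑ k, q k (φ / ε) * B k := fun B => by fun_prop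
  have hm : Set.EqOn f (fun φ => ∑ k, q k (φ / ε) * Bm k) (Set.Ioo (-ε) x) := fun φ hφ =>
    (h φ ⟨hφ.1, hφ.2.trans hx.2⟩).1 hφ.2
  have hp : Set.EqOn f (fun φ => ∑ k, q k (φ / ε) * Bp k) (Set.Ioo x ε) := fun φ hφ =>
    (h φ ⟨hx.1.trans hφ.1, hφ.2⟩).2 hφ.1
  have i1 : IntervalIntegrable f volume (-ε) x :=
    ((hc Bm).intervalIntegrable _ _).congr_uIoo
      (by rw [Set.uIoo_of_le hx.1.le]; exact hm.symm)
  have i2 : IntervalIntegrable f volume x ε :=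
    ((hc Bp).intervalIntegrable _ _).congr_uIoo
      (by rw [Set.uIoo_of_le hx.2.le]; exact hp.symm)
  have key : ∀ (B : ι → ℂ) (a b : ℝ), ∫ φ in a..b, ∑ k, q k (φ / ε) * B k =
      ε * ∑ k, B k * ∫ y in (a / ε)..(b / ε), q k y := by
    intro B a b
    rw [intervalIntegral.integral_finsetSum fun k _ =>
      Continuous.intervalIntegrable (by have := hq k; fun_prop) _ _, Finset.mul_sum]
    refine Finset.sum_congr rfl fun k _ => ?_
    rw [intervalIntegral.integral_mul_const, intervalIntegral.integral_comp_div _ hε.ne',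
      Complex.real_smul]
    ring
  rw [← integral_Ioc_eq_integral_Ioo, ← intervalIntegral.integral_of_le (by linarith),
    ← intervalIntegral.integral_add_adjacent_intervals i1 i2,
    intervalIntegral.integral_congr_Ioo_of_le hx.1.le hm,
    intervalIntegral.integral_congr_Ioo_of_le hx.2.le hp, key, key, ← mul_add, neg_div,
    div_self hε.ne', ← Finset.sum_add_distrib, ← mul_assoc, Finset.mul_sum]
  refine Finset.sum_congr rfl fun k _ => ?_
  have : (ε : ℂ) ≠ 0 := Complex.ofReal_ne_zero.2 hε.ne'
  field_simp

variable {r : ℕ} {D : RefinedBPS r}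

/-- The integral operator preserves expansions. -/
theorem expands_secOp {d e : ℂ} (hd : d ≠ 0) (he : e ≠ 0) {f : ℝ → ℂ → ℂ} {E : ℂ → ℂ}
    (hE : SectorBound d E)
    (hEd : ∀ p, E (sPt d p) = Complex.exp (-(2 * Real.pi) * Complex.exp (-(p.2 + p.1 * Complex.I))))
    (hf : ∀ ε, 0 < ε → ε < 1 → SlowGrowth (f ε)) (h : Expands f d) :
    Expands (fun ε => secOp ε d fun s => E s * f ε s) e := by
  obtain ⟨δ, h0, h1, ι, _, A, p, hA, hp, hexp⟩ := h
  set ω := Complex.log (e / d) with hω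
  have hωexp : e = d * Complex.exp ω := by
    rw [hω, Complex.exp_log (div_ne_zero he hd), mul_div_cancel₀ _ hd]
  obtain ⟨δ', h0', h1', hsides⟩ := exists_sides h0 h1 ω
    (by rw [hω, Complex.log_im]; exact Complex.abs_arg_le_pi _)
  set F : ι → ℂ → ℂ := fun k z => Complex.exp (-(2 * Real.pi) * Complex.exp (-z)) * A k z with hFdef
  have hF : ∀ k, StripDecay δ (F k) := fun k => (hA k).mul_exp h1
  choose Bm Bp hBm hBp hB using fun k => hsides (F k) (hF k)
  -- The new coefficients average the old ones over the contours rotated less, respectively more,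
  -- than the outer point at angle xε; 1/2 normalises the length of (−1,1).
  refine ⟨δ', h0', h1'.trans h1, ι ⊕ ι, inferInstance, Sum.elim Bm Bp,
    Sum.elim (fun k x => (1 / 2) * ∫ y in (-1)..x, p k y) (fun k x => (1 / 2) * ∫ y in x..1, p k y),
    ?_, ?_, fun ε hε hεδ ζ hζ => ?_⟩
  · rintro (k | k)
    exacts [hBm k, hBp k]
  · rintro (k | k)
    · exact continuous_const.mul
        (intervalIntegral.continuous_primitive (fun a b => (hp k).intervalIntegrable a b) _)
    · have := intervalIntegral.continuous_primitive
        (fun a b => (hp k).intervalIntegrable (μ := volume) a b) 1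
      have e : (fun x => (1 / 2 : ℂ) * ∫ y in x..1, p k y) =
          fun x => (1 / 2 : ℂ) * -∫ y in (1 : ℝ)..x, p k y :=
        funext fun x => by rw [intervalIntegral.integral_symm]
      simp only [Sum.elim_inr]
      rw [e]
      exact continuous_const.mul this.neg
  · have hε1 : ε < 1 := by linarith
    have hint := integrable_sK_mul (ε := ε) hε1 hd (hE.mul_slowGrowth (hf ε hε hε1))
      (e * Complex.exp ζ)
    have ht : e * Complex.exp ζ = d * Complex.exp (ζ + ω) := by
      rw [hωexp, Complex.exp_add]; ring
    -- Along one rotated ray the imaginary part is φ, so the coefficients `p k (φ / ε)` are constant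
    -- there and leave the integral.
    have hinner : ∀ φ : ℝ, |φ| < ε → φ ≠ ζ.im →
        ∫ u : ℝ, sK (e * Complex.exp ζ) (sPt d (φ, u)) *
          (E (sPt d (φ, u)) * f ε (sPt d (φ, u))) =
        ∑ k, p k (φ / ε) * lineInt (F k) φ (ζ + ω) := by
      intro φ hφ hne
      have hs : ∀ k, Real.sin ((φ - (ζ + ω).im) / 2) ≠ 0 := fun k => by
        rcases lt_or_gt_of_ne hne with h | h
        · exact ((hB k ζ (hζ.trans hεδ) φ (hφ.trans hεδ)).1 h).1
        · exact ((hB k ζ (hζ.trans hεδ) φ (hφ.trans hεδ)).2 h).1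
      have e1 : (fun u : ℝ => sK (e * Complex.exp ζ) (sPt d (φ, u)) *
          (E (sPt d (φ, u)) * f ε (sPt d (φ, u)))) = fun u : ℝ => ∑ k, p k (φ / ε) *
            (expK (u + φ * Complex.I - (ζ + ω)) * F k (u + φ * Complex.I)) := by
        funext u
        rw [hEd, ht, sK_mul_exp hd]
        have := hexp ε hε (hεδ.trans_le h1') (u + φ * Complex.I) (by simpa using hφ)
        rw [sPt, this, Finset.mul_sum, Finset.mul_sum]
        refine Finset.sum_congr rfl fun k _ => ?_
        simp only [hFdef]
        have him : (u + φ * Complex.I : ℂ).im = φ := by simp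
        rw [him]
        ring
      rw [e1, integral_finsetSum _ fun k _ => (integrable_lineIntegrand (hF k)
        (hφ.trans (hεδ.trans_le h1')) (hs k)).const_mul _]
      exact Finset.sum_congr rfl fun k _ => integral_const_mul _ _
    have hx : |ζ.im| < ε := hζ
    beta_reduce
    rw [secOp, sectorMeas, integral_prod _ hint, Fintype.sum_sum_type]
    simp only [Sum.elim_inl, Sum.elim_inr]
    rw [← Finset.sum_add_distrib]
    refine integral_two_sides hx hp fun φ hφ => ⟨fun h => ?_, fun h => ?_⟩
    · rw [hinner φ (abs_lt.2 hφ) h.ne]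
      exact Finset.sum_congr rfl fun k _ => by
        rw [((hB k ζ (hζ.trans hεδ) φ ((abs_lt.2 hφ).trans hεδ)).1 h).2]
    · rw [hinner φ (abs_lt.2 hφ) h.ne']
      exact Finset.sum_congr rfl fun k _ => by
        rw [((hB k ζ (hζ.trans hεδ) φ ((abs_lt.2 hφ).trans hεδ)).2 h).2]

theorem expands_wordInt (w : List (NZCharge r)) {e : ℂ} (he : e ≠ 0) :
    Expands (fun ε => wordInt D ε w) e := by
  induction w generalizing e with
  | nil => exact expands_const 1 e
  | cons a w ih =>
    by_cases h : D.Z a.1 = 0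
    · have : (fun ε => wordInt D ε (a :: w)) = fun _ _ => 0 := by
        funext ε t
        exact opT_of_Z_eq_zero D h ε _ t
      rw [this]
      exact expands_const 0 e
    · have hd := mul_ne_zero Complex.I_ne_zero h
      have : (fun ε => wordInt D ε (a :: w)) = fun ε =>
          secOp ε (Complex.I * D.Z a.1) fun s => ef D a.1 s * wordInt D ε w s := by
        funext ε t
        exact opT_eq_secOp D h ε _ t
      rw [this]
      exact expands_secOp hd he (sectorBound_ef D h) (ef_sPt D h)
        (fun ε h0 h1 => slowGrowth_wordInt h0 h1 w) (ih hd)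

theorem wordInt_cons_zero (ε : ℝ) (a : NZCharge r) (w : List (NZCharge r)) :
    wordInt D ε (a :: w) 0 = 0 := by
  simp [wordInt, opT, RefinedBPS.rayInt, kern]

/-- The averaged iterated integrals stabilise when the displacement goes to zero. -/
theorem eventually_wordInt (w : List (NZCharge r)) (t : ℂ) :
    ∃ c : ℂ, ∀ᶠ ε in 𝓝[>] (0 : ℝ), wordInt D ε w t = c := by
  by_cases ht : t = 0
  · subst ht
    cases w with
    | nil => exact ⟨1, Filter.Eventually.of_forall fun _ => rfl⟩
    | cons a w => exact ⟨0, Filter.Eventually.of_forall fun ε => wordInt_cons_zero ε a w⟩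
  · exact (expands_wordInt w ht).eventually_const

variable (D) in
/-- The averaged iterated integrals. -/
def limInt (w : List (NZCharge r)) (t : ℂ) : ℂ := (eventually_wordInt (D := D) w t).choose

theorem eventually_wordInt_eq (w : List (NZCharge r)) (t : ℂ) :
    ∀ᶠ ε in 𝓝[>] (0 : ℝ), wordInt D ε w t = limInt D w t :=
  (eventually_wordInt (D := D) w t).choose_spec

/-- A shuffle relation involves finitely many words, so it passes to the limit. -/
theorem isShuffleChar_limInt (t : ℂ) : IsShuffleChar fun w => limInt D w t := by
  have htend : ∀ w, Tendsto (fun ε => wordInt D ε w t) (𝓝[>] (0 : ℝ)) (𝓝 (limInt D w t)) := fun w =>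
    tendsto_nhds_of_eventually_eq (eventually_wordInt_eq w t)
  have hsh : ∀ (u v : List (NZCharge r)) (F : ℝ → List (NZCharge r) → ℂ) (G : List (NZCharge r) → ℂ),
      (∀ w, Tendsto (fun ε => F ε w) (𝓝[>] (0 : ℝ)) (𝓝 (G w))) →
      Tendsto (fun ε => shuffleSum u v (F ε)) (𝓝[>] (0 : ℝ)) (𝓝 (shuffleSum u v G)) := by
    intro u v
    induction hn : u.length + v.length using Nat.strong_induction_on generalizing u v with
    | _ n ih =>
    intro F G hFG
    match u, v with
    | [], v => simpa using hFG v
    | a :: u, [] => simpa using hFG (a :: u)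
    | a :: u, b :: v =>
      simp only [shuffleSum_cons_cons]
      exact (ih (u.length + (b :: v).length) (by simp at hn ⊢; omega) u (b :: v) rfl _ _
        fun w => hFG (a :: w)).add (ih ((a :: u).length + v.length) (by simp at hn ⊢; omega)
        (a :: u) v rfl _ _ fun w => hFG (b :: w))
  have hmem : ∀ᶠ ε in 𝓝[>] (0 : ℝ), ε ∈ Set.Ioo (0 : ℝ) 1 := Ioo_mem_nhdsGT one_pos
  refine ⟨tendsto_nhds_unique (htend []) (by simp [wordInt]), fun u v => ?_⟩
  refine tendsto_nhds_unique ((htend u).mul (htend v))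
    ((hsh u v (fun ε w => wordInt D ε w t) _ htend).congr' ?_)
  filter_upwards [hmem] with ε hε
  exact ((isShuffleChar_wordInt hε.1 hε.2 t).mul u v).symm

end Expansion

/-! ### Star product and brackets of exponentials. -/

section Exponentials

variable {r : ℕ}

/-- The linear form `θ ↦ 2πi ∑ g_a θ^a`. -/
def chargeForm (g : Charge r) : (Fin r → ℂ) →L[ℂ] ℂ :=
  ∑ a, (2 * Real.pi * Complex.I * (g a : ℂ)) • ContinuousLinearMap.proj a

theorem chargeForm_apply (g : Charge r) (θ : Fin r → ℂ) :
    chargeForm g θ = 2 * Real.pi * Complex.I * ∑ a, (g a : ℂ) * θ a := by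
  rw [chargeForm, Finset.mul_sum]
  simp [mul_assoc]

theorem chargeForm_single (g : Charge r) (a : Fin r) :
    chargeForm g (Pi.single a 1) = 2 * Real.pi * Complex.I * (g a : ℂ) := by
  rw [chargeForm_apply]
  congr 1
  rw [Finset.sum_eq_single a (fun b _ hb => by simp [hb]) (by simp)]
  simp

/-- The exponential function of a charge. -/
def expFun (g : Charge r) : Obs r := fun θ => Complex.exp (chargeForm g θ)

theorem expFun_mul (g g' : Charge r) (θ : Fin r → ℂ) :
    expFun g θ * expFun g' θ = expFun (g + g') θ := by
  rw [expFun, expFun, expFun, ← Complex.exp_add, chargeForm_apply, chargeForm_apply,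
    chargeForm_apply, ← mul_add, ← Finset.sum_add_distrib]
  congr 2
  refine Finset.sum_congr rfl fun a _ => ?_
  rw [Pi.add_apply]
  push_cast
  ring

theorem hasFDerivAt_smul_expFun (g : Charge r) (c : ℂ) (θ : Fin r → ℂ) :
    HasFDerivAt (c • expFun g) ((c * expFun g θ) • chargeForm g) θ := by
  have h := ((chargeForm g).hasFDerivAt (x := θ)).cexp.const_smul c
  rw [smul_smul] at h
  exact h

theorem iteratedFDeriv_smul_expFun (g : Charge r) (c : ℂ) (k : ℕ) :
    iteratedFDeriv ℂ k (c • expFun g) = fun θ => (c * expFun g θ) •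
      (ContinuousMultilinearMap.mkPiAlgebra ℂ (Fin k) ℂ).compContinuousLinearMap
        fun _ => chargeForm g := by
  induction k with
  | zero =>
    funext θ
    ext v
    simp
  | succ k ih =>
    funext θ
    ext v
    rw [iteratedFDeriv_succ_apply_left, ih]
    have h : HasFDerivAt (fun θ => (c * expFun g θ) •
        (ContinuousMultilinearMap.mkPiAlgebra ℂ (Fin k) ℂ).compContinuousLinearMap
          fun _ => chargeForm g) (((c * expFun g θ) • chargeForm g).smulRight
        ((ContinuousMultilinearMap.mkPiAlgebra ℂ (Fin k) ℂ).compContinuousLinearMap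
          fun _ => chargeForm g)) θ :=
      (hasFDerivAt_smul_expFun g c θ).smul_const
        ((ContinuousMultilinearMap.mkPiAlgebra ℂ (Fin k) ℂ).compContinuousLinearMap
          fun _ => chargeForm g)
    rw [h.fderiv]
    simp [Fin.prod_univ_succ, Fin.tail, mul_assoc]

theorem iteratedFDeriv_smul_expFun_apply (g : Charge r) (c : ℂ) (k : ℕ) (θ : Fin r → ℂ)
    (a : Fin k → Fin r) :
    iteratedFDeriv ℂ k (c • expFun g) θ (fun i => Pi.single (a i) 1) =
      c * expFun g θ * ∏ i, (2 * Real.pi * Complex.I * (g (a i) : ℂ)) := by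
  rw [iteratedFDeriv_smul_expFun]
  simp [chargeForm_single]

variable (D : RefinedBPS r)

theorem sum_om (g g' : Charge r) :
    ∑ a, ∑ b, D.om a b * ((g a : ℂ) * (g' b : ℂ)) = ((D.pairing g g' : ℤ) : ℂ) := by
  have e : ∀ g : Charge r, g = ∑ a, g a • (Pi.single a 1 : Charge r) := by
    intro g
    funext b
    rw [Finset.sum_apply, Finset.sum_eq_single b (fun a _ ha => by simp [Ne.symm ha]) (by simp)]
    simp
  conv_rhs => rw [e g, e g']
  simp only [map_sum, LinearMap.sum_apply, map_smul, LinearMap.smul_apply, smul_eq_mul]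
  push_cast
  rw [Finset.sum_comm]
  simp only [Finset.mul_sum]
  refine Finset.sum_congr rfl fun b _ => Finset.sum_congr rfl fun a _ => ?_
  rw [RefinedBPS.om]
  ring

/-- `y^n = exp (2πiαn)`. -/
def yPow (α : ℂ) (n : ℤ) : ℂ := Complex.exp (2 * Real.pi * Complex.I * α * n)

theorem yPow_add (α : ℂ) (m n : ℤ) : yPow α (m + n) = yPow α m * yPow α n := by
  rw [yPow, yPow, yPow, ← Complex.exp_add]
  congr 1
  push_cast
  ring

theorem yPow_zero (α : ℂ) : yPow α 0 = 1 := by simp [yPow]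

theorem yGap_eq (α : ℂ) : yGap α = yPow α 1 - yPow α (-1) := by
  rw [yGap, yy, yPow, yPow]
  simp only [Units.val_mk0, Units.val_inv_eq_inv_val]
  rw [← Complex.exp_neg, mul_right_comm]
  congr 2 <;> · push_cast; ring

/-- Each derivative of an exponential gives 2πi times a component of the charge, so the k-th term is
(2πiα⟨g,g'⟩)^k/k! times the product. -/
theorem moyal_expFun (α : ℂ) (g g' : Charge r) (a b : ℂ) :
    D.moyal α (a • expFun g) (b • expFun g') =
      (a * b * yPow α (D.pairing g g')) • expFun (g + g') := by
  funext θ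
  rw [RefinedBPS.moyal]
  have hexp : ∀ x : ℂ, Complex.exp x = ∑' k : ℕ, x ^ k / (k.factorial : ℂ) := fun x => by
    rw [Complex.exp_eq_exp_ℂ, NormedSpace.exp_eq_tsum_div]
  have hpi : (2 * Real.pi * Complex.I : ℂ) ≠ 0 := Complex.two_pi_I_ne_zero
  simp only [iteratedFDeriv_smul_expFun_apply]
  rw [Pi.smul_apply, smul_eq_mul, ← expFun_mul, yPow, hexp]
  generalize (2 * Real.pi * Complex.I : ℂ) = P at hpi ⊢
  have key : ∀ k : ℕ, (α / P) ^ k / (k.factorial : ℂ) *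
      (∑ x : Fin k → Fin r, ∑ z : Fin k → Fin r, (∏ i, D.om (x i) (z i)) *
      (a * expFun g θ * (∏ i, P * (g (x i) : ℂ)) * (b * expFun g' θ * ∏ i, P * (g' (z i) : ℂ)))) =
      (a * expFun g θ * (b * expFun g' θ)) *
        ((P * α * (D.pairing g g' : ℤ)) ^ k / (k.factorial : ℂ)) := by
    intro k
    -- The k index pairs are summed independently, which makes the sum over tuples a k-th power.
    have h2 : (P ^ 2 * ∑ x, ∑ z, D.om x z * ((g x : ℂ) * (g' z : ℂ))) ^ k =
        ∏ _i : Fin k, ∑ x, ∑ z, D.om x z * ((P * (g x : ℂ)) * (P * (g' z : ℂ))) := by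
      rw [Finset.prod_const, Finset.card_univ, Fintype.card_fin, Finset.mul_sum]
      congr 1
      refine Finset.sum_congr rfl fun x _ => ?_
      rw [Finset.mul_sum]
      refine Finset.sum_congr rfl fun z _ => ?_
      ring
    have h1 : ∑ x : Fin k → Fin r, ∑ z : Fin k → Fin r, (∏ i, D.om (x i) (z i)) *
        (a * expFun g θ * (∏ i, P * (g (x i) : ℂ)) * (b * expFun g' θ * ∏ i, P * (g' (z i) : ℂ))) =
        (a * expFun g θ * (b * expFun g' θ)) *
          (P ^ 2 * ∑ x, ∑ z, D.om x z * ((g x : ℂ) * (g' z : ℂ))) ^ k := by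
      rw [h2, Fintype.prod_sum, Finset.mul_sum]
      refine Finset.sum_congr rfl fun x _ => ?_
      rw [Fintype.prod_sum, Finset.mul_sum]
      refine Finset.sum_congr rfl fun z _ => ?_
      simp only [Finset.prod_mul_distrib]
      ring
    rw [h1, sum_om, div_pow, mul_pow, mul_pow, mul_pow, pow_right_comm, sq (P ^ k)]
    field_simp
  simp only [key]
  rw [tsum_mul_left]
  ring

/-- The structure constants of the star bracket. -/
def kap (α : ℂ) (n : ℤ) : ℂ := (yGap α)⁻¹ * (yPow α n - yPow α (-n))

theorem starBr_expFun (α : ℂ) (g g' : Charge r) (a b : ℂ) :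
    D.starBr α (a • expFun g) (b • expFun g') =
      (a * b * kap α (D.pairing g g')) • expFun (g + g') := by
  rw [RefinedBPS.starBr, moyal_expFun, moyal_expFun, D.pairing_skew g' g, add_comm g' g, kap,
    ← sub_smul, smul_smul]
  congr 1
  ring

theorem poissonBr_expFun (g g' : Charge r) (a b : ℂ) :
    D.poissonBr (a • expFun g) (b • expFun g') =
      (a * b * ((D.pairing g g' : ℤ) : ℂ)) • expFun (g + g') := by
  funext θ
  rw [RefinedBPS.poissonBr, (hasFDerivAt_smul_expFun g a θ).fderiv,
    (hasFDerivAt_smul_expFun g' b θ).fderiv, Pi.smul_apply, ← expFun_mul, ← sum_om]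
  simp only [smul_apply, chargeForm_single, smul_eq_mul, Finset.mul_sum,
    Finset.sum_mul]
  refine Finset.sum_congr rfl fun x _ => ?_
  refine Finset.sum_congr rfl fun z _ => ?_
  have hpi : (2 * Real.pi * Complex.I : ℂ) ≠ 0 := Complex.two_pi_I_ne_zero
  field_simp

theorem Xsf_eq (γ : Charge r) (t : ℂ) : D.Xsf γ t = ef D γ t • expFun γ := by
  funext θ
  rw [RefinedBPS.Xsf, Pi.smul_apply, smul_eq_mul, ef, expFun, ← Complex.exp_add, chargeForm_apply]
  congr 1
  ring

end Exponentials

/-! ### The quantum torus as an operator algebra, and transfer of identities from it. -/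

section Transfer

variable {r : ℕ} (D : RefinedBPS r)

/-- The total charge of a multi-index. -/
def wt : (NZCharge r →₀ ℕ) →+ Charge r :=
  Finsupp.liftAddHom fun a : NZCharge r => multiplesHom (Charge r) a.1

theorem wt_single (a : NZCharge r) : wt (Finsupp.single a 1) = a.1 := by simp [wt]

/-- The formal series with coefficients `c m`, in the sector of charge `δ`. -/
def toF (δ : Charge r) (c : (NZCharge r →₀ ℕ) → ℂ) : Formal r := fun m => c m • expFun (δ + wt m)

/-- `op` acts on exponentials with structure constants `χ ⟨γ, γ'⟩`. -/
def HasStructure (χ : ℤ → ℂ) (op : Obs r → Obs r → Obs r) : Prop :=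
  ∀ (g g' : Charge r) (a b : ℂ),
    op (a • expFun g) (b • expFun g') = (a * b * χ (D.pairing g g')) • expFun (g + g')

/-- The product of coefficient functions with structure constants `χ`. -/
def brConv (χ : ℤ → ℂ) (δ : Charge r) (c : (NZCharge r →₀ ℕ) → ℂ) (δ' : Charge r)
    (c' : (NZCharge r →₀ ℕ) → ℂ) : (NZCharge r →₀ ℕ) → ℂ := fun m =>
  ∑ x ∈ Finset.HasAntidiagonal.antidiagonal m,
    c x.1 * c' x.2 * χ (D.pairing (δ + wt x.1) (δ' + wt x.2))

variable {D}

theorem lift₂_toF {χ : ℤ → ℂ} {op : Obs r → Obs r → Obs r} (h : HasStructure D χ op)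
    (δ δ' : Charge r) (c c' : (NZCharge r →₀ ℕ) → ℂ) :
    lift₂ op (toF δ c) (toF δ' c') = toF (δ + δ') (brConv D χ δ c δ' c') := by
  funext m
  rw [lift₂, toF, brConv, Finset.sum_smul]
  refine Finset.sum_congr rfl fun x hx => ?_
  rw [Finset.HasAntidiagonal.mem_antidiagonal] at hx
  rw [toF, toF, h, ← hx, map_add wt, add_add_add_comm]

theorem brConv_swap (χ : ℤ → ℂ) (δ : Charge r) (c : (NZCharge r →₀ ℕ) → ℂ) (δ' : Charge r)
    (c' : (NZCharge r →₀ ℕ) → ℂ) :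
    brConv D χ δ c δ' c' = brConv D (fun n => χ (-n)) δ' c' δ c := by
  funext m
  have hmem : ∀ x ∈ Finset.HasAntidiagonal.antidiagonal m,
      x.swap ∈ Finset.HasAntidiagonal.antidiagonal m := fun x hx => by
    rw [Finset.HasAntidiagonal.mem_antidiagonal] at hx ⊢
    rw [← hx, Prod.fst_swap, Prod.snd_swap, add_comm]
  refine Finset.sum_nbij' Prod.swap Prod.swap hmem hmem (fun _ _ => rfl) (fun _ _ => rfl) fun x _ => ?_
  simp only [Prod.fst_swap, Prod.snd_swap]
  rw [D.pairing_skew, mul_comm (c x.1)]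

/-- The ring in which the quantum torus algebra is represented. -/
abbrev OpRing (r : ℕ) := Module.End ℂ (ℤ × Charge r → ℂ)

variable (D) in
/-- The generators of the quantum torus algebra, shifted in degree. -/
def lop (α : ℂ) (k : ℤ) (γ : Charge r) : OpRing r where
  toFun f := fun x => yPow α (D.pairing γ x.2) * f (x.1 - k, x.2 - γ)
  map_add' f g := by funext x; simp [mul_add]
  map_smul' c f := by funext x; simp [mul_left_comm]

theorem lop_apply (α : ℂ) (k : ℤ) (γ : Charge r) (f : ℤ × Charge r → ℂ) (x : ℤ × Charge r) :
    lop D α k γ f x = yPow α (D.pairing γ x.2) * f (x.1 - k, x.2 - γ) := rfl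

/-- The shift by γ inside the second phase gives y^{−⟨γ',γ⟩} = y^{⟨γ,γ'⟩}, the cocycle of the Moyal
product. The exponentials are thus modelled in an associative ring, where general algebra applies;
the integer coordinate records the degree and makes the Euler derivation the inner derivation by
`gradeOp`. -/
theorem lop_mul (α : ℂ) (k k' : ℤ) (γ γ' : Charge r) :
    lop D α k γ * lop D α k' γ' = yPow α (D.pairing γ γ') • lop D α (k + k') (γ + γ') := by
  refine LinearMap.ext fun f => funext fun x => ?_
  rw [Module.End.mul_apply, LinearMap.smul_apply, Pi.smul_apply, smul_eq_mul, lop_apply, lop_apply,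
    lop_apply, ← mul_assoc, ← mul_assoc, ← yPow_add, ← yPow_add, sub_sub, sub_sub]
  congr 2
  rw [map_sub, map_add, LinearMap.add_apply, D.pairing_skew γ' γ]
  ring

theorem lop_zero (α : ℂ) : lop D α 0 0 = 1 := by
  refine LinearMap.ext fun f => funext fun x => ?_
  rw [lop_apply]
  simp [yPow_zero]

theorem smul_lop_injective {α : ℂ} {k : ℤ} {γ : Charge r} {a b : ℂ}
    (h : a • lop D α k γ = b • lop D α k γ) : a = b := by
  have := congrFun (LinearMap.congr_fun h fun _ => 1) (0, 0)
  simpa [lop_apply, yPow_zero] using this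

/-- The degree operator. -/
def gradeOp : OpRing r where
  toFun f := fun x => (x.1 : ℂ) * f x
  map_add' f g := by funext x; simp [mul_add]
  map_smul' c f := by funext x; simp [mul_left_comm]

theorem gradeOp_comm (α : ℂ) (k : ℤ) (γ : Charge r) :
    gradeOp * lop D α k γ - lop D α k γ * gradeOp = (k : ℂ) • lop D α k γ := by
  refine LinearMap.ext fun f => funext fun x => ?_
  simp only [LinearMap.sub_apply, Pi.sub_apply, Module.End.mul_apply, LinearMap.smul_apply,
    Pi.smul_apply, smul_eq_mul, lop_apply, gradeOp, LinearMap.coe_mk, AddHom.coe_mk]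
  push_cast
  ring

theorem opRing_sub_smul (a b : ℂ) (y : OpRing r) : a • y - b • y = (a - b) • y :=
  (sub_smul a b y).symm

theorem lop_comm (α : ℂ) (k k' : ℤ) (γ γ' : Charge r) :
    lop D α k γ * lop D α k' γ' - lop D α k' γ' * lop D α k γ =
      (yPow α (D.pairing γ γ') - yPow α (-D.pairing γ γ')) • lop D α (k + k') (γ + γ') := by
  rw [lop_mul, lop_mul, add_comm k' k, add_comm γ' γ, opRing_sub_smul, D.pairing_skew γ' γ]

variable (D) in
/-- The series of operators with coefficients `c m`, in the sector of charge `δ`. -/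
def toT (α : ℂ) (δ : Charge r) (c : (NZCharge r →₀ ℕ) → ℂ) : MvPowerSeries (NZCharge r) (OpRing r) :=
  fun m => c m • lop D α m.degree (δ + wt m)

theorem toT_mul (α : ℂ) (δ δ' : Charge r) (c c' : (NZCharge r →₀ ℕ) → ℂ) :
    toT D α δ c * toT D α δ' c' = toT D α (δ + δ') (brConv D (yPow α) δ c δ' c') := by
  funext m
  rw [mvps_mul_apply, toT, brConv, Finset.sum_smul]
  refine Finset.sum_congr rfl fun x hx => ?_
  rw [Finset.HasAntidiagonal.mem_antidiagonal] at hx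
  rw [toT, toT, smul_mul_smul_comm, lop_mul, smul_smul, ← hx, map_add wt,
    map_add Finsupp.degree, add_add_add_comm δ, Nat.cast_add]

variable (D) in
/-- A formal series of exponentials and a series of operators have the same coefficients. -/
def Rel (α : ℂ) (δ : Charge r) (A : Formal r) (T : MvPowerSeries (NZCharge r) (OpRing r)) : Prop :=
  ∃ c, A = toF δ c ∧ T = toT D α δ c

theorem hasStructure_moyal (α : ℂ) : HasStructure D (yPow α) (D.moyal α) := fun g g' a b =>
  moyal_expFun D α g g' a b

theorem hasStructure_starBr (α : ℂ) : HasStructure D (kap α) (D.starBr α) := fun g g' a b =>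
  starBr_expFun D α g g' a b

theorem hasStructure_poissonBr : HasStructure D (fun n => (n : ℂ)) D.poissonBr := fun g g' a b =>
  poissonBr_expFun D g g' a b

variable {α : ℂ} {δ δ' : Charge r} {A B : Formal r} {T U : MvPowerSeries (NZCharge r) (OpRing r)}

/-- An operator determines its coefficient, so equality of operator series descends to the series of
functions. -/
theorem Rel.ext (h : Rel D α δ A T) (h' : Rel D α δ B T) : A = B := by
  obtain ⟨c, rfl, rfl⟩ := h
  obtain ⟨c', rfl, hc⟩ := h'
  have : c = c' := funext fun m => smul_lop_injective (congrFun hc m)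
  rw [this]

theorem Rel.mul (h : Rel D α δ A T) (h' : Rel D α δ' B U) :
    Rel D α (δ + δ') (D.starMul α A B) (T * U) := by
  obtain ⟨c, rfl, rfl⟩ := h
  obtain ⟨c', rfl, rfl⟩ := h'
  exact ⟨_, lift₂_toF (hasStructure_moyal α) δ δ' c c', toT_mul α δ δ' c c'⟩

theorem Rel.smul (h : Rel D α δ A T) (k : ℂ) : Rel D α δ (k • A) (k • T) := by
  obtain ⟨c, rfl, rfl⟩ := h
  refine ⟨fun m => k * c m, funext fun m => ?_, funext fun m => ?_⟩
  · exact smul_smul k (c m) _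
  · exact smul_smul k (c m) _

theorem Rel.add (h : Rel D α δ A T) (h' : Rel D α δ B U) : Rel D α δ (A + B) (T + U) := by
  obtain ⟨c, rfl, rfl⟩ := h
  obtain ⟨c', rfl, rfl⟩ := h'
  refine ⟨fun m => c m + c' m, funext fun m => ?_, funext fun m => ?_⟩
  · exact (add_smul (c m) (c' m) _).symm
  · exact (add_smul (c m) (c' m) _).symm

theorem Rel.sum {A : ℕ → Formal r} {T : ℕ → MvPowerSeries (NZCharge r) (OpRing r)}
    (h : ∀ n, Rel D α δ (A n) (T n)) :
    Rel D α δ (formalSum A) (fun m => ∑ n ∈ Finset.range (m.degree + 1), T n m) := by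
  choose c hA hT using h
  refine ⟨fun m => ∑ n ∈ Finset.range (m.degree + 1), c n m, funext fun m => ?_, funext fun m => ?_⟩
  · simp only [formalSum, toF, Finset.sum_smul, hA]
  · simp only [toT, Finset.sum_smul, hT]

theorem rel_C (a : ℂ) (γ : Charge r) : Rel D α γ (MvPowerSeries.C (a • expFun γ))
    (MvPowerSeries.C (a • lop D α 0 γ)) := by
  refine ⟨fun m => if m = 0 then a else 0, funext fun m => ?_, funext fun m => ?_⟩
  · refine (MvPowerSeries.coeff_C m _).trans ?_
    rw [toF]
    split_ifs with h
    · simp [h]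
    · simp
  · refine (MvPowerSeries.coeff_C m _).trans ?_
    rw [toT]
    split_ifs with h
    · simp [h]
    · simp

theorem expFun_zero : expFun (0 : Charge r) = 1 := by
  funext θ
  simp [expFun, chargeForm_apply]

theorem rel_one : Rel D α 0 1 1 := by
  have := rel_C (D := D) (α := α) 1 0
  rwa [one_smul, one_smul, lop_zero, expFun_zero, map_one, map_one] at this

theorem Rel.pow (h : Rel D α 0 A T) (n : ℕ) : Rel D α 0 (opPow (D.starMul α) A n) (T ^ n) := by
  induction n with
  | zero => exact rel_one
  | succ n ih =>
    rw [pow_succ']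
    have := h.mul ih
    rwa [add_zero] at this

theorem Rel.log (h : Rel D α 0 A T) :
    Rel D α 0 (logOneAdd (D.starMul α) A) (psEval T (PowerSeries.log ℂ)) := by
  have := Rel.sum (D := D) (α := α) (δ := 0)
    (A := fun n => if n = 0 then 0 else ((-1 : ℂ) ^ (n + 1) / (n : ℂ)) • opPow (D.starMul α) A n)
    (T := fun n => PowerSeries.coeff n (PowerSeries.log ℂ) • T ^ n) fun n => by
      have h1 := (h.pow n).smul (PowerSeries.coeff n (PowerSeries.log ℂ))
      convert h1 using 1
      rw [PowerSeries.coeff_log]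
      split_ifs <;> simp
  exact this

theorem Rel.inv (h : Rel D α 0 A T) :
    Rel D α 0 (invOneAdd (D.starMul α) A) (psEval T invSer) := by
  have := Rel.sum (D := D) (α := α) (δ := 0)
    (A := fun n => ((-1 : ℂ) ^ n) • opPow (D.starMul α) A n)
    (T := fun n => PowerSeries.coeff n invSer • T ^ n) fun n => by
      have h1 := (h.pow n).smul (PowerSeries.coeff n invSer)
      rwa [invSer, PowerSeries.coeff_mk] at h1 ⊢
  exact this

theorem Rel.starBr (h : Rel D α δ A T) (h' : Rel D α δ' B U) :
    Rel D α (δ + δ') (lift₂ (D.starBr α) A B) ((yGap α)⁻¹ • (T * U - U * T)) := by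
  obtain ⟨c, rfl, rfl⟩ := h
  obtain ⟨c', rfl, rfl⟩ := h'
  refine ⟨_, lift₂_toF (hasStructure_starBr α) δ δ' c c', ?_⟩
  rw [toT_mul, toT_mul, brConv_swap _ δ' c' δ c, add_comm δ' δ]
  funext m
  rw [mvps_smul_apply, mvps_sub_apply, toT, toT, toT, opRing_sub_smul, smul_smul]
  congr 1
  simp only [brConv, ← Finset.sum_sub_distrib, Finset.mul_sum]
  refine Finset.sum_congr rfl fun x _ => ?_
  rw [kap]
  ring

/-- The factor `yGap α` in front of `A` cancels the denominator of the star bracket and leaves the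
plain commutator. -/
theorem Rel.expNegBracket (hg : yGap α ≠ 0) (h : Rel D α 0 A T) (h' : Rel D α δ B U)
    (hT : OrderGE 1 T) :
    Rel D α δ (expNegBracket (lift₂ (D.starBr α)) (yGap α • A) B) (expNegSer T * U * expSer T) := by
  have hit : ∀ n, Rel D α δ ((lift₂ (D.starBr α) (yGap α • A))^[n] B)
      ((fun x => T * x - x * T)^[n] U) := by
    intro n
    induction n with
    | zero => exact h'
    | succ n ih =>
      rw [Function.iterate_succ_apply', Function.iterate_succ_apply']
      have := (h.smul (yGap α)).starBr ih
      rwa [zero_add, smul_mul_assoc, mul_smul_comm, ← smul_sub, smul_smul, inv_mul_cancel₀ hg,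
        one_smul] at this
  have := Rel.sum fun n => (hit n).smul ((-1 : ℂ) ^ n / (n.factorial : ℂ))
  have e : (fun m => ∑ n ∈ Finset.range (m.degree + 1), (((-1 : ℂ) ^ n / (n.factorial : ℂ)) •
      (fun x => T * x - x * T)^[n] U) m) = expNegSer T * U * expSer T :=
    funext fun m => sum_ad_eq hT U m
  rw [e] at this
  exact this

/-- Conjugation by `1 + J` is the exponential of the bracket with its logarithm. -/
theorem starMul_inv_conj (hg : yGap α ≠ 0) {J C : Formal r}
    {TJ TC : MvPowerSeries (NZCharge r) (OpRing r)} (hJ : Rel D α 0 J TJ) (hC : Rel D α δ C TC)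
    (hT : OrderGE 1 TJ) :
    D.starMul α (invOneAdd (D.starMul α) J) (D.starMul α C (1 + J)) =
      QRH.expNegBracket (lift₂ (D.starBr α)) (yGap α • logOneAdd (D.starMul α) J) C := by
  have hlog : OrderGE 1 (psEval TJ (PowerSeries.log ℂ)) := orderGE_psEval hT (by simp)
  have h1 := hJ.inv.mul (hC.mul (rel_one.add hJ))
  have h2 := hJ.log.expNegBracket hg hC hlog
  have h3 : expSer (psEval TJ (PowerSeries.log ℂ)) = 1 + TJ := psEval_exp_log hT
  have h4 : expNegSer (psEval TJ (PowerSeries.log ℂ)) = psEval TJ invSer := by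
    have e1 := expNegSer_mul_expSer hlog
    rw [h3] at e1
    have e2 := (psEval_invSer hT).2
    calc expNegSer (psEval TJ (PowerSeries.log ℂ))
        = expNegSer (psEval TJ (PowerSeries.log ℂ)) * ((1 + TJ) * psEval TJ invSer) := by
          rw [e2, mul_one]
      _ = psEval TJ invSer := by rw [← mul_assoc, e1, one_mul]
  rw [h3, h4, mul_assoc] at h2
  rw [zero_add, add_zero] at h1
  exact h1.ext h2

end Transfer

/-! ### Word expansions of X^ref, J^ref, X and H^ref. -/

section WordExpansion

variable {r : ℕ} (D : RefinedBPS r)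

/-- The weight `σ_γ W(γ) / (2πi)` of a charge in the sum-integral. -/
def cf (W : Charge r → ℂ) (a : NZCharge r) : ℂ :=
  ((D.sgn a.1 : ℤ) : ℂ) * W a.1 / (2 * Real.pi * Complex.I)

/-- Linear combinations of words with content `m`. -/
def wsum (K χ : List (NZCharge r) → ℂ) (m : NZCharge r →₀ ℕ) : ℂ := ∑ w ∈ wordsOf m, K w * χ w

/-- Extension by zero to the empty word. -/
def consFn (G : NZCharge r → List (NZCharge r) → ℂ) : List (NZCharge r) → ℂ
  | [] => 0
  | a :: w => G a w

variable {D} {ε : ℝ}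

theorem wt_content_cons (a : NZCharge r) (w : List (NZCharge r)) :
    wt (content (a :: w)) = a.1 + wt (content w) := by
  rw [content_cons, map_add, wt_single]

theorem rayInt_const_mul (ε : ℝ) (γ : Charge r) (c : ℂ) (f : ℂ → ℂ) :
    D.rayInt ε γ (fun s => c * f s) = c * D.rayInt ε γ f := by
  rw [rayInt_eq, rayInt_eq, mul_left_comm]
  congr 1
  rw [← integral_const_mul]
  simp only [mul_div_assoc]

theorem SlowGrowth.const_mul {f : ℂ → ℂ} (hf : SlowGrowth f) (c : ℂ) :
    SlowGrowth fun s => c * f s := by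
  refine ⟨hf.measurable.const_mul c, fun η h0 h1 => ?_⟩
  obtain ⟨C, hC, hb⟩ := hf.bound η h0 h1
  refine ⟨‖c‖ * C, by positivity, fun t => ?_⟩
  rw [norm_mul, mul_assoc]
  exact mul_le_mul_of_nonneg_left (hb t) (norm_nonneg c)

theorem opT_const_mul (ε : ℝ) (γ : Charge r) (c : ℂ) (f : ℂ → ℂ) (t : ℂ) :
    opT D ε γ (fun s => c * f s) t = c * opT D ε γ f t := by
  rw [opT, opT, ← rayInt_const_mul]
  congr 1
  funext s
  ring

theorem opT_sum {ι : Type*} (S : Finset ι) (K : ι → ℂ) {f : ι → ℂ → ℂ}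
    (hf : ∀ i, SlowGrowth (f i)) (hε1 : ε < 1) (γ : Charge r) (t : ℂ) :
    SlowGrowth (fun s => ∑ i ∈ S, K i * f i s) ∧
    opT D ε γ (fun s => ∑ i ∈ S, K i * f i s) t = ∑ i ∈ S, K i * opT D ε γ (f i) t := by
  classical
  induction S using Finset.induction_on with
  | empty =>
    refine ⟨by simpa using SlowGrowth.const 0, ?_⟩
    have := opT_const_mul (D := D) ε γ 0 (fun _ => 0) t
    simpa using this
  | insert i S hi ih =>
    simp only [Finset.sum_insert hi]
    refine ⟨((hf i).const_mul (K i)).add ih.1, ?_⟩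
    rw [opT_add ((hf i).const_mul (K i)) ih.1 hε1, ih.2, opT_const_mul]

/-- The sum-integral of a family given by word expansions. -/
theorem sumInt_words (W : Charge r → ℂ) (hε : 0 < ε) (hε1 : ε < 1) (k : NZCharge r → ℂ)
    (K : NZCharge r → List (NZCharge r) → ℂ) {X : NZCharge r → ℂ → Formal r}
    (hX : ∀ a s, X a s = toF a.1 fun m => ef D a.1 s * wsum (K a) (fun w => wordInt D ε w s) m)
    (t : ℂ) :
    D.sumInt W ε (fun a s => (k a * kern t s) • X a s) =
      toF 0 (wsum (consFn fun a w => cf D W a * k a * K a w) fun w => wordInt D ε w t) := by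
  funext m θ
  rw [RefinedBPS.sumInt, toF, wsum]
  by_cases hm : m = 0
  · subst hm
    simp [sum_wordsOf_zero, consFn]
  rw [sum_wordsOf_of_ne hm, Pi.smul_apply, smul_eq_mul, Finset.sum_mul]
  refine Finset.sum_congr rfl fun a ha => ?_
  have hwt : a.1 + wt (m - Finsupp.single a 1) = 0 + wt m := by
    rw [← wt_single a, ← map_add, add_tsub_cancel_of_le (single_le_of_mem_support ha), zero_add]
  have e : (fun s => ((k a * kern t s) • X a s) (m - Finsupp.single a 1) θ) = fun s =>
      (k a * expFun (0 + wt m) θ) * (kern t s * (ef D a.1 s *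
        ∑ w ∈ wordsOf (m - Finsupp.single a 1), K a w * wordInt D ε w s)) := by
    funext s
    change (k a * kern t s) * X a s (m - Finsupp.single a 1) θ = _
    rw [hX, toF, hwt, Pi.smul_apply, smul_eq_mul, wsum]
    ring
  have e2 := (opT_sum (D := D) (wordsOf (m - Finsupp.single a 1)) (K a)
    (fun w => slowGrowth_wordInt (D := D) hε hε1 w) hε1 a.1 t).2
  rw [opT] at e2
  rw [e, rayInt_const_mul, e2, Finset.mul_sum, Finset.mul_sum, Finset.sum_mul]
  refine Finset.sum_congr rfl fun w _ => ?_
  simp only [consFn, wordInt, cf]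
  ring

theorem XsfF_eq_toF (γ : Charge r) (t : ℂ) :
    D.XsfF γ t = toF γ fun m => if m = 0 then ef D γ t else 0 := by
  funext m
  refine (MvPowerSeries.coeff_C m _).trans ?_
  rw [toF]
  split_ifs with hm
  · simp [hm, Xsf_eq]
  · simp

theorem lift₂_XsfF {χ : ℤ → ℂ} {op : Obs r → Obs r → Obs r} (h : HasStructure D χ op)
    (γ : Charge r) (t : ℂ) (δ : Charge r) (c : (NZCharge r →₀ ℕ) → ℂ) :
    lift₂ op (D.XsfF γ t) (toF δ c) =
      toF (γ + δ) fun m => ef D γ t * (χ (D.pairing γ (δ + wt m)) * c m) := by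
  rw [XsfF_eq_toF, lift₂_toF h]
  congr 1
  funext m
  rw [brConv, Finset.sum_eq_single (0, m)]
  · simp only [if_true, map_zero, add_zero]
    ring
  · rintro ⟨x, y⟩ hx hne
    rw [if_neg, zero_mul, zero_mul]
    rintro rfl
    rw [Finset.HasAntidiagonal.mem_antidiagonal, zero_add] at hx
    exact hne (by rw [← hx])
  · intro hx
    rw [Finset.HasAntidiagonal.mem_antidiagonal, zero_add] at hx
    exact absurd rfl hx

/-- Each step gains one order of agreement, so the iterates agree in every degree with any fixed
point. Solving the equation thereby reduces to exhibiting one. -/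
theorem iterate_eq_fixed {S : (Charge r → ℂ → Formal r) → Charge r → ℂ → Formal r}
    (hS : ∀ N X Y, RefinedBPS.AgreeBelow N X Y → RefinedBPS.AgreeBelow (N + 1) (S X) (S Y))
    {X : Charge r → ℂ → Formal r} (hX : S X = X) (γ : Charge r) (t : ℂ) :
    (fun m => S^[m.degree + 1] 0 γ t m) = X γ t := by
  have key : ∀ N, RefinedBPS.AgreeBelow N (S^[N] 0) X := by
    intro N
    induction N with
    | zero => intro γ t m hm; omega
    | succ N ih =>
      rw [Function.iterate_succ_apply', ← hX]
      exact hS N _ _ ih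
  funext m
  exact key (m.degree + 1) γ t m (Nat.lt_succ_self _)

variable (D) in
/-- The coefficient of a word in `1 + J^ref`. -/
def refCoef (α : ℂ) : List (NZCharge r) → ℂ
  | [] => 1
  | a :: w => cf D (D.OmegaBar α) a * (yGap α)⁻¹ * (yPow α (D.pairing a.1 (wt (content w))) * refCoef α w)

theorem toF_one_add (K χ : List (NZCharge r) → ℂ) (h1 : K [] = 1) (h2 : χ [] = 1) :
    (1 : Formal r) + toF 0 (wsum (consFn fun a w => K (a :: w)) χ) = toF 0 (wsum K χ) := by
  funext m
  rw [mvps_add_apply, mvps_one_apply, toF, toF, wsum, wsum]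
  by_cases hm : m = 0
  · subst hm
    simp [sum_wordsOf_zero, consFn, h1, h2, expFun_zero]
  · rw [if_neg hm, zero_add, sum_wordsOf_of_ne hm, sum_wordsOf_of_ne hm]
    rfl

theorem refStep_words (α : ℂ) (hε : 0 < ε) (hε1 : ε < 1) {X : Charge r → ℂ → Formal r}
    (hX : ∀ γ s, X γ s = toF γ fun m => ef D γ s *
      (yPow α (D.pairing γ (wt m)) * wsum (refCoef D α) (fun w => wordInt D ε w s) m)) (t : ℂ) :
    1 + D.sumInt (D.OmegaBar α) ε (fun a s => (kern t s / yGap α) • X a.1 s) =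
      toF 0 (wsum (refCoef D α) fun w => wordInt D ε w t) := by
  have hXa : ∀ (a : NZCharge r) s, X a.1 s = toF a.1 fun m => ef D a.1 s *
      wsum (fun w => yPow α (D.pairing a.1 (wt (content w))) * refCoef D α w)
        (fun w => wordInt D ε w s) m := by
    intro a s
    rw [hX]
    congr 1
    funext m
    congr 1
    rw [wsum, wsum, Finset.mul_sum]
    refine Finset.sum_congr rfl fun w hw => ?_
    rw [mem_wordsOf.1 hw, mul_assoc]
  have h := sumInt_words (D.OmegaBar α) hε hε1 (fun _ => (yGap α)⁻¹)
    (fun a w => yPow α (D.pairing a.1 (wt (content w))) * refCoef D α w)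
    (X := fun a => X a.1) hXa t
  have e : (fun (a : NZCharge r) s => (kern t s / yGap α) • X a.1 s) =
      fun a s => ((yGap α)⁻¹ * kern t s) • X a.1 s := by
    funext a s
    rw [div_eq_inv_mul]
  rw [e, h, ← toF_one_add (refCoef D α) _ (by rw [refCoef]) (by rw [wordInt])]
  simp only [refCoef]

/-- One step prepends a letter: the star product with X^sf supplies the power of y, and the
sum-integral the outermost integration of `wordInt`. -/
theorem XrefReg_words (α : ℂ) (hε : 0 < ε) (hε1 : ε < 1) :
    D.XrefReg α ε = fun γ t => toF γ fun m => ef D γ t *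
      (yPow α (D.pairing γ (wt m)) * wsum (refCoef D α) (fun w => wordInt D ε w t) m) := by
  funext γ t
  refine iterate_eq_fixed (fun _ _ _ h => D.refStep_agree α ε h)
    (X := fun γ t => toF γ fun m => ef D γ t *
      (yPow α (D.pairing γ (wt m)) * wsum (refCoef D α) (fun w => wordInt D ε w t) m)) ?_ γ t
  funext γ t
  rw [RefinedBPS.refStep, refStep_words α hε hε1 fun _ _ => rfl, RefinedBPS.starMul,
    lift₂_XsfF (hasStructure_moyal α), add_zero]
  simp only [zero_add]

theorem JrefReg_words (α : ℂ) (hε : 0 < ε) (hε1 : ε < 1) (t : ℂ) :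
    1 + D.JrefReg α ε t = toF 0 (wsum (refCoef D α) fun w => wordInt D ε w t) :=
  refStep_words α hε hε1 (fun γ s => by rw [XrefReg_words α hε hε1]) t

/-! ### The limit of coinciding contours -/

theorem eventually_wordInt_wordsOf (t : ℂ) (m : NZCharge r →₀ ℕ) :
    ∀ᶠ ε in 𝓝[>] (0 : ℝ), (0 < ε ∧ ε < 1) ∧ ∀ w ∈ wordsOf m, wordInt D ε w t = limInt D w t := by
  have h : ∀ᶠ ε in 𝓝[>] (0 : ℝ), 0 < ε ∧ ε < 1 := Ioo_mem_nhdsGT one_pos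
  refine h.and ?_
  rw [Filter.eventually_all_finset]
  exact fun w _ => eventually_wordInt_eq w t

theorem wsum_congr (K : List (NZCharge r) → ℂ) {χ χ' : List (NZCharge r) → ℂ}
    {m : NZCharge r →₀ ℕ} (h : ∀ w ∈ wordsOf m, χ w = χ' w) : wsum K χ m = wsum K χ' m :=
  Finset.sum_congr rfl fun w hw => by rw [h w hw]

theorem eventually_JrefReg (α : ℂ) (t : ℂ) (m : NZCharge r →₀ ℕ) :
    ∀ᶠ ε in 𝓝[>] (0 : ℝ), D.JrefReg α ε t m =
      (toF 0 (wsum (refCoef D α) fun w => limInt D w t) - 1) m := by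
  filter_upwards [eventually_wordInt_wordsOf (D := D) t m] with ε hε
  have h := JrefReg_words (D := D) α hε.1.1 hε.1.2 t
  rw [eq_sub_of_add_eq' h, mvps_sub_apply, mvps_sub_apply, toF, toF, wsum_congr _ hε.2]

theorem eventually_XrefReg (α : ℂ) (γ : Charge r) (t : ℂ) (m : NZCharge r →₀ ℕ) :
    ∀ᶠ ε in 𝓝[>] (0 : ℝ), D.XrefReg α ε γ t m = toF γ (fun m => ef D γ t *
      (yPow α (D.pairing γ (wt m)) * wsum (refCoef D α) (fun w => limInt D w t) m)) m := by
  filter_upwards [eventually_wordInt_wordsOf (D := D) t m] with ε hε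
  simp only [XrefReg_words α hε.1.1 hε.1.2, toF, wsum_congr _ hε.2]

theorem tendsto_of_eventually_eq_coeff {F : ℝ → Formal r} {G : Formal r} {m : NZCharge r →₀ ℕ}
    (h : ∀ᶠ ε in 𝓝[>] (0 : ℝ), F ε m = G m) (θ : Fin r → ℂ) :
    Tendsto (fun ε => F ε m θ) (𝓝[>] (0 : ℝ)) (𝓝 (G m θ)) :=
  tendsto_nhds_of_eventually_eq (h.mono fun ε hε => by rw [hε])

theorem Jref_words (α : ℂ) (t : ℂ) :
    D.Jref α t = toF 0 (wsum (refCoef D α) fun w => limInt D w t) - 1 := by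
  funext m θ
  exact (tendsto_of_eventually_eq_coeff (eventually_JrefReg α t m) θ).limUnder_eq

theorem Xref_words (α : ℂ) (γ : Charge r) (t : ℂ) :
    D.Xref α γ t = toF γ fun m => ef D γ t *
      (yPow α (D.pairing γ (wt m)) * wsum (refCoef D α) (fun w => limInt D w t) m) := by
  funext m θ
  exact (tendsto_of_eventually_eq_coeff (eventually_XrefReg α γ t m) θ).limUnder_eq

theorem tendsto_JrefReg (α : ℂ) (t : ℂ) (m : NZCharge r →₀ ℕ) (θ : Fin r → ℂ) :
    Tendsto (fun ε => D.JrefReg α ε t m θ) (𝓝[>] (0 : ℝ)) (𝓝 (D.Jref α t m θ)) := by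
  rw [Jref_words]
  exact tendsto_of_eventually_eq_coeff (eventually_JrefReg α t m) θ

theorem tendsto_XrefReg (α : ℂ) (γ : Charge r) (t : ℂ) (m : NZCharge r →₀ ℕ) (θ : Fin r → ℂ) :
    Tendsto (fun ε => D.XrefReg α ε γ t m θ) (𝓝[>] (0 : ℝ)) (𝓝 (D.Xref α γ t m θ)) := by
  rw [Xref_words]
  exact tendsto_of_eventually_eq_coeff (eventually_XrefReg α γ t m) θ

theorem Xref_eq (α : ℂ) (γ : Charge r) (t : ℂ) :
    D.Xref α γ t = D.starMul α (D.XsfF γ t) (1 + D.Jref α t) := by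
  rw [Xref_words, Jref_words, add_sub_cancel, RefinedBPS.starMul, lift₂_XsfF (hasStructure_moyal α),
    add_zero]
  simp only [zero_add]

/-! ### Expansions of `X` and `H^ref` -/

variable (D) in
/-- The letters representing the charges. -/
def letter (α : ℂ) (a : NZCharge r) : OpRing r :=
  (cf D (D.OmegaBar α) a * (yGap α)⁻¹) • lop D α 1 a.1

theorem prod_letter (α : ℂ) (w : List (NZCharge r)) :
    (w.map (letter D α)).prod = refCoef D α w • lop D α (content w).degree (wt (content w)) := by
  induction w with
  | nil => simp [refCoef, content_nil, lop_zero]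
  | cons a w ih =>
    rw [List.map_cons, List.prod_cons, ih, letter, smul_mul_smul_comm, lop_mul, smul_smul, refCoef,
      content_cons, map_add, map_add, wt_single, Finsupp.degree_single, Nat.cast_add, Nat.cast_one]
    congr 1
    ring

theorem wordSer_letter (α : ℂ) (χ : List (NZCharge r) → ℂ) :
    wordSer (letter D α) χ = toT D α 0 (wsum (refCoef D α) χ) := by
  funext m
  rw [wordSer, ser, toT, wsum, Finset.sum_smul, zero_add]
  refine Finset.sum_congr rfl fun w hw => ?_
  rw [prod_letter, smul_smul, mem_wordsOf.1 hw, mul_comm]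

theorem rel_Jref (α : ℂ) (t : ℂ) :
    Rel D α 0 (D.Jref α t) (wordSer (letter D α) (fun w => limInt D w t) - 1) := by
  have h : Rel D α 0 (toF 0 (wsum (refCoef D α) fun w => limInt D w t))
    (wordSer (letter D α) fun w => limInt D w t) := ⟨_, rfl, wordSer_letter α _⟩
  have := h.add (rel_one.smul (-1))
  rw [Jref_words, sub_eq_add_neg, sub_eq_add_neg]
  simpa using this

theorem rel_XsfF (α : ℂ) (γ : Charge r) (t : ℂ) :
    Rel D α γ (D.XsfF γ t) (MvPowerSeries.C (ef D γ t • lop D α 0 γ)) := by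
  rw [RefinedBPS.XsfF, Xsf_eq]
  exact rel_C _ _

/-- `H^ref` generates the `X_γ`. -/
theorem X_eq_expNegBracket {α : ℂ} (hg : yGap α ≠ 0) (γ : Charge r) (t : ℂ) :
    D.X α γ t = expNegBracket (lift₂ (D.starBr α)) (D.Href α t) (D.XsfF γ t) := by
  rw [RefinedBPS.X, Xref_eq, RefinedBPS.Href]
  exact starMul_inv_conj hg (rel_Jref α t) (rel_XsfF α γ t)
    (orderGE_wordSer_sub_one (isShuffleChar_limInt t).nil _)

variable (D) in
/-- The product of the weights of the letters of a word. -/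
def cw (W : Charge r → ℂ) (w : List (NZCharge r)) : ℂ := (w.map (cf D W)).prod

variable (D) in
/-- The structure constant of the nested bracket of `γ` with the letters of a word. -/
def lamW (κ : ℤ → ℂ) : Charge r → List (NZCharge r) → ℂ
  | _, [] => 1
  | γ, a :: w => κ (D.pairing γ a.1) * lamW κ (γ + a.1) w

theorem opRing_smul_sub (a : ℂ) (x y : OpRing r) : a • x - a • y = a • (x - y) :=
  (smul_sub a x y).symm

theorem adWord_letter {α : ℂ} (p : ℂ) (k : ℕ) (δ : Charge r) (w : List (NZCharge r)) :
    adWord (letter D α) (p • lop D α k δ) w =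
      (p * (cw D (D.OmegaBar α) w * lamW D (kap α) δ w)) •
        lop D α ((k + (content w).degree : ℕ) : ℤ) (δ + wt (content w)) := by
  induction w generalizing p k δ with
  | nil => simp [adWord, cw, lamW, content_nil]
  | cons a w ih =>
    have e : p • lop D α k δ * letter D α a - letter D α a * p • lop D α k δ =
        (p * (cf D (D.OmegaBar α) a * kap α (D.pairing δ a.1))) •
          lop D α ((k + 1 : ℕ) : ℤ) (δ + a.1) := by
      rw [letter, smul_mul_smul_comm, smul_mul_smul_comm, mul_comm p, opRing_smul_sub, lop_comm, smul_smul,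
        kap, Nat.cast_add, Nat.cast_one]
      congr 1
      ring
    rw [adWord, e, ih, content_cons, map_add, map_add, wt_single, Finsupp.degree_single, cw, cw,
      List.map_cons, List.prod_cons, lamW, add_assoc, add_assoc]
    congr 1
    ring

/-- X is X^sf conjugated by the character series 1 + J. Each letter enters through a commutator, and
its factor 1/(y − y⁻¹) is absorbed into `kap`; no pole at y = 1 is left, unlike in X^ref. -/
theorem X_words {α : ℂ} (γ : Charge r) (t : ℂ) :
    D.X α γ t = toF γ fun m => ef D γ t *
      wsum (fun w => cw D (D.OmegaBar α) w * lamW D (kap α) γ w) (fun w => limInt D w t) m := by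
  have hJ := rel_Jref (D := D) α t
  have h := hJ.inv.mul ((rel_XsfF (D := D) α γ t).mul (rel_one.add hJ))
  rw [add_sub_cancel, zero_add, add_zero, ← mul_assoc,
    psEval_inv_mul_C_mul (isShuffleChar_limInt t), ← Xref_eq] at h
  refine Rel.ext h ⟨_, rfl, ?_⟩
  funext m
  rw [ser, toT, wsum, Finset.mul_sum, Finset.sum_smul]
  refine Finset.sum_congr rfl fun w hw => ?_
  have := adWord_letter (D := D) (α := α) (ef D γ t) 0 γ w
  rw [Nat.cast_zero] at this
  rw [this, smul_smul, mem_wordsOf.1 hw, zero_add]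
  congr 1
  ring

variable (D) in
/-- The coefficient of a word in the logarithm. -/
def headC (W : Charge r → ℂ) (κ : ℤ → ℂ) : List (NZCharge r) → ℂ
  | [] => 0
  | a :: w => cw D W (a :: w) * lamW D κ a.1 w

/-- Dynkin–Specht–Wever with E = `gradeOp`: the first commutator returns the first letter. The other
commutators absorb one factor 1/(y − y⁻¹) each, and the prefactor of H^ref cancels the remaining
one. -/
theorem Href_words {α : ℂ} (hg : yGap α ≠ 0) (t : ℂ) :
    D.Href α t = toF 0 fun m => (m.degree : ℂ)⁻¹ *
      wsum (headC D (D.OmegaBar α) (kap α)) (wordLog fun w => limInt D w t) m := by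
  have hχ := isShuffleChar_limInt (D := D) t
  have h := (rel_Jref (D := D) α t).log.smul (yGap α)
  rw [psEval_log hχ.nil] at h
  refine Rel.ext h ⟨_, rfl, ?_⟩
  funext m
  rw [mvps_smul_apply]
  by_cases hm : m = 0
  · subst hm
    rw [wordSer, ser, sum_wordsOf_zero, wordLog_nil]
    simp [toT]
  have hd : (m.degree : ℂ) ≠ 0 := by
    rw [Nat.cast_ne_zero, Ne, Finsupp.degree_eq_zero_iff]
    exact hm
  have hE : ∀ a, gradeOp * letter D α a - letter D α a * gradeOp = letter D α a := by
    intro a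
    rw [letter, mul_smul_comm, smul_mul_assoc, opRing_smul_sub, gradeOp_comm]
    simp
  have key := degree_smul_wordSer_wordLog hχ (letter D α) gradeOp hE m
  rw [← inv_smul_smul₀ hd (wordSer (letter D α) (wordLog fun w => limInt D w t) m), key, smul_smul,
    Finset.smul_sum, toT, wsum, Finset.mul_sum, Finset.sum_smul]
  refine Finset.sum_congr rfl fun w hw => ?_
  match w with
  | [] => simp [wordLog_nil]
  | a :: w =>
    have := adWord_letter (D := D) (α := α) (cf D (D.OmegaBar α) a * (yGap α)⁻¹) 1 a.1 w
    rw [adWord, hE, letter, ← Nat.cast_one (R := ℤ), this, smul_smul, smul_smul, headC, zero_add,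
      ← mem_wordsOf.1 hw, content_cons, map_add, map_add, wt_single, Finsupp.degree_single, cw, cw,
      List.map_cons, List.prod_cons]
    congr 1
    field_simp

end WordExpansion

/-! ### Stabilisation of the logarithm for small displacements. -/

section EventualEquality

variable {L R : Type*} [AddCommMonoid R]

theorem eventually_splitSum {ι : Type*} {l : Filter ι} {H : ι → List L → List L → R}
    {H' : List L → List L → R} (h : ∀ u v, ∀ᶠ i in l, H i u v = H' u v) (w : List L) :
    ∀ᶠ i in l, splitSum (H i) w = splitSum H' w := by
  induction w generalizing H H' with
  | nil => exact h [] []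
  | cons a w ih =>
    filter_upwards [h [] (a :: w), ih fun u v => h (a :: u) v] with i h1 h2
    rw [splitSum, splitSum, h1, h2]

theorem eventually_wordLog {K ι : Type*} [Field K] {l : Filter ι} {χ : ι → List L → K}
    {χ' : List L → K} (h : ∀ w, ∀ᶠ i in l, χ i w = χ' w) (w : List L) :
    ∀ᶠ i in l, wordLog (χ i) w = wordLog χ' w := by
  have hc : ∀ k w, ∀ᶠ i in l, convPow (χ i) k w = convPow χ' k w := by
    intro k
    induction k with
    | zero => intro w; cases w <;> exact Eventually.of_forall fun _ => rfl
    | succ k ih =>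
      intro w
      cases w with
      | nil => exact Eventually.of_forall fun _ => rfl
      | cons a w =>
        refine eventually_splitSum (fun u v => ?_) w
        filter_upwards [h (a :: u), ih v] with i h1 h2
        rw [h1, h2]
  have := (Filter.eventually_all_finset (Finset.range (w.length + 1))).2 fun k _ => hc k w
  filter_upwards [this] with i hi
  exact Finset.sum_congr rfl fun k hk => by rw [hi k hk]

end EventualEquality

/-! ### The series of nested brackets in terms of words. -/

section BracketSeries

variable {r : ℕ} {D : RefinedBPS r} {ε : ℝ} {χ : ℤ → ℂ} {op : Obs r → Obs r → Obs r}

variable (D) in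
/-- The structure constant of the nested bracket of the letters of a word. -/
def lamH (κ : ℤ → ℂ) : List (NZCharge r) → ℂ
  | [] => 0
  | a :: w => lamW D κ a.1 w

theorem headC_eq (W : Charge r → ℂ) (κ : ℤ → ℂ) (w : List (NZCharge r)) :
    headC D W κ w = cw D W w * lamH D κ w := by
  cases w with
  | nil => rw [headC, lamH, mul_zero]
  | cons a w => rw [headC, lamH]

theorem cw_cons (W : Charge r → ℂ) (a : NZCharge r) (w : List (NZCharge r)) :
    cw D W (a :: w) = cf D W a * cw D W w := by
  rw [cw, List.map_cons, List.prod_cons, cw]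

theorem foldl_expFun (h : HasStructure D χ op) (l : List (NZCharge r × ℂ)) (c : ℂ)
    (g : Charge r) :
    (l.map fun p => p.2 • expFun p.1.1).foldl op (c • expFun g) =
      (c * (l.map Prod.snd).prod * lamW D χ g (l.map Prod.fst)) •
        expFun (g + wt (content (l.map Prod.fst))) := by
  induction l generalizing c g with
  | nil => simp [lamW, content_nil]
  | cons p l ih =>
    rw [List.map_cons, List.foldl_cons, h, ih, List.map_cons, List.map_cons, List.prod_cons, lamW,
      wt_content_cons, add_assoc]
    congr 1
    ring

theorem leftNested_expFun (h : HasStructure D χ op) (l : List (NZCharge r × ℂ)) :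
    leftNested op (l.map fun p => p.2 • expFun p.1.1) =
      ((l.map Prod.snd).prod * lamH D χ (l.map Prod.fst)) •
        expFun (wt (content (l.map Prod.fst))) := by
  cases l with
  | nil => simp [leftNested, lamH]
  | cons p l =>
    rw [List.map_cons, leftNested, foldl_expFun h, List.map_cons, List.map_cons, List.prod_cons,
      lamH, wt_content_cons]

variable (D) in
/-- The structure constant of the sum over nested brackets of permuted charges. -/
def runCoef (κ : ℤ → ℂ) (n : ℕ) (f : Fin n → NZCharge r) : ℂ :=
  ∑ σ : Equiv.Perm (Fin n),
    ((-1 : ℂ) ^ (ascRuns σ + 1) / ((n.choose (ascRuns σ) : ℂ) * (n : ℂ) * (ascRuns σ : ℂ))) *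
      lamH D κ (List.ofFn (f ∘ σ))

theorem runSum_expFun (h : HasStructure D χ op) (n : ℕ) (f : Fin n → NZCharge r) (c : Fin n → ℂ) :
    runSum op n (fun i => c i • expFun (f i).1) =
      (∏ i, c i) • (runCoef D χ n f • expFun (wt (content (List.ofFn f)))) := by
  rw [runSum, runCoef, Finset.sum_smul, Finset.smul_sum]
  refine Finset.sum_congr rfl fun σ _ => ?_
  have e := leftNested_expFun h (List.ofFn fun i => (f (σ i), c (σ i)))
  simp only [List.map_ofFn, Function.comp_def, List.prod_ofFn] at e
  rw [e, Equiv.prod_comp σ c]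
  have e2 : content (List.ofFn fun i => f (σ i)) = content (List.ofFn f) :=
    content_ofFn_comp f σ
  rw [e2, smul_smul, smul_smul]
  congr 1
  simp only [Function.comp_def]
  ring

/-- `G` depends on the charges only, so the chain of integrals acts on the exponential factors alone
and assembles into `wordInt`. -/
theorem chainInt_words (W : Charge r → ℂ) (hε : 0 < ε) (hε1 : ε < 1) (n : ℕ) (t : ℂ)
    (G : (Fin n → NZCharge r) → Obs r) (m : NZCharge r →₀ ℕ) (θ : Fin r → ℂ) :
    D.chainInt W ε n t (fun v => (∏ i, ef D (v i).1.1 (v i).2) • G fun i => (v i).1) m θ =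
      ∑ f ∈ tuplesOf n m, cw D W (List.ofFn f) * wordInt D ε (List.ofFn f) t * G f θ := by
  induction n generalizing t m with
  | zero =>
    rw [RefinedBPS.chainInt]
    have e := congrFun (MvPowerSeries.coeff_C m ((∏ i : Fin 0, ef D (Fin.elim0 (α := NZCharge r × ℂ) i).1.1
      (Fin.elim0 (α := NZCharge r × ℂ) i).2) • G fun i => (Fin.elim0 (α := NZCharge r × ℂ) i).1)) θ
    refine e.trans ?_
    have hG : (fun i : Fin 0 => (Fin.elim0 (α := NZCharge r × ℂ) i).1) = Fin.elim0 :=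
      Subsingleton.elim _ _
    by_cases hm : m = 0
    · subst hm
      have ht : tuplesOf 0 (0 : NZCharge r →₀ ℕ) = {Fin.elim0} := by
        ext f
        rw [mem_tuplesOf, Finset.mem_singleton, List.ofFn_zero, content_nil]
        exact ⟨fun _ => Subsingleton.elim _ _, fun _ => rfl⟩
      rw [ht, Finset.sum_singleton, if_pos rfl, hG]
      simp [cw, wordInt]
    · have ht : tuplesOf 0 m = ∅ := by
        refine Finset.eq_empty_of_forall_notMem fun f hf => ?_
        rw [mem_tuplesOf, List.ofFn_zero, content_nil] at hf
        exact hm hf.symm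
      rw [ht, Finset.sum_empty, if_neg hm]
      rfl
  | succ n ih =>
    rw [RefinedBPS.chainInt, RefinedBPS.sumInt, sum_tuplesOf_succ]
    refine Finset.sum_congr rfl fun a _ => ?_
    have e : (fun s => (kern t s • D.chainInt W ε n s fun v =>
        (∏ i, ef D ((Fin.cons (a, s) v : Fin (n + 1) → NZCharge r × ℂ) i).1.1
          ((Fin.cons (a, s) v : Fin (n + 1) → NZCharge r × ℂ) i).2) •
        G fun i => ((Fin.cons (a, s) v : Fin (n + 1) → NZCharge r × ℂ) i).1)
          (m - Finsupp.single a 1) θ) =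
        fun s => kern t s * (ef D a.1 s * ∑ f ∈ tuplesOf n (m - Finsupp.single a 1),
          (cw D W (List.ofFn f) * G (Fin.cons a f) θ) * wordInt D ε (List.ofFn f) s) := by
      funext s
      change kern t s * D.chainInt W ε n s _ (m - Finsupp.single a 1) θ = _
      congr 1
      have hf : (fun v : Fin n → NZCharge r × ℂ =>
          (∏ i, ef D ((Fin.cons (a, s) v : Fin (n + 1) → NZCharge r × ℂ) i).1.1
            ((Fin.cons (a, s) v : Fin (n + 1) → NZCharge r × ℂ) i).2) •
          G fun i => ((Fin.cons (a, s) v : Fin (n + 1) → NZCharge r × ℂ) i).1) =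
          fun v => (∏ i, ef D (v i).1.1 (v i).2) •
            (fun f : Fin n → NZCharge r => ef D a.1 s • G (Fin.cons a f)) fun i => (v i).1 := by
        funext v
        have hc : (fun i => ((Fin.cons (a, s) v : Fin (n + 1) → NZCharge r × ℂ) i).1) =
            Fin.cons a fun i => (v i).1 := by
          funext i
          refine Fin.cases ?_ (fun i => ?_) i <;> rfl
        rw [hc, Fin.prod_univ_succ]
        simp only [Fin.cons_zero, Fin.cons_succ]
        rw [mul_comm, mul_smul]
      rw [hf]
      refine (ih s (fun f => ef D a.1 s • G (Fin.cons a f)) (m - Finsupp.single a 1)).trans ?_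
      rw [Finset.mul_sum]
      refine Finset.sum_congr rfl fun f _ => ?_
      rw [Pi.smul_apply, smul_eq_mul]
      ring
    have e2 := (opT_sum (D := D) (tuplesOf n (m - Finsupp.single a 1))
      (fun f => cw D W (List.ofFn f) * G (Fin.cons a f) θ)
      (fun f => slowGrowth_wordInt (D := D) hε hε1 (List.ofFn f)) hε1 a.1 t).2
    rw [opT] at e2
    rw [e, e2, Finset.mul_sum]
    refine Finset.sum_congr rfl fun f _ => ?_
    rw [List.ofFn_cons, cw_cons, wordInt, cf]
    ring

theorem degree_eq_of_mem_tuplesOf {n : ℕ} {m : NZCharge r →₀ ℕ} {f : Fin n → NZCharge r}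
    (h : f ∈ tuplesOf n m) : m.degree = n := by
  rw [← mem_tuplesOf.1 h, degree_content, List.length_ofFn]

/-- Here the order of integration is fixed and the bracket is permuted, while in `wordLog_ofFn` it
is the other way round. Relabelling the tuples by `σ` exchanges the two, since the product of
weights is symmetric. The additional 1/n is the Dynkin factor. -/
theorem sum_runCoef {χ' : List (NZCharge r) → ℂ} (hχ : IsShuffleChar χ') (W : Charge r → ℂ)
    (κ : ℤ → ℂ) (n : ℕ) {m : NZCharge r →₀ ℕ} (hm : m.degree = n + 1) :
    ∑ f ∈ tuplesOf (n + 1) m, cw D W (List.ofFn f) * χ' (List.ofFn f) * runCoef D κ (n + 1) f =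
      (m.degree : ℂ)⁻¹ * wsum (headC D W κ) (wordLog χ') m := by
  have hcw : ∀ (f : Fin (n + 1) → NZCharge r) (σ : Equiv.Perm (Fin (n + 1))),
      cw D W (List.ofFn (f ∘ σ)) = cw D W (List.ofFn f) := by
    intro f σ
    rw [cw, cw, List.map_ofFn, List.map_ofFn, List.prod_ofFn, List.prod_ofFn]
    exact Equiv.prod_comp σ fun i => cf D W (f i)
  rw [wsum, sum_wordsOf_eq_sum_tuplesOf hm, Finset.mul_sum]
  simp only [runCoef, Finset.mul_sum]
  have hR : ∀ f : Fin (n + 1) → NZCharge r,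
      (m.degree : ℂ)⁻¹ * (headC D W κ (List.ofFn f) * wordLog χ' (List.ofFn f)) =
      ∑ σ : Equiv.Perm (Fin (n + 1)), (m.degree : ℂ)⁻¹ * (cw D W (List.ofFn f) *
        lamH D κ (List.ofFn f) * ((-1) ^ (ascRuns σ + 1) /
          (((n + 1).choose (ascRuns σ) : ℂ) * (ascRuns σ : ℂ)) * χ' (List.ofFn (f ∘ σ.symm)))) := by
    intro f
    rw [headC_eq, wordLog_ofFn hχ, Finset.mul_sum, Finset.mul_sum]
  simp only [hR]
  rw [Finset.sum_comm, Finset.sum_comm (s := tuplesOf (n + 1) m)]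
  refine Finset.sum_congr rfl fun σ _ => ?_
  rw [← sum_tuplesOf_comp m σ.symm]
  refine Finset.sum_congr rfl fun f _ => ?_
  have e : (f ∘ σ.symm) ∘ σ = f := by funext i; simp
  rw [hcw, e, hm]
  rw [mul_right_comm ((n + 1).choose (ascRuns σ) : ℂ), div_mul_eq_div_div]
  ring

/-- Each integration carries one indeterminate, so in total degree d only the term n = d of the
series contributes. -/
theorem bracketSeries_words (h : HasStructure D χ op) (W : Charge r → ℂ) (hε : 0 < ε) (hε1 : ε < 1)
    (t : ℂ) : D.bracketSeries op W ε t = toF 0 fun m => (m.degree : ℂ)⁻¹ *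
      wsum (headC D W χ) (wordLog fun w => wordInt D ε w t) m := by
  have hchar := isShuffleChar_wordInt (D := D) hε hε1 t
  have hF : ∀ n m θ, D.chainInt W ε n t
      (fun v => runSum op n fun i => D.Xsf (v i).1.1 (v i).2) m θ =
      ∑ f ∈ tuplesOf n m, cw D W (List.ofFn f) * wordInt D ε (List.ofFn f) t *
        (runCoef D χ n f • expFun (wt (content (List.ofFn f)))) θ := by
    intro n m θ
    rw [← chainInt_words W hε hε1]
    simp only [Xsf_eq, runSum_expFun h]
  funext m θ
  rw [RefinedBPS.bracketSeries, formalSum, toF]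
  refine (Finset.sum_apply θ _ _).trans ?_
  cases hd : m.degree with
  | zero =>
    simp only [zero_add, Finset.range_one, Finset.sum_singleton, if_true, Nat.cast_zero, inv_zero,
      zero_mul, zero_smul]
    rfl
  | succ n =>
    have key := sum_runCoef (D := D) hchar W χ n hd
    rw [hd] at key
    rw [Finset.sum_eq_single (n + 1)]
    · rw [if_neg (Nat.succ_ne_zero n), hF, Pi.smul_apply, smul_eq_mul,
        ← key, Finset.sum_mul]
      refine Finset.sum_congr rfl fun f hf => ?_
      rw [Pi.smul_apply, smul_eq_mul, mem_tuplesOf.1 hf, zero_add]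
      ring
    · intro k _ hk
      split_ifs
      · rfl
      · rw [hF]
        refine Finset.sum_eq_zero fun f hf => absurd (degree_eq_of_mem_tuplesOf hf) ?_
        omega
    · intro hn
      exact absurd (Finset.mem_range.2 (Nat.lt_succ_self _)) hn

theorem tendsto_bracketSeries (h : HasStructure D χ op) (W : Charge r → ℂ) (t : ℂ)
    (m : NZCharge r →₀ ℕ) (θ : Fin r → ℂ) :
    Tendsto (fun ε => D.bracketSeries op W ε t m θ) (𝓝[>] (0 : ℝ))
      (𝓝 (toF 0 (fun m => (m.degree : ℂ)⁻¹ *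
        wsum (headC D W χ) (wordLog fun w => limInt D w t) m) m θ)) := by
  refine tendsto_of_eventually_eq_coeff (F := fun ε => D.bracketSeries op W ε t) ?_ θ
  filter_upwards [eventually_wordInt_wordsOf (D := D) t m,
    (Filter.eventually_all_finset (wordsOf m)).2 fun w _ =>
      eventually_wordLog (fun w => eventually_wordInt_eq (D := D) w t) w] with ε h1 h2
  rw [bracketSeries_words h W h1.1.1 h1.1.2]
  simp only [toF, wsum_congr _ h2]

end BracketSeries

/-! ### The commutative product dual to unshuffling. -/

section ShuffleProduct

variable {L R : Type*} [CommRing R]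

/-- The product dual to shuffling on functions on words. -/
def shMul (f g : List L → R) (w : List L) : R := unshuffleSum (fun u v => f u * g v) w

/-- Removal of the first letter is a derivation of this product; the identities below are proved by
it, as if by differentiation. -/
theorem shMul_cons (f g : List L → R) (a : L) (w : List L) :
    shMul f g (a :: w) = shMul (fun u => f (a :: u)) g w + shMul f (fun v => g (a :: v)) w := rfl

theorem shMul_comm (f g : List L → R) : shMul f g = shMul g f := by
  funext w
  induction w generalizing f g with
  | nil => exact mul_comm _ _
  | cons a w ih => rw [shMul_cons, shMul_cons, ih, ih f, add_comm]

theorem shMul_add (f g h : List L → R) :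
    shMul f (fun w => g w + h w) = fun w => shMul f g w + shMul f h w := by
  funext w
  simp only [shMul, mul_add]
  exact unshuffleSum_add _ _ w

theorem shMul_smul (f g : List L → R) (c : R) :
    shMul f (fun w => c * g w) = fun w => c * shMul f g w := by
  funext w
  simp only [shMul, mul_left_comm _ c]
  exact (map_unshuffleSum (AddMonoidHom.mulLeft c) (fun u v => f u * g v) w).symm

theorem shMul_assoc (f g h : List L → R) : shMul (shMul f g) h = shMul f (shMul g h) := by
  funext w
  induction w generalizing f g h with
  | nil => exact mul_assoc _ _ _
  | cons a w ih =>
    rw [shMul_cons, shMul_cons]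
    simp only [shMul_cons]
    rw [shMul_add, shMul_comm _ h, shMul_add, shMul_comm h, shMul_comm h]
    simp only [ih]
    ring

theorem shMul_congr_right {f g g' : List L → R} {w : List L}
    (h : ∀ v, v.length ≤ w.length → g v = g' v) : shMul f g w = shMul f g' w := by
  induction w generalizing f g g' with
  | nil => exact congrArg (f [] * ·) (h [] le_rfl)
  | cons a w ih =>
    rw [shMul_cons, shMul_cons, ih fun v hv => h v (hv.trans (Nat.le_succ _)),
      ih fun v hv => h (a :: v) (Nat.succ_le_succ hv)]

theorem shMul_zero (f : List L → R) (w : List L) : shMul f (fun _ => 0) w = 0 := by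
  have := congrFun (shMul_smul f (fun _ => 0) 0) w
  simpa using this

/-- Powers for the product dual to shuffling. -/
def shPow (f : List L → R) : ℕ → List L → R
  | 0 => fun w => if w.length = 0 then 1 else 0
  | n + 1 => shMul f (shPow f n)

/-- The power rule for the derivation that removes a first letter. -/
theorem shPow_succ_cons (f : List L → R) (n : ℕ) (a : L) :
    (fun w => shPow f (n + 1) (a :: w)) =
      fun w => ((n : R) + 1) * shMul (fun u => f (a :: u)) (shPow f n) w := by
  induction n with
  | zero =>
    funext w
    have h0 : (fun v : List L => shPow f 0 (a :: v)) = fun _ => 0 := by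
      funext v
      simp [shPow]
    change shMul f (shPow f 0) (a :: w) = _
    rw [shMul_cons, h0, shMul_zero]
    simp
  | succ n ih =>
    funext w
    rw [shPow, shMul_cons, ih, shMul_smul, ← shMul_assoc, shMul_comm f, shMul_assoc]
    change _ + _ * shMul _ (shPow f (n + 1)) w = _
    push_cast
    ring

theorem shPow_eq_zero {f : List L → R} (hf : f [] = 0) {n : ℕ} {w : List L} (h : w.length < n) :
    shPow f n w = 0 := by
  induction n generalizing w with
  | zero => omega
  | succ n ih =>
    cases w with
    | nil =>
      change f [] * _ = 0
      rw [hf, zero_mul]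
    | cons a w =>
      have hw : w.length < n := by simpa using h
      rw [show shPow f (n + 1) (a :: w) = _ from congrFun (shPow_succ_cons f n a) w,
        shMul_congr_right (g' := fun _ => 0) fun v hv => ih (by omega), shMul_zero, mul_zero]

theorem shMul_sum {ι : Type*} (s : Finset ι) (f : List L → R) (c : ι → R) (g : ι → List L → R) :
    shMul f (fun w => ∑ i ∈ s, c i * g i w) = fun w => ∑ i ∈ s, c i * shMul f (g i) w := by
  classical
  induction s using Finset.induction_on with
  | empty => funext w; simp [shMul_zero]
  | insert i s hi ih => simp only [Finset.sum_insert hi, shMul_add, shMul_smul, ih]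

end ShuffleProduct

/-! ### Word expansion of the classical Darboux coordinates. -/

section Classical

variable {r : ℕ} {D : RefinedBPS r} {ε : ℝ}

/-- Induction on the word by the derivation property, using ⟨γ+δ,a⟩ = ⟨γ,a⟩ + ⟨δ,a⟩. The refined
constants `kap` are not additive, so the exponential form is special to the classical case. -/
theorem shMul_lamW (γ δ : Charge r) :
    shMul (lamW D (fun n => (n : ℂ)) γ) (lamW D (fun n => (n : ℂ)) δ) =
      lamW D (fun n => (n : ℂ)) (γ + δ) := by
  funext w
  induction w generalizing γ δ with
  | nil => simp [shMul, unshuffleSum, lamW]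
  | cons a w ih =>
    rw [shMul_cons]
    simp only [lamW]
    rw [shMul_comm, shMul_smul, shMul_comm, shMul_smul]
    simp only [ih]
    rw [map_add, LinearMap.add_apply, add_right_comm, add_assoc γ δ]
    push_cast
    ring

variable (D) in
/-- The logarithm of `lamW` for the product dual to shuffling. -/
def muW (γ : Charge r) : List (NZCharge r) → ℂ :=
  consFn fun a w => (D.pairing γ a.1 : ℂ) * lamW D (fun n => (n : ℂ)) a.1 w

/-- Removing the first letter a from `lamW γ` gives ⟨γ,a⟩ times `lamW (γ + a)`, which is the
derivative of `muW γ` times `lamW γ`. The exponential of `muW γ` obeys the same equation. -/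
theorem lamW_eq_sum_shPow {N : ℕ} (γ : Charge r) {w : List (NZCharge r)} (h : w.length < N) :
    lamW D (fun n => (n : ℂ)) γ w = ∑ n ∈ Finset.range N, (n.factorial : ℂ)⁻¹ * shPow (muW D γ) n w := by
  induction N generalizing w with
  | zero => omega
  | succ N ih =>
    rw [Finset.sum_range_succ']
    cases w with
    | nil =>
      rw [Finset.sum_eq_zero fun n _ => by rw [shPow_eq_zero rfl (by simp), mul_zero]]
      simp [lamW, shPow]
    | cons a w =>
      have hw : w.length < N := by simpa using h
      have e : ∀ n, ((n + 1).factorial : ℂ)⁻¹ * shPow (muW D γ) (n + 1) (a :: w) =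
          (n.factorial : ℂ)⁻¹ * shMul (fun u => muW D γ (a :: u)) (shPow (muW D γ) n) w := by
        intro n
        rw [show shPow (muW D γ) (n + 1) (a :: w) = _ from congrFun (shPow_succ_cons _ n a) w,
          Nat.factorial_succ]
        have h1 : (n.factorial : ℂ) ≠ 0 := by exact_mod_cast n.factorial_ne_zero
        have h2 : (n : ℂ) + 1 ≠ 0 := by exact_mod_cast n.succ_ne_zero
        push_cast
        field_simp
      have h0 : shPow (muW D γ) 0 (a :: w) = 0 := by simp [shPow]
      rw [h0, mul_zero, add_zero, Finset.sum_congr rfl fun n _ => e n]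
      rw [← congrFun (shMul_sum (Finset.range N) _ _ _) w,
        ← shMul_congr_right fun v hv => ih (by omega)]
      simp only [muW, consFn]
      rw [shMul_comm, shMul_smul, shMul_lamW, lamW]

theorem cw_nil (W : Charge r → ℂ) : cw D W [] = 1 := rfl

theorem unshuffleSum_cw (W : Charge r → ℂ) (H : List (NZCharge r) → List (NZCharge r) → ℂ)
    (w : List (NZCharge r)) :
    unshuffleSum (fun u v => cw D W u * cw D W v * H u v) w = cw D W w * unshuffleSum H w := by
  induction w generalizing H with
  | nil => simp [unshuffleSum, cw_nil]
  | cons a w ih =>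
    have e : ∀ G : List (NZCharge r) → List (NZCharge r) → ℂ,
        unshuffleSum (fun u v => cf D W a * G u v) w = cf D W a * unshuffleSum G w := fun G =>
      (map_unshuffleSum (AddMonoidHom.mulLeft (cf D W a)) G w).symm
    simp only [unshuffleSum, cw_cons]
    have h1 : ∀ u v, cf D W a * cw D W u * cw D W v * H (a :: u) v =
        cf D W a * (cw D W u * cw D W v * H (a :: u) v) := fun u v => by ring
    have h2 : ∀ u v, cw D W u * (cf D W a * cw D W v) * H u (a :: v) =
        cf D W a * (cw D W u * cw D W v * H u (a :: v)) := fun u v => by ring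
    simp only [h1, h2]
    rw [e, e, ih, ih]
    ring

/-- The product of character values is a shuffle sum, and adjointness moves the shuffle onto the
coefficients. -/
theorem sum_wsum_mul_wsum {χ : List (NZCharge r) → ℂ} (hχ : IsShuffleChar χ) (W : Charge r → ℂ)
    (f g : List (NZCharge r) → ℂ) (m : NZCharge r →₀ ℕ) :
    ∑ x ∈ Finset.HasAntidiagonal.antidiagonal m,
      wsum (fun w => cw D W w * f w) χ x.1 * wsum (fun w => cw D W w * g w) χ x.2 =
    wsum (fun w => cw D W w * shMul f g w) χ m := by
  have h := pairSum_shuffleSum m χ fun u v => cw D W u * cw D W v * (f u * g v)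
  simp only [unshuffleSum_cw] at h
  rw [wsum]
  simp only [shMul, smul_eq_mul] at h ⊢
  rw [Finset.sum_congr rfl fun w _ => mul_comm _ (χ w), ← h, pairSum]
  refine Finset.sum_congr rfl fun x _ => ?_
  rw [wsum, wsum, Finset.sum_mul_sum]
  refine Finset.sum_congr rfl fun u _ => Finset.sum_congr rfl fun v _ => ?_
  rw [← hχ.mul]
  ring

theorem hasStructure_mul : HasStructure D (fun _ => 1) fun f g : Obs r => f * g := by
  intro g g' a b
  funext θ
  simp only [Pi.mul_apply, Pi.smul_apply, smul_eq_mul, ← expFun_mul]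
  ring

theorem mul_eq_lift₂ (A B : Formal r) : A * B = lift₂ (fun f g => f * g) A B := by
  funext m
  exact mvps_mul_apply A B m

theorem toF_wsum_pow {χ : List (NZCharge r) → ℂ} (hχ : IsShuffleChar χ) (W : Charge r → ℂ)
    (f : List (NZCharge r) → ℂ) (n : ℕ) :
    (toF 0 (wsum (fun w => cw D W w * f w) χ) : Formal r) ^ n =
      toF 0 (wsum (fun w => cw D W w * shPow f n w) χ) := by
  induction n with
  | zero =>
    rw [pow_zero, ← toF_one_add _ _ (by simp [cw_nil, shPow]) hχ.nil]
    have : (consFn fun a w => cw D W (a :: w) * shPow f 0 (a :: w)) = fun _ => 0 := by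
      funext w
      cases w <;> simp [consFn, shPow]
    rw [this]
    have h0 : (toF 0 (wsum (fun _ => 0) χ) : Formal r) = 0 := by
      funext m
      simp [toF, wsum]
      rfl
    rw [h0, add_zero]
  | succ n ih =>
    rw [pow_succ', ih, mul_eq_lift₂, lift₂_toF (D := D) hasStructure_mul, add_zero]
    congr 1
    funext m
    rw [brConv, shPow, ← sum_wsum_mul_wsum hχ]
    simp only [mul_one]

theorem expFormal_toF {χ : List (NZCharge r) → ℂ} (hχ : IsShuffleChar χ) (W : Charge r → ℂ)
    (γ : Charge r) : expFormal (toF 0 (wsum (fun w => cw D W w * muW D γ w) χ)) =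
      toF 0 (wsum (fun w => cw D W w * lamW D (fun n => (n : ℂ)) γ w) χ) := by
  funext m
  rw [expFormal, formalSum]
  simp only [mvps_smul_apply, toF_wsum_pow hχ]
  simp only [toF, smul_smul]
  rw [← Finset.sum_smul]
  congr 1
  simp only [wsum, Finset.mul_sum]
  rw [Finset.sum_comm]
  refine Finset.sum_congr rfl fun w hw => ?_
  rw [lamW_eq_sum_shPow γ (N := m.degree + 1) (by rw [length_of_mem_wordsOf hw]; omega),
    Finset.mul_sum, Finset.sum_mul]
  refine Finset.sum_congr rfl fun n _ => ?_
  ring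

/-- For this ansatz the sum-integral with weight ⟨γ,a⟩ has the coefficients `muW γ`, and its
exponential those of `lamW γ`, so it is a fixed point. -/
theorem XclReg_words (hε : 0 < ε) (hε1 : ε < 1) :
    D.XclReg ε = fun γ t => toF γ fun m => ef D γ t *
      wsum (fun w => cw D D.OmegaBarCl w * lamW D (fun n => (n : ℂ)) γ w)
        (fun w => wordInt D ε w t) m := by
  funext γ t
  refine iterate_eq_fixed (fun _ _ _ h => D.tbaStep_agree ε h)
    (X := fun γ t => toF γ fun m => ef D γ t *
      wsum (fun w => cw D D.OmegaBarCl w * lamW D (fun n => (n : ℂ)) γ w)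
        (fun w => wordInt D ε w t) m) ?_ γ t
  funext γ t
  have h := sumInt_words (D := D) D.OmegaBarCl hε hε1 (fun a => ((D.pairing γ a.1 : ℤ) : ℂ))
    (fun a w => cw D D.OmegaBarCl w * lamW D (fun n => (n : ℂ)) a.1 w)
    (X := fun a s => toF a.1 fun m => ef D a.1 s *
      wsum (fun w => cw D D.OmegaBarCl w * lamW D (fun n => (n : ℂ)) a.1 w)
        (fun w => wordInt D ε w s) m) (fun _ _ => rfl) t
  have e : (consFn fun (a : NZCharge r) w => cf D D.OmegaBarCl a * (D.pairing γ a.1 : ℂ) *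
      (cw D D.OmegaBarCl w * lamW D (fun n => (n : ℂ)) a.1 w)) =
      fun w => cw D D.OmegaBarCl w * muW D γ w := by
    funext w
    cases w with
    | nil => simp [consFn, muW]
    | cons a w =>
      rw [muW, consFn, consFn, cw_cons]
      ring
  rw [RefinedBPS.tbaStep, h, e, expFormal_toF (isShuffleChar_wordInt hε hε1 t), mul_eq_lift₂,
    lift₂_XsfF hasStructure_mul, add_zero]
  simp only [one_mul]

theorem eventually_XclReg (γ : Charge r) (t : ℂ) (m : NZCharge r →₀ ℕ) :
    ∀ᶠ ε in 𝓝[>] (0 : ℝ), D.XclReg ε γ t m = toF γ (fun m => ef D γ t *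
      wsum (fun w => cw D D.OmegaBarCl w * lamW D (fun n => (n : ℂ)) γ w)
        (fun w => limInt D w t) m) m := by
  filter_upwards [eventually_wordInt_wordsOf (D := D) t m] with ε hε
  simp only [XclReg_words hε.1.1 hε.1.2, toF, wsum_congr _ hε.2]

theorem Xcl_words (γ : Charge r) (t : ℂ) :
    D.Xcl γ t = toF γ fun m => ef D γ t *
      wsum (fun w => cw D D.OmegaBarCl w * lamW D (fun n => (n : ℂ)) γ w)
        (fun w => limInt D w t) m := by
  funext m θ
  exact (tendsto_of_eventually_eq_coeff (eventually_XclReg γ t m) θ).limUnder_eq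

theorem tendsto_XclReg (γ : Charge r) (t : ℂ) (m : NZCharge r →₀ ℕ) (θ : Fin r → ℂ) :
    Tendsto (fun ε => D.XclReg ε γ t m θ) (𝓝[>] (0 : ℝ)) (𝓝 (D.Xcl γ t m θ)) := by
  rw [Xcl_words]
  exact tendsto_of_eventually_eq_coeff (eventually_XclReg γ t m) θ

end Classical

/-! ### The limit y → 1. -/

section UnrefinedLimit

variable {r : ℕ} {D : RefinedBPS r}

theorem yGap_ne_zero {α : ℂ} (h : Generic α) : yGap α ≠ 0 := by
  intro h0
  -- y = y⁻¹ would give y² = 1.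
  refine h 2 two_pos (Units.ext ?_)
  rw [yGap, sub_eq_zero] at h0
  have h1 : yy α = (yy α)⁻¹ := Units.ext h0
  rw [sq]
  nth_rewrite 1 [h1]
  rw [inv_mul_cancel]

theorem hasDerivAt_yPow_sub (n : ℤ) :
    HasDerivAt (fun α => yPow α n - yPow α (-n)) (2 * (2 * Real.pi * Complex.I) * n) 0 := by
  have h : ∀ n : ℤ, HasDerivAt (fun α => yPow α n) (2 * Real.pi * Complex.I * n) 0 := by
    intro n
    have := (((hasDerivAt_id (0 : ℂ)).const_mul (2 * Real.pi * Complex.I)).mul_const (n : ℂ)).cexp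
    simpa [yPow] using this
  refine ((h n).sub (h (-n))).congr_deriv ?_
  push_cast
  ring

theorem tendsto_yPow_sub_div (n : ℤ) :
    Tendsto (fun α => α⁻¹ * (yPow α n - yPow α (-n))) (𝓝[≠] 0)
      (𝓝 (2 * (2 * Real.pi * Complex.I) * n)) := by
  have := hasDerivAt_iff_tendsto_slope_zero.1 (hasDerivAt_yPow_sub n)
  simpa [yPow] using this

/-- Both differences vanish at α = 0 with derivative proportional to the exponent. This gives the
limit of `kap` and one of the factors 1/d in the classical rational indices. -/
theorem tendsto_yPow_sub_div_yPow_sub (n k : ℤ) (hk : k ≠ 0) :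
    Tendsto (fun α => (yPow α k - yPow α (-k))⁻¹ * (yPow α n - yPow α (-n))) (𝓝[≠] 0)
      (𝓝 ((k : ℂ)⁻¹ * n)) := by
  have hP : (2 * (2 * Real.pi * Complex.I) : ℂ) ≠ 0 :=
    mul_ne_zero two_ne_zero Complex.two_pi_I_ne_zero
  have hk' : (k : ℂ) ≠ 0 := by exact_mod_cast hk
  have h := ((tendsto_yPow_sub_div k).inv₀ (mul_ne_zero hP hk')).mul (tendsto_yPow_sub_div n)
  have e : (2 * (2 * Real.pi * Complex.I) * (k : ℂ))⁻¹ * (2 * (2 * Real.pi * Complex.I) * n) =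
      (k : ℂ)⁻¹ * n := by
    rw [mul_inv, mul_mul_mul_comm, inv_mul_cancel₀ hP, one_mul]
  rw [e] at h
  refine h.congr' ?_
  filter_upwards [self_mem_nhdsWithin] with α hα
  rw [mul_inv, inv_inv, mul_mul_mul_comm, mul_inv_cancel₀ hα, one_mul]

theorem tendsto_kap (n : ℤ) : Tendsto (fun α => kap α n) (𝓝[≠] 0) (𝓝 (n : ℂ)) := by
  have := tendsto_yPow_sub_div_yPow_sub n 1 one_ne_zero
  simpa only [kap, yGap_eq, Int.cast_one, inv_one, one_mul] using this

theorem eventually_yGap_ne_zero : ∀ᶠ α in 𝓝[≠] (0 : ℂ), yGap α ≠ 0 := by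
  have h := (hasDerivAt_yPow_sub 1).eventually_ne (c := 0) (by
    rw [Int.cast_one, mul_one]
    exact mul_ne_zero two_ne_zero Complex.two_pi_I_ne_zero)
  filter_upwards [h] with α hα
  rwa [yGap_eq]

theorem coe_yy_zpow (α : ℂ) (n : ℤ) : ((yy α ^ n : ℂˣ) : ℂ) = yPow α n := by
  rw [Units.val_zpow_eq_zpow_val, yy, Units.val_mk0, ← Complex.exp_int_mul, yPow, mul_comm]

theorem continuous_yPow (n : ℤ) : Continuous fun α => yPow α n := by
  unfold yPow
  fun_prop

theorem continuous_OmegaAt (γ : Charge r) (d : ℕ) : Continuous fun α => D.OmegaAt γ (yy α ^ d) := by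
  unfold RefinedBPS.OmegaAt
  generalize D.Ω γ = p
  induction p using LaurentPolynomial.induction_on' with
  | add p q hp hq => simp only [map_add]; exact hp.add hq
  | C_mul_T n a =>
    simp only [LaurentPolynomial.eval₂_C_mul_T]
    refine continuous_const.mul ((continuous_yPow (d * n)).congr fun α => ?_)
    rw [← coe_yy_zpow, zpow_mul, zpow_natCast]

theorem tendsto_OmegaBar (γ : Charge r) :
    Tendsto (fun α => D.OmegaBar α γ) (𝓝[≠] 0) (𝓝 (D.OmegaBarCl γ)) := by
  refine tendsto_finsetSum _ fun d hd => ?_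
  have hd0 : (d : ℤ) ≠ 0 := by exact_mod_cast (Nat.pos_of_mem_divisors hd).ne'
  have h1 := (tendsto_yPow_sub_div_yPow_sub 1 d hd0).const_mul (1 / (d : ℂ))
  have h2 : Tendsto (fun α => D.OmegaAt (fun a => γ a / (d : ℤ)) (yy α ^ d)) (𝓝[≠] 0)
      (𝓝 (D.OmegaAt (fun a => γ a / (d : ℤ)) 1)) := by
    have e : yy 0 ^ d = 1 := by
      have : yy 0 = 1 := Units.ext (by simp [yy])
      rw [this, one_pow]
    have := (continuous_OmegaAt (D := D) (fun a => γ a / (d : ℤ)) d).tendsto 0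
    rw [e] at this
    exact this.mono_left nhdsWithin_le_nhds
  convert h1.mul h2 using 2 with α
  · congr 2
    rw [← yGap_eq, ← coe_yy_zpow, ← coe_yy_zpow, zpow_neg, zpow_natCast, div_eq_inv_mul]
  · push_cast
    ring

theorem tendsto_cf (a : NZCharge r) :
    Tendsto (fun α => cf D (D.OmegaBar α) a) (𝓝[≠] 0) (𝓝 (cf D D.OmegaBarCl a)) :=
  ((tendsto_OmegaBar a.1).const_mul _).div_const _

theorem tendsto_cw (w : List (NZCharge r)) :
    Tendsto (fun α => cw D (D.OmegaBar α) w) (𝓝[≠] 0) (𝓝 (cw D D.OmegaBarCl w)) := by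
  induction w with
  | nil => exact tendsto_const_nhds
  | cons a w ih =>
    simp only [cw_cons]
    exact (tendsto_cf a).mul ih

theorem tendsto_lamW (γ : Charge r) (w : List (NZCharge r)) :
    Tendsto (fun α => lamW D (kap α) γ w) (𝓝[≠] 0) (𝓝 (lamW D (fun n => (n : ℂ)) γ w)) := by
  induction w generalizing γ with
  | nil => exact tendsto_const_nhds
  | cons a w ih => exact (tendsto_kap _).mul (ih _)

theorem tendsto_headC (w : List (NZCharge r)) :
    Tendsto (fun α => headC D (D.OmegaBar α) (kap α) w) (𝓝[≠] 0)
      (𝓝 (headC D D.OmegaBarCl (fun n => (n : ℂ)) w)) := by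
  cases w with
  | nil => exact tendsto_const_nhds
  | cons a w => exact (tendsto_cw _).mul (tendsto_lamW _ _)

theorem tendsto_wsum {ι : Type*} {l : Filter ι} {K : ι → List (NZCharge r) → ℂ}
    {K' : List (NZCharge r) → ℂ} (h : ∀ w, Tendsto (fun i => K i w) l (𝓝 (K' w)))
    (χ : List (NZCharge r) → ℂ) (m : NZCharge r →₀ ℕ) :
    Tendsto (fun i => wsum (K i) χ m) l (𝓝 (wsum K' χ m)) :=
  tendsto_finsetSum _ fun w _ => (h w).mul_const _

variable (D) in
/-- The coefficients of the generating function of the `X_γ`. -/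
def hamCoef (W : Charge r → ℂ) (κ : ℤ → ℂ) (t : ℂ) (m : NZCharge r →₀ ℕ) : ℂ :=
  (m.degree : ℂ)⁻¹ * wsum (headC D W κ) (wordLog fun w => limInt D w t) m

theorem tendsto_hamCoef (t : ℂ) (m : NZCharge r →₀ ℕ) :
    Tendsto (fun α => hamCoef D (D.OmegaBar α) (kap α) t m) (𝓝[≠] 0)
      (𝓝 (hamCoef D D.OmegaBarCl (fun n => (n : ℂ)) t m)) :=
  (tendsto_wsum tendsto_headC _ m).const_mul _

theorem tendsto_toF {ι : Type*} {l : Filter ι} {c : ι → (NZCharge r →₀ ℕ) → ℂ}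
    {c' : (NZCharge r →₀ ℕ) → ℂ} {m : NZCharge r →₀ ℕ}
    (h : Tendsto (fun i => c i m) l (𝓝 (c' m))) (δ : Charge r) (θ : Fin r → ℂ) :
    Tendsto (fun i => toF δ (c i) m θ) l (𝓝 (toF δ c' m θ)) :=
  h.mul_const (expFun (δ + wt m) θ)

theorem tendsto_Href_toF (t : ℂ) (m : NZCharge r →₀ ℕ) (θ : Fin r → ℂ) :
    Tendsto (fun α => D.Href α t m θ) (𝓝[≠] 0)
      (𝓝 (toF 0 (hamCoef D D.OmegaBarCl (fun n => (n : ℂ)) t) m θ)) := by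
  refine (tendsto_toF (tendsto_hamCoef t m) 0 θ).congr' ?_
  filter_upwards [eventually_yGap_ne_zero] with α hα
  rw [Href_words hα]
  rfl

theorem Hcl_eq (t : ℂ) : D.Hcl t = toF 0 (hamCoef D D.OmegaBarCl (fun n => (n : ℂ)) t) := by
  funext m θ
  exact (tendsto_Href_toF t m θ).limUnder_eq

theorem tendsto_X (γ : Charge r) (t : ℂ) (m : NZCharge r →₀ ℕ) (θ : Fin r → ℂ) :
    Tendsto (fun α => D.X α γ t m θ) (𝓝[≠] 0) (𝓝 (D.Xcl γ t m θ)) := by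
  rw [Xcl_words]
  simp only [X_words]
  exact tendsto_toF ((tendsto_wsum (fun w => (tendsto_cw w).mul (tendsto_lamW γ w)) _ m).const_mul _)
    γ θ

theorem expNegBracket_toF {χ : ℤ → ℂ} {op : Obs r → Obs r → Obs r} (h : HasStructure D χ op)
    (γ : Charge r) (c c' : (NZCharge r →₀ ℕ) → ℂ) :
    expNegBracket (lift₂ op) (toF 0 c) (toF γ c') = toF γ fun m =>
      ∑ n ∈ Finset.range (m.degree + 1), (-1 : ℂ) ^ n / (n.factorial : ℂ) *
        (brConv D χ 0 c γ)^[n] c' m := by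
  have hit : ∀ n, (lift₂ op (toF 0 c))^[n] (toF γ c') = toF γ ((brConv D χ 0 c γ)^[n] c') := by
    intro n
    induction n with
    | zero => rfl
    | succ n ih =>
      rw [Function.iterate_succ_apply', ih, lift₂_toF h, zero_add, Function.iterate_succ_apply']
  funext m
  rw [expNegBracket, formalSum, toF, Finset.sum_smul]
  refine Finset.sum_congr rfl fun n _ => ?_
  rw [hit, mvps_smul_apply, toF, smul_smul]

theorem tendsto_brConv_iterate {ι : Type*} {l : Filter ι} {χ : ι → ℤ → ℂ} {χ' : ℤ → ℂ}
    {c : ι → (NZCharge r →₀ ℕ) → ℂ} {c' : (NZCharge r →₀ ℕ) → ℂ}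
    (hχ : ∀ k, Tendsto (fun i => χ i k) l (𝓝 (χ' k)))
    (hc : ∀ m, Tendsto (fun i => c i m) l (𝓝 (c' m))) (γ : Charge r)
    (b : (NZCharge r →₀ ℕ) → ℂ) (n : ℕ) (m : NZCharge r →₀ ℕ) :
    Tendsto (fun i => (brConv D (χ i) 0 (c i) γ)^[n] b m) l
      (𝓝 ((brConv D χ' 0 c' γ)^[n] b m)) := by
  induction n generalizing m with
  | zero => exact tendsto_const_nhds
  | succ n ih =>
    simp only [Function.iterate_succ_apply']
    exact tendsto_finsetSum _ fun x _ => ((hc _).mul (ih _)).mul (hχ _)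

/-- The refined identity passes to the limit: each coefficient is a finite sum in the coefficients
of H^ref and the structure constants, which all converge. Uniqueness of limits concludes. -/
theorem Xcl_eq_expNegBracket (γ : Charge r) (t : ℂ) :
    D.Xcl γ t = expNegBracket (lift₂ D.poissonBr) (D.Hcl t) (D.XsfF γ t) := by
  rw [Hcl_eq, XsfF_eq_toF, expNegBracket_toF hasStructure_poissonBr]
  funext m θ
  refine tendsto_nhds_unique (tendsto_X γ t m θ) ?_
  have hlim := tendsto_finsetSum (Finset.range (m.degree + 1)) fun n _ =>
    (tendsto_brConv_iterate (D := D) tendsto_kap (tendsto_hamCoef (D := D) t) γ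
      (fun m => if m = 0 then ef D γ t else 0) n m).const_mul ((-1 : ℂ) ^ n / (n.factorial : ℂ))
  refine (hlim.mul_const (expFun (γ + wt m) θ)).congr' ?_
  filter_upwards [eventually_yGap_ne_zero] with α hα
  rw [X_eq_expNegBracket hα, Href_words hα, XsfF_eq_toF, expNegBracket_toF (hasStructure_starBr α)]
  rfl

end UnrefinedLimit

end QRH

end

theorem mainTheorem6 {r : ℕ} (D : QRH.RefinedBPS r) :
    -- generic `y`
    (∀ α : ℂ, QRH.Generic α → ∀ t : ℂ, D.OffRays t →
      -- the nested integrals defining `J^ref` and `X^ref` exist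
      (∀ m θ, Tendsto (fun ε => D.JrefReg α ε t m θ) (𝓝[>] (0 : ℝ)) (𝓝 (D.Jref α t m θ))) ∧
      (∀ γ m θ, Tendsto (fun ε => D.XrefReg α ε γ t m θ) (𝓝[>] (0 : ℝ))
        (𝓝 (D.Xref α γ t m θ))) ∧
      -- `H^ref` generates all the `X_γ`
      (∀ γ, D.X α γ t =
        QRH.expNegBracket (QRH.lift₂ (D.starBr α)) (D.Href α t) (D.XsfF γ t)) ∧
      -- `H^ref` as a series of nested star brackets
      (∀ m θ, Tendsto (fun ε => D.bracketSeries (D.starBr α) (D.OmegaBar α) ε t m θ)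
        (𝓝[>] (0 : ℝ)) (𝓝 (D.Href α t m θ)))) ∧
    -- the unrefined limit
    (∀ t : ℂ, D.OffRays t →
      (∀ m θ, Tendsto (fun α => D.Href α t m θ) (𝓝[≠] (0 : ℂ)) (𝓝 (D.Hcl t m θ))) ∧
      (∀ m θ, Tendsto (fun ε => D.bracketSeries D.poissonBr D.OmegaBarCl ε t m θ)
        (𝓝[>] (0 : ℝ)) (𝓝 (D.Hcl t m θ))) ∧
      (∀ γ m θ, Tendsto (fun ε => D.XclReg ε γ t m θ) (𝓝[>] (0 : ℝ)) (𝓝 (D.Xcl γ t m θ))) ∧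
      (∀ γ m θ, Tendsto (fun α => D.X α γ t m θ) (𝓝[≠] (0 : ℂ)) (𝓝 (D.Xcl γ t m θ))) ∧
      (∀ γ, D.Xcl γ t =
        QRH.expNegBracket (QRH.lift₂ D.poissonBr) (D.Hcl t) (D.XsfF γ t))) := by
  refine ⟨fun α hα t _ => ⟨QRH.tendsto_JrefReg α t, fun γ => QRH.tendsto_XrefReg α γ t,
      fun γ => QRH.X_eq_expNegBracket (QRH.yGap_ne_zero hα) γ t, fun m θ => ?_⟩,
    fun t _ => ⟨fun m θ => ?_, fun m θ => ?_, fun γ => QRH.tendsto_XclReg γ t,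
      fun γ => QRH.tendsto_X γ t, fun γ => QRH.Xcl_eq_expNegBracket γ t⟩⟩
  · rw [QRH.Href_words (QRH.yGap_ne_zero hα)]
    exact QRH.tendsto_bracketSeries (QRH.hasStructure_starBr α) _ t m θ
  · rw [QRH.Hcl_eq]
    exact QRH.tendsto_Href_toF t m θ
  · rw [QRH.Hcl_eq]
    exact QRH.tendsto_bracketSeries QRH.hasStructure_poissonBr _ t m θ
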